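/- Let $D\subset\mathbb R^d$ be compact and let $H_k(D)$ be a reproducing kernel Hilbert space of real functions on $D$ whose kernel $k$ is continuous with $k(x,x)\le 1$ on $D$. Let $f_1,\dots,f_T\in H_k(D)$ be fixed functions with $\|f_t\|_H\le B$ and $\sum_{t=1}^{T-1}\|f_{t+1}-f_t\|_H\le B_T$, and let $x_t^*\in\arg\max_{x\in D}f_t(x)$. In round $t=1,\dots,T$ a point $x_t\in D$ is queried and $y_t=f_t(x_t)+\epsilon_t$ is observed, where, for some $R\ge 0$, $\mathbb E[e^{u\epsilon_t}\mid\mathcal F_{t-1}]\le e^{u^2R^2/2}$ for all $u\in\mathbb R$, with $\mathcal F_{t-1}=\sigma(x_1,y_1,\dots,x_{t-1},y_{t-1},x_t)$. Let $\lambda>0$, $0<\delta<1$, $0<\eta<1$, $w_t=\eta^{-t}$, $\lambda_t=\lambda w_t$, $\alpha_t=\lambda w_t^2$ and $W=W_t=\mathrm{diag}(\sqrt{w_1},\dots,\sqrt{w_t})$. Put $K_t=[k(x_i,x_j)]_{i,j\le t}$, $\tilde K_t=WK_tW^{\top}$, $\tilde k_t(x)=W[k(x_1,x),\dots,k(x_t,x)]^{\top}$,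 $\tilde y_{1:t}=W[y_1,\dots,y_t]^{\top}$, $$\tilde\mu_t(x)=\tilde k_t(x)^{\top}(\tilde K_t+\lambda_tI)^{-1}\tilde y_{1:t},\qquad \tilde\sigma_t^2(x)=k(x,x)-\tilde k_t(x)^{\top}(\tilde K_t+\lambda_tI)^{-1}\tilde k_t(x),$$ $$\bar\gamma_t=\max_{a_1,\dots,a_t\in D}\tfrac12\log\det\!\big(I+\alpha_t^{-1}W^2[k(a_i,a_j)]_{i,j}(W^2)^{\top}\big),\qquad \beta_t=B+\tfrac{1}{\sqrt\lambda}R\sqrt{2\log\tfrac1\delta+2\bar\gamma_t}.$$ Suppose that the points are chosen by WGP-UCB, i.e. $x_t\in\arg\max_{x\in D}\tilde\mu_{t-1}(x)+\beta_{t-1}\tilde\sigma_{t-1}(x)$ for $t=1,\dots,T$. Let $\breve\varphi:D\to\mathbb R^m$ be a (measurable) feature map with $|k(x,y)-\breve\varphi(x)^{\top}\breve\varphi(y)|\le\varepsilon_m$ for all $x,y\in D$, and let $\breve\gamma_t=\frac12\log\det(I+\lambda_t^{-1}\breve\Phi_t\breve\Phi_t^{\top})$ with $\breve\Phi_t=W[\breve\varphi(x_1),\dots,\breve\varphi(x_t)]^{\top}$.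 Then for every integer $c\ge 1$, with probability at least $1-\delta$ the dynamic regret $R_T=\sum_{t=1}^T\big(f_t(x_t^*)-f_t(x_t)\big)$ satisfies $$R_T\le C\Big(\beta_T\sqrt{T\breve\gamma_T+mT^2\log\tfrac1\eta}+c^{3/2}B_T\sqrt{\max_{0\le t\le T}\breve\gamma_t+mc\log\tfrac1\eta}+\frac{B\eta^c}{1-\eta}T+B_T\frac{c^2\sqrt{\varepsilon_m}}{1-\eta}+\frac{\beta_TT\sqrt{\varepsilon_m}}{1-\eta}\Big),$$ where the constant $C>0$ depends only on $\lambda$. -/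

import Mathlib

open MeasureTheory
open scoped Matrix

noncomputable section

namespace WGPUCB

/-! ### Kernel of a real reproducing kernel Hilbert space -/

/-- The real-valued kernel `k(x, x')` of a reproducing kernel Hilbert space `H` of real functions
on `X`; Mathlib's `RKHS.kernel` is valued in `ℝ →L[ℝ] ℝ`. -/
def kernelFun (H : Type*) {X : Type*} [NormedAddCommGroup H] [InnerProductSpace ℝ H]
    [CompleteSpace H] [RKHS ℝ H X ℝ] (x x' : X) : ℝ :=
  RKHS.kernel H x x' 1

/-! ### Weighted Gaussian process regression

Rounds are numbered from `1`, so the index `i : Fin t` stands for the round `i + 1`. -/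

section Regression

variable {X : Type*} (k : X → X → ℝ) (w : ℕ → ℝ) (lam : ℝ) (x : ℕ → X) (y : ℕ → ℝ) (t : ℕ)

/-- `W = diag(√w₁, …, √w_t)`. -/
def weightMatrix : Matrix (Fin t) (Fin t) ℝ :=
  Matrix.diagonal fun i => √(w (i + 1))

/-- The regularizer `λ_t = λ w_t`. -/
def reg : ℝ := lam * w t

/-- The regularizer `α_t = λ w_t²` of the double-weighted problem. -/
def doubleReg : ℝ := lam * w t ^ 2

/-- The kernel matrix `[k(a_i, a_j)]` of a tuple of points. -/
def gram (a : Fin t → X) : Matrix (Fin t) (Fin t) ℝ :=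
  Matrix.of fun i j => k (a i) (a j)

/-- The weighted kernel matrix `K̃_t = W K_t Wᵀ`. -/
def weightedGram : Matrix (Fin t) (Fin t) ℝ :=
  weightMatrix w t * gram k t (fun i => x (i + 1)) * (weightMatrix w t)ᵀ

/-- The weighted kernel vector `k̃_t(z) = W k_t(z)`. -/
def weightedKernelVec (z : X) : Fin t → ℝ :=
  weightMatrix w t *ᵥ fun i => k (x (i + 1)) z

/-- The weighted observations `ỹ_{1:t} = W y_{1:t}`. -/
def weightedObs : Fin t → ℝ :=
  weightMatrix w t *ᵥ fun i => y (i + 1)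

/-- The weighted posterior mean
`μ̃_t(z) = k̃_t(z)ᵀ (K̃_t + λ_t I)⁻¹ ỹ_{1:t}`. -/
def postMean (z : X) : ℝ :=
  weightedKernelVec k w x t z ⬝ᵥ
    ((weightedGram k w x t + reg w lam t • (1 : Matrix (Fin t) (Fin t) ℝ))⁻¹ *ᵥ
      weightedObs w y t)

/-- The weighted posterior variance
`σ̃_t²(z) = k(z, z) - k̃_t(z)ᵀ (K̃_t + λ_t I)⁻¹ k̃_t(z)`. -/
def postVar (z : X) : ℝ :=
  k z z - weightedKernelVec k w x t z ⬝ᵥ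
    ((weightedGram k w x t + reg w lam t • (1 : Matrix (Fin t) (Fin t) ℝ))⁻¹ *ᵥ
      weightedKernelVec k w x t z)

/-- The weighted posterior standard deviation `σ̃_t(z)`. -/
def postStd (z : X) : ℝ := √(postVar k w lam x t z)

/-- The double-weighted maximum information gain `γ̄_t`, the maximum of
`½ log det(I + α_t⁻¹ W² K_A (W²)ᵀ)` over all choices `A = (a₁, …, a_t)` of `t` query points,
repetitions allowed. -/
def doubleGain : ℝ :=
  ⨆ a : Fin t → X, (1 / 2) * Real.log
    (1 + (doubleReg w lam t)⁻¹ •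
      (weightMatrix w t ^ 2 * gram k t a * (weightMatrix w t ^ 2)ᵀ)).det

/-- The confidence width `β_t = B + λ^{-1/2} R √(2 log(1/δ) + 2 γ̄_t)`. -/
def confWidth (B R δ : ℝ) : ℝ :=
  B + (1 / √lam) * R * √(2 * Real.log (1 / δ) + 2 * doubleGain k w lam t)

/-- The upper confidence bound `μ̃_t(z) + β_t σ̃_t(z)`. -/
def ucb (B R δ : ℝ) (z : X) : ℝ :=
  postMean k w lam x y t z + confWidth k w lam t B R δ * postStd k w lam x t z

/-- The weighted feature matrix `Φ̆_t = W [φ̆(x₁), …, φ̆(x_t)]ᵀ` of an `m`-dimensional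
feature map. -/
def featMatrix {m : ℕ} (feat : X → EuclideanSpace ℝ (Fin m)) : Matrix (Fin t) (Fin m) ℝ :=
  weightMatrix w t * Matrix.of fun (i : Fin t) (j : Fin m) => feat (x (i + 1)) j

/-- `γ̆_t = ½ log det(I + λ_t⁻¹ Φ̆_t Φ̆_tᵀ)`, along the trajectory `x`. -/
def featGain {m : ℕ} (feat : X → EuclideanSpace ℝ (Fin m)) : ℝ :=
  (1 / 2) * Real.log
    (1 + (reg w lam t)⁻¹ • (featMatrix w x t feat * (featMatrix w x t feat)ᵀ)).det

/-- `max_{0 ≤ t ≤ T} γ̆_t`. -/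
def maxFeatGain {m : ℕ} (T : ℕ) (feat : X → EuclideanSpace ℝ (Fin m)) : ℝ :=
  (Finset.range (T + 1)).sup' Finset.nonempty_range_add_one
    fun t => featGain w lam x t feat

end Regression

/-- The exponentially increasing weights `w_t = η^{-t}`. -/
def expWeight (η : ℝ) (t : ℕ) : ℝ := (η ^ t)⁻¹

/-! ### The bandit problem -/

/-- `σ(x₁, y₁, …, x_{t-1}, y_{t-1}, x_t)`. -/
abbrev historySigma {Ω X : Type*} [MeasurableSpace X] (x : ℕ → Ω → X) (y : ℕ → Ω → ℝ) (t : ℕ) :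
    MeasurableSpace Ω :=
  (⨆ s ∈ Finset.Ico 1 t,
      (MeasurableSpace.comap (x s) inferInstance ⊔ MeasurableSpace.comap (y s) inferInstance)) ⊔
    MeasurableSpace.comap (x t) inferInstance

/-- `ξ` is `R`-sub-Gaussian conditionally on `F`: `𝔼[exp(u ξ) | F] ≤ exp(u² R² / 2)` almost
surely for every real `u`. -/
def CondSubGaussian {Ω : Type*} [MeasurableSpace Ω] (μ : Measure Ω) (F : MeasurableSpace Ω)
    (ξ : Ω → ℝ) (R : ℝ) : Prop :=
  ∀ u : ℝ, Integrable (fun ω => Real.exp (u * ξ ω)) μ ∧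
    μ[fun ω => Real.exp (u * ξ ω) | F] ≤ᵐ[μ] fun _ => Real.exp (u ^ 2 * R ^ 2 / 2)

/-- The run `x` of WGP-UCB with weights `w` during the rounds `1, …, T`, given the observed
rewards `y`: in round `t` a maximizer of `μ̃_{t-1} + β_{t-1} σ̃_{t-1}` is queried. -/
def IsRun {X : Type*} (k : X → X → ℝ) (w : ℕ → ℝ) (lam B R δ : ℝ) (T : ℕ)
    (x : ℕ → X) (y : ℕ → ℝ) : Prop :=
  ∀ t ∈ Finset.Icc 1 T, ∀ z : X,
    ucb k w lam x y (t - 1) B R δ z ≤ ucb k w lam x y (t - 1) B R δ (x t)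

/-- The dynamic regret `R_T = ∑_{t=1}^T (f_t(x_t^*) - f_t(x_t))`. -/
def dynRegret {X : Type*} (f : ℕ → X → ℝ) (xstar x : ℕ → X) (T : ℕ) : ℝ :=
  ∑ t ∈ Finset.Icc 1 T, (f t (xstar t) - f t (x t))

end WGPUCB

end

noncomputable section

namespace WGPUCB

section Ridge

variable {ι E : Type*} [NormedAddCommGroup E] [InnerProductSpace ℝ E]

/-- The regularized covariance operator `p + ∑ ψᵢ ψᵢᵀ`. -/
def ridge (ψ : ι → E) (s : Finset ι) (p : ℝ) (u : E) : E :=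
  p • u + ∑ i ∈ s, inner ℝ (ψ i) u • ψ i

/-- The inverse of the regularized covariance operator. -/
def ridgeInv (ψ : ι → E) (s : Finset ι) (p : ℝ) : E → E :=
  Function.invFun (ridge ψ s p)

/-- The bilinear form of the inverse of the regularized covariance operator. -/
def ridgeForm (ψ : ι → E) (s : Finset ι) (p : ℝ) (z z' : E) : ℝ :=
  inner ℝ z (ridgeInv ψ s p z')

variable {ψ : ι → E} {s : Finset ι} {p : ℝ}

lemma ridge_add (u v : E) : ridge ψ s p (u + v) = ridge ψ s p u + ridge ψ s p v := by
  simp only [ridge, inner_add_right, add_smul, Finset.sum_add_distrib, smul_add]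
  abel

lemma ridge_smul (c : ℝ) (u : E) : ridge ψ s p (c • u) = c • ridge ψ s p u := by
  simp only [ridge, inner_smul_right, mul_smul, smul_add, Finset.smul_sum]
  rw [smul_comm]

lemma ridge_sub (u v : E) : ridge ψ s p (u - v) = ridge ψ s p u - ridge ψ s p v := by
  have := ridge_add (ψ := ψ) (s := s) (p := p) (u - v) v
  rw [sub_add_cancel] at this
  rw [this, add_sub_cancel_right]

lemma inner_ridge (u v : E) :
    inner ℝ u (ridge ψ s p v) =
      p * inner ℝ u v + ∑ i ∈ s, inner ℝ (ψ i) u * inner ℝ (ψ i) v := by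
  simp only [ridge, inner_add_right, inner_smul_right, inner_sum]
  congr 1
  refine Finset.sum_congr rfl fun i _ => ?_
  rw [real_inner_comm u (ψ i)]
  ring

lemma inner_ridge_self (u : E) :
    inner ℝ u (ridge ψ s p u) = p * ‖u‖ ^ 2 + ∑ i ∈ s, inner ℝ (ψ i) u ^ 2 := by
  rw [inner_ridge, real_inner_self_eq_norm_sq]
  simp only [sq]

lemma inner_ridge_comm (u v : E) :
    inner ℝ u (ridge ψ s p v) = inner ℝ (ridge ψ s p u) v := by
  rw [inner_ridge, real_inner_comm v (ridge ψ s p u), inner_ridge, real_inner_comm u v]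
  congr 1
  exact Finset.sum_congr rfl fun i _ => mul_comm _ _

lemma ridge_insert [DecidableEq ι] {i : ι} (hi : i ∉ s) (u : E) :
    ridge ψ (insert i s) p u = ridge ψ s p u + inner ℝ (ψ i) u • ψ i := by
  simp only [ridge, Finset.sum_insert hi]
  abel

lemma inner_ridge_self_ge (u : E) : p * ‖u‖ ^ 2 ≤ inner ℝ u (ridge ψ s p u) := by
  rw [inner_ridge_self]
  exact le_add_of_nonneg_right (Finset.sum_nonneg fun i _ => sq_nonneg _)

lemma ridge_injective (hp : 0 < p) : Function.Injective (ridge ψ s p) := by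
  intro u v h
  have h0 : ridge ψ s p (u - v) = 0 := by rw [ridge_sub, h, sub_self]
  have h1 := inner_ridge_self_ge (ψ := ψ) (s := s) (p := p) (u - v)
  rw [h0, inner_zero_right] at h1
  have h2 : ‖u - v‖ ^ 2 ≤ 0 := by
    by_contra hc
    push Not at hc
    have := mul_pos hp hc
    linarith
  have h3 : ‖u - v‖ = 0 := by nlinarith [norm_nonneg (u - v)]
  exact sub_eq_zero.mp (norm_eq_zero.mp h3)

lemma ridge_surjective (hp : 0 < p) : Function.Surjective (ridge ψ s p) := by
  classical
  induction s using Finset.induction_on with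
  | empty =>
    intro z
    exact ⟨p⁻¹ • z, by simp [ridge, hp.ne']⟩
  | insert i s hi ih =>
    intro z
    obtain ⟨u, hu⟩ := ih z
    obtain ⟨v, hv⟩ := ih (ψ i)
    have ha : 0 ≤ inner ℝ (ψ i) v := by
      rw [← hv, real_inner_comm]
      exact le_trans (by positivity) (inner_ridge_self_ge v)
    refine ⟨u - (inner ℝ (ψ i) u / (1 + inner ℝ (ψ i) v)) • v, ?_⟩
    rw [ridge_insert hi, ridge_sub, ridge_smul, hu, hv, inner_sub_right, inner_smul_right,
      sub_add, ← sub_smul]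
    rw [show inner ℝ (ψ i) u / (1 + inner ℝ (ψ i) v) -
      (inner ℝ (ψ i) u - inner ℝ (ψ i) u / (1 + inner ℝ (ψ i) v) * inner ℝ (ψ i) v) = 0 by
        have : 1 + inner ℝ (ψ i) v ≠ 0 := by positivity
        field_simp
        ring]
    simp

lemma ridge_ridgeInv (hp : 0 < p) (z : E) : ridge ψ s p (ridgeInv ψ s p z) = z :=
  Function.invFun_eq (ridge_surjective hp z)

lemma ridgeInv_eq (hp : 0 < p) {u z : E} (h : ridge ψ s p u = z) : ridgeInv ψ s p z = u :=
  ridge_injective hp (by rw [ridge_ridgeInv hp, h])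

lemma ridgeInv_add (hp : 0 < p) (z z' : E) :
    ridgeInv ψ s p (z + z') = ridgeInv ψ s p z + ridgeInv ψ s p z' :=
  ridgeInv_eq hp (by rw [ridge_add, ridge_ridgeInv hp, ridge_ridgeInv hp])

lemma ridgeInv_smul (hp : 0 < p) (c : ℝ) (z : E) :
    ridgeInv ψ s p (c • z) = c • ridgeInv ψ s p z :=
  ridgeInv_eq hp (by rw [ridge_smul, ridge_ridgeInv hp])

lemma ridgeForm_comm (hp : 0 < p) (z z' : E) :
    ridgeForm ψ s p z z' = ridgeForm ψ s p z' z := by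
  unfold ridgeForm
  nth_rewrite 1 [← ridge_ridgeInv (ψ := ψ) (s := s) hp z]
  rw [← inner_ridge_comm, ridge_ridgeInv hp, real_inner_comm]

lemma ridgeForm_add_right (hp : 0 < p) (z u v : E) :
    ridgeForm ψ s p z (u + v) = ridgeForm ψ s p z u + ridgeForm ψ s p z v := by
  simp [ridgeForm, ridgeInv_add hp, inner_add_right]

lemma ridgeForm_smul_right (hp : 0 < p) (c : ℝ) (z u : E) :
    ridgeForm ψ s p z (c • u) = c * ridgeForm ψ s p z u := by
  simp [ridgeForm, ridgeInv_smul hp, inner_smul_right]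

lemma ridgeForm_add_left (z u v : E) :
    ridgeForm ψ s p (u + v) z = ridgeForm ψ s p u z + ridgeForm ψ s p v z := by
  simp [ridgeForm, inner_add_left]

lemma ridgeForm_smul_left (c : ℝ) (z u : E) :
    ridgeForm ψ s p (c • u) z = c * ridgeForm ψ s p u z := by
  simp [ridgeForm, inner_smul_left]

lemma ridgeForm_smul_smul (hp : 0 < p) (c : ℝ) (z : E) :
    ridgeForm ψ s p (c • z) (c • z) = c ^ 2 * ridgeForm ψ s p z z := by
  rw [ridgeForm_smul_left, ridgeForm_smul_right hp]
  ring

lemma ridgeForm_self (hp : 0 < p) (z : E) :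
    ridgeForm ψ s p z z =
      p * ‖ridgeInv ψ s p z‖ ^ 2 + ∑ i ∈ s, inner ℝ (ψ i) (ridgeInv ψ s p z) ^ 2 := by
  rw [← inner_ridge_self, ridge_ridgeInv hp, ridgeForm, real_inner_comm]

lemma ridgeForm_self_nonneg (hp : 0 < p) (z : E) : 0 ≤ ridgeForm ψ s p z z := by
  rw [ridgeForm_self hp]
  exact add_nonneg (by positivity) (Finset.sum_nonneg fun i _ => sq_nonneg _)

lemma ridgeForm_empty (hp : 0 < p) (z z' : E) :
    ridgeForm ψ ∅ p z z' = p⁻¹ * inner ℝ z z' := by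
  rw [ridgeForm, ridgeInv_eq (u := p⁻¹ • z') hp (by simp [ridge, hp.ne']), inner_smul_right]

lemma two_inner_sub_le_ridgeForm (hp : 0 < p) (z u : E) :
    2 * inner ℝ z u - inner ℝ u (ridge ψ s p u) ≤ ridgeForm ψ s p z z := by
  set v := ridgeInv ψ s p z with hv
  have hz : ridge ψ s p v = z := ridge_ridgeInv hp z
  have h := inner_ridge_self_ge (ψ := ψ) (s := s) (p := p) (u - v)
  have h0 : 0 ≤ inner ℝ (u - v) (ridge ψ s p (u - v)) := le_trans (by positivity) h
  rw [ridge_sub, hz, inner_sub_right, inner_sub_left, inner_sub_left, inner_ridge_comm v u, hz,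
    real_inner_comm z u] at h0
  rw [ridgeForm, ← hv]
  rw [real_inner_comm z v] at h0
  linarith

/-- Monotonicity of the inverse: a larger operator has a smaller inverse. -/
lemma ridgeForm_le_of_le {ι' : Type*} {ψ' : ι' → E} {s' : Finset ι'} {p' c : ℝ} (hc : 0 < c)
    (hp : 0 < p) (hp' : 0 < p')
    (h : ∀ u, c * inner ℝ u (ridge ψ' s' p' u) ≤ inner ℝ u (ridge ψ s p u)) (z : E) :
    ridgeForm ψ s p z z ≤ c⁻¹ * ridgeForm ψ' s' p' z z := by
  set v := ridgeInv ψ s p z with hv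
  have hz : ridge ψ s p v = z := ridge_ridgeInv hp z
  have h1 := two_inner_sub_le_ridgeForm (ψ := ψ') (s := s') hp' z (c • v)
  have h2 := h v
  have h3 : ridgeForm ψ s p z z = inner ℝ z v := rfl
  rw [hz, real_inner_comm z v] at h2
  rw [ridge_smul, inner_smul_right, inner_smul_left, inner_smul_right] at h1
  simp only [conj_trivial] at h1
  rw [h3, le_inv_mul_iff₀ hc]
  nlinarith [mul_le_mul_of_nonneg_left h2 hc.le]

lemma ridgeForm_anti_set {s' : Finset ι} (hp : 0 < p) (h : s ⊆ s') (z : E) :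
    ridgeForm ψ s' p z z ≤ ridgeForm ψ s p z z := by
  have := ridgeForm_le_of_le (ψ := ψ) (s := s') (ψ' := ψ) (s' := s) one_pos hp hp (fun u => by
    rw [one_mul, inner_ridge_self, inner_ridge_self]
    gcongr) z
  simpa using this

lemma ridgeForm_anti_reg {p' : ℝ} (hp : 0 < p) (h : p ≤ p') (z : E) :
    ridgeForm ψ s p' z z ≤ ridgeForm ψ s p z z := by
  have := ridgeForm_le_of_le (ψ := ψ) (s := s) (ψ' := ψ) (s' := s) one_pos (hp.trans_le h) hp
    (fun u => by
      rw [one_mul, inner_ridge_self, inner_ridge_self]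
      gcongr) z
  simpa using this

lemma ridgeForm_le_mul_reg {r : ℝ} (hp : 0 < p) (hr : 1 ≤ r) (z : E) :
    ridgeForm ψ s p z z ≤ r * ridgeForm ψ s (r * p) z z := by
  have hr0 : 0 < r := by linarith
  have := ridgeForm_le_of_le (ψ := ψ) (s := s) (ψ' := ψ) (s' := s) (c := r⁻¹) (by positivity) hp
    (mul_pos hr0 hp)
    (fun u => by
      rw [inner_ridge_self, inner_ridge_self, mul_add, ← mul_assoc, ← mul_assoc,
        inv_mul_cancel₀ hr0.ne', one_mul]
      have h1 : 0 ≤ ∑ i ∈ s, inner ℝ (ψ i) u ^ 2 := Finset.sum_nonneg fun i _ => sq_nonneg _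
      have h2 : r⁻¹ ≤ 1 := inv_le_one_of_one_le₀ hr
      nlinarith) z
  simpa using this

lemma reg_mul_ridgeForm_le (hp : 0 < p) (z : E) : p * ridgeForm ψ s p z z ≤ ‖z‖ ^ 2 := by
  have := ridgeForm_anti_set (ψ := ψ) hp (Finset.empty_subset s) z
  rw [ridgeForm_empty hp, real_inner_self_eq_norm_sq] at this
  calc _ ≤ p * (p⁻¹ * ‖z‖ ^ 2) := by gcongr
    _ = _ := by field_simp

lemma norm_ridgeInv_sq_le (hp : 0 < p) (z : E) :
    p * ‖ridgeInv ψ s p z‖ ^ 2 ≤ ridgeForm ψ s p z z := by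
  rw [ridgeForm_self hp]
  exact le_add_of_nonneg_right (Finset.sum_nonneg fun i _ => sq_nonneg _)

/-- The Cauchy–Schwarz inequality for the dual pair of norms of the operator and its inverse. -/
lemma inner_sq_le_ridgeForm_mul (hp : 0 < p) (z u : E) :
    inner ℝ z u ^ 2 ≤ ridgeForm ψ s p z z * inner ℝ u (ridge ψ s p u) := by
  set q := inner ℝ u (ridge ψ s p u) with hq
  have hq0 : 0 ≤ q := le_trans (by positivity) (inner_ridge_self_ge u)
  have key : ∀ c : ℝ, 2 * c * inner ℝ z u - c ^ 2 * q ≤ ridgeForm ψ s p z z := by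
    intro c
    have := two_inner_sub_le_ridgeForm (ψ := ψ) (s := s) hp z (c • u)
    rw [ridge_smul, inner_smul_right, inner_smul_left, inner_smul_right] at this
    simp only [conj_trivial] at this
    linarith
  rcases hq0.eq_or_lt with h0 | h0
  · have h1 : inner ℝ z u = 0 := by
      by_contra hne
      have h2 := key ((ridgeForm ψ s p z z + 1) / (2 * inner ℝ z u))
      rw [← h0] at h2
      have h3 : 2 * ((ridgeForm ψ s p z z + 1) / (2 * inner ℝ z u)) * inner ℝ z u =
          ridgeForm ψ s p z z + 1 := by
        field_simp
      rw [h3] at h2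
      linarith
    rw [h1, ← h0]
    simp
  · have h2 := key (inner ℝ z u / q)
    have h3 : 2 * (inner ℝ z u / q) * inner ℝ z u - (inner ℝ z u / q) ^ 2 * q
        = inner ℝ z u ^ 2 / q := by
      field_simp
      ring
    rw [h3, div_le_iff₀ h0] at h2
    exact h2

lemma ridgeForm_sq_le (hp : 0 < p) (z z' : E) :
    ridgeForm ψ s p z z' ^ 2 ≤ ridgeForm ψ s p z z * ridgeForm ψ s p z' z' := by
  have := inner_sq_le_ridgeForm_mul (ψ := ψ) (s := s) hp z (ridgeInv ψ s p z')
  rwa [ridge_ridgeInv hp, real_inner_comm z' (ridgeInv ψ s p z')] at this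

/-- The Sherman–Morrison formula. -/
lemma ridgeForm_insert [DecidableEq ι] (hp : 0 < p) {i : ι} (hi : i ∉ s) (z z' : E) :
    ridgeForm ψ (insert i s) p z z' = ridgeForm ψ s p z z' -
      ridgeForm ψ s p z (ψ i) * ridgeForm ψ s p (ψ i) z' / (1 + ridgeForm ψ s p (ψ i) (ψ i)) := by
  have ha := ridgeForm_self_nonneg (ψ := ψ) (s := s) hp (ψ i)
  set c := ridgeForm ψ s p (ψ i) z' / (1 + ridgeForm ψ s p (ψ i) (ψ i)) with hc
  have h : ridgeInv ψ (insert i s) p z' =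
      ridgeInv ψ s p z' - c • ridgeInv ψ s p (ψ i) := by
    apply ridgeInv_eq hp
    rw [ridge_insert hi, ridge_sub, ridge_smul, ridge_ridgeInv hp, ridge_ridgeInv hp,
      inner_sub_right, inner_smul_right, sub_add, ← sub_smul]
    change z' - (c - (ridgeForm ψ s p (ψ i) z' - c * ridgeForm ψ s p (ψ i) (ψ i))) • ψ i = z'
    rw [show c - (ridgeForm ψ s p (ψ i) z' - c * ridgeForm ψ s p (ψ i) (ψ i)) = 0 by
      rw [hc]
      have : 1 + ridgeForm ψ s p (ψ i) (ψ i) ≠ 0 := by positivity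
      field_simp
      ring]
    simp
  rw [ridgeForm, h, inner_sub_right, inner_smul_right]
  change ridgeForm ψ s p z z' - c * ridgeForm ψ s p z (ψ i) = _
  rw [hc]
  ring

/-- The least-squares characterization of the ridge form. -/
lemma reg_mul_ridgeForm_le_leastSquares (hp : 0 < p) (z : E) (a : ι → ℝ) :
    p * ridgeForm ψ s p z z ≤ ‖z - ∑ i ∈ s, a i • ψ i‖ ^ 2 + p * ∑ i ∈ s, a i ^ 2 := by
  set u := ridgeInv ψ s p z with hu
  have h1 := ridgeForm_self (ψ := ψ) (s := s) hp z
  have h2 : ridgeForm ψ s p z z = inner ℝ (z - ∑ i ∈ s, a i • ψ i) u +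
      ∑ i ∈ s, a i * inner ℝ (ψ i) u := by
    rw [inner_sub_left, sum_inner]
    simp only [inner_smul_left, conj_trivial]
    rw [sub_add_cancel]
    rfl
  rw [← hu] at h1
  set r := z - ∑ i ∈ s, a i • ψ i
  have h3 : 2 * p * inner ℝ r u ≤ ‖r‖ ^ 2 + p ^ 2 * ‖u‖ ^ 2 := by
    have h := real_inner_le_norm r u
    nlinarith [sq_nonneg (‖r‖ - p * ‖u‖), mul_le_mul_of_nonneg_left h hp.le]
  have h4 : 2 * ∑ i ∈ s, a i * inner ℝ (ψ i) u ≤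
      ∑ i ∈ s, a i ^ 2 + ∑ i ∈ s, inner ℝ (ψ i) u ^ 2 := by
    rw [Finset.mul_sum, ← Finset.sum_add_distrib]
    exact Finset.sum_le_sum fun i _ => by nlinarith [sq_nonneg (a i - inner ℝ (ψ i) u)]
  nlinarith [mul_le_mul_of_nonneg_left h4 hp.le]

lemma reg_mul_ridgeForm_eq_leastSquares (hp : 0 < p) (z : E) :
    p * ridgeForm ψ s p z z =
      ‖z - ∑ i ∈ s, inner ℝ (ψ i) (ridgeInv ψ s p z) • ψ i‖ ^ 2 +
        p * ∑ i ∈ s, inner ℝ (ψ i) (ridgeInv ψ s p z) ^ 2 := by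
  have h : z - ∑ i ∈ s, inner ℝ (ψ i) (ridgeInv ψ s p z) • ψ i = p • ridgeInv ψ s p z := by
    rw [sub_eq_iff_eq_add]
    exact (ridge_ridgeInv hp z).symm
  rw [h, norm_smul, ridgeForm_self hp, Real.norm_of_nonneg hp.le]
  ring

/-- The effective dimension `∑ᵢ ψᵢᵀ (p + ∑ⱼ ψⱼ ψⱼᵀ)⁻¹ ψᵢ`. -/
def effDim (ψ : ι → E) (s : Finset ι) (p : ℝ) : ℝ :=
  ∑ i ∈ s, ridgeForm ψ s p (ψ i) (ψ i)

lemma effDim_nonneg (hp : 0 < p) : 0 ≤ effDim ψ s p :=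
  Finset.sum_nonneg fun _ _ => ridgeForm_self_nonneg hp _

lemma sum_ridgeForm_sq (hp : 0 < p) (z : E) :
    ∑ j ∈ s, ridgeForm ψ s p (ψ j) z ^ 2 =
      ridgeForm ψ s p z z - p * ‖ridgeInv ψ s p z‖ ^ 2 := by
  rw [ridgeForm_self hp z]
  simp only [ridgeForm]
  ring

lemma effDim_insert [DecidableEq ι] (hp : 0 < p) {i : ι} (hi : i ∉ s) :
    effDim ψ (insert i s) p = effDim ψ s p +
      p * ‖ridgeInv ψ s p (ψ i)‖ ^ 2 / (1 + ridgeForm ψ s p (ψ i) (ψ i)) := by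
  have ha := ridgeForm_self_nonneg (ψ := ψ) (s := s) hp (ψ i)
  have ha' : 1 + ridgeForm ψ s p (ψ i) (ψ i) ≠ 0 := by positivity
  have h := sum_ridgeForm_sq (ψ := ψ) (s := s) hp (ψ i)
  unfold effDim
  rw [Finset.sum_insert hi]
  simp only [ridgeForm_insert hp hi, Finset.sum_sub_distrib]
  rw [← Finset.sum_div]
  have h2 : ∑ j ∈ s, ridgeForm ψ s p (ψ j) (ψ i) * ridgeForm ψ s p (ψ i) (ψ j) =
      ridgeForm ψ s p (ψ i) (ψ i) - p * ‖ridgeInv ψ s p (ψ i)‖ ^ 2 := by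
    rw [← h]
    refine Finset.sum_congr rfl fun j _ => ?_
    rw [ridgeForm_comm hp (ψ i) (ψ j), sq]
  rw [h2]
  field_simp
  ring

lemma effDim_le_card {m : ℕ} {ψ : ι → EuclideanSpace ℝ (Fin m)} (hp : 0 < p) :
    effDim ψ s p ≤ m := by
  have e := EuclideanSpace.basisFun (Fin m) ℝ
  have h1 : effDim ψ s p = ∑ j, (1 - p * ridgeForm ψ s p (e j) (e j)) := by
    have h2 : ∀ i, ridgeForm ψ s p (ψ i) (ψ i) =
        ∑ j, inner ℝ (ψ i) (e j) * inner ℝ (ψ i) (ridgeInv ψ s p (e j)) := by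
      intro i
      rw [ridgeForm, ← e.sum_inner_mul_inner]
      refine Finset.sum_congr rfl fun j _ => ?_
      congr 1
      exact ridgeForm_comm hp (e j) (ψ i)
    unfold effDim
    simp only [h2]
    rw [Finset.sum_comm]
    refine Finset.sum_congr rfl fun j _ => ?_
    have h3 := inner_ridge (ψ := ψ) (s := s) (p := p) (e j) (ridgeInv ψ s p (e j))
    rw [ridge_ridgeInv hp, real_inner_self_eq_norm_sq, e.norm_eq_one] at h3
    simp only [ridgeForm]
    linarith
  rw [h1]
  calc _ ≤ ∑ j : Fin m, (1 : ℝ) := Finset.sum_le_sum fun j _ => by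
        have := ridgeForm_self_nonneg (ψ := ψ) (s := s) hp (e j)
        nlinarith
    _ = m := by simp

end Ridge

end WGPUCB

namespace WGPUCB

section LogDet

variable {ι E : Type*} [NormedAddCommGroup E] [InnerProductSpace ℝ E]

/-- The matrix `1 + p⁻¹ [⟪ψᵢ, ψⱼ⟫]`. -/
def regGram {κ : Type*} [DecidableEq κ] (v : κ → E) (p : ℝ) : Matrix κ κ ℝ :=
  1 + p⁻¹ • Matrix.of fun i j => inner ℝ (v i) (v j)

/-- The logarithm of `det (1 + p⁻¹ [⟪ψᵢ, ψⱼ⟫]_{i, j ∈ s})`. -/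
def logDet [DecidableEq ι] (ψ : ι → E) (s : Finset ι) (p : ℝ) : ℝ :=
  Real.log (regGram (fun i : s => ψ i) p).det

variable [DecidableEq ι] {ψ : ι → E} {s : Finset ι} {p : ℝ}

lemma det_regGram_equiv {κ κ' : Type*} [Fintype κ] [Fintype κ'] [DecidableEq κ] [DecidableEq κ']
    (e : κ' ≃ κ) (v : κ → E) (p : ℝ) :
    (regGram (fun i => v (e i)) p).det = (regGram v p).det := by
  rw [← Matrix.det_submatrix_equiv_self e (regGram v p)]
  congr 1
  ext i j
  simp [regGram, Matrix.one_apply]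

lemma det_regGram_insert (hp : 0 < p) {i : ι} (hi : i ∉ s) :
    (regGram (fun j : (insert i s : Finset ι) => ψ j) p).det =
      (regGram (fun j : s => ψ j) p).det * (1 + ridgeForm ψ s p (ψ i) (ψ i)) := by
  set u := ridgeInv ψ s p (ψ i) with hu
  let e : (s ⊕ Unit) ≃ (insert i s : Finset ι) :=
    ((Finset.subtypeInsertEquivOption hi).trans (Equiv.optionEquivSumPUnit _)).symm
  have he1 : ∀ j : s, ((e (Sum.inl j) : (insert i s : Finset ι)) : ι) = j := fun j => rfl
  have he2 : ∀ j : Unit, ((e (Sum.inr j) : (insert i s : Finset ι)) : ι) = i := fun j => rfl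
  rw [← det_regGram_equiv e]
  have hu' : p • u + ∑ k ∈ s, inner ℝ (ψ k) u • ψ k = ψ i := ridge_ridgeInv hp (ψ i)
  have hinner : ∀ z, inner ℝ z (ψ i) =
      p * inner ℝ z u + ∑ k : s, inner ℝ (ψ k) u * inner ℝ z (ψ k) := by
    intro z
    nth_rewrite 1 [← hu']
    rw [inner_add_right, inner_smul_right, inner_sum, ← Finset.sum_coe_sort s]
    simp only [inner_smul_right]
  set A := regGram (fun j : s => ψ j) p
  let b : Matrix s Unit ℝ := Matrix.of fun j _ => inner ℝ (ψ j) u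
  let C : Matrix Unit s ℝ := Matrix.of fun _ j => p⁻¹ * inner ℝ (ψ i) (ψ j)
  let D : Matrix Unit Unit ℝ := Matrix.of fun _ _ => 1 + p⁻¹ * inner ℝ (ψ i) (ψ i)
  have hAb : ∀ j k, (A * b) j k = p⁻¹ * inner ℝ (ψ j) (ψ i) := by
    intro j k
    have h1 : A * b = b + p⁻¹ • ((Matrix.of fun k l : s => inner ℝ (ψ k) (ψ l)) * b) := by
      change (1 + p⁻¹ • (Matrix.of fun k l : s => inner ℝ (ψ k) (ψ l))) * b = _
      rw [Matrix.add_mul, Matrix.one_mul, Matrix.smul_mul]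
    rw [h1, hinner (ψ j), mul_add, inv_mul_cancel_left₀ hp.ne']
    simp only [Matrix.add_apply, Matrix.smul_apply, Matrix.mul_apply, smul_eq_mul]
    have h2 : ∑ l, (Matrix.of fun k l : s => inner ℝ (ψ k) (ψ l)) j l * b l k =
        ∑ l : s, inner ℝ (ψ l) u * inner ℝ (ψ j) (ψ l) :=
      Finset.sum_congr rfl fun l _ => mul_comm _ _
    rw [h2]
    rfl
  have hM : regGram (fun j => ψ (e j)) p = Matrix.fromBlocks A (A * b) C D := by
    ext j k
    rcases j with j | j <;> rcases k with k | k
    · simp [A, regGram, he1, Matrix.one_apply]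
    · rw [Matrix.fromBlocks_apply₁₂, hAb]
      simp [regGram, he1, he2]
    · simp [C, regGram, he1, he2]
    · simp [D, regGram, he2]
  have hmul : Matrix.fromBlocks A (A * b) C D * Matrix.fromBlocks 1 (-b) 0 1 =
      Matrix.fromBlocks A 0 C (D - C * b) := by
    rw [Matrix.fromBlocks_multiply]
    congr 1 <;> simp [sub_eq_add_neg, add_comm]
  have hdet := congrArg Matrix.det hmul
  rw [Matrix.det_mul, Matrix.det_fromBlocks_zero₂₁, Matrix.det_fromBlocks_zero₁₂] at hdet
  simp only [Matrix.det_one, mul_one] at hdet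
  rw [hM, hdet]
  congr 1
  rw [Matrix.det_unique]
  have h1 := hinner (ψ i)
  simp only [D, C, b, Matrix.sub_apply, Matrix.of_apply, Matrix.mul_apply, ridgeForm]
  have h2 : ∑ x : s, p⁻¹ * inner ℝ (ψ i) (ψ x) * inner ℝ (ψ x) u =
      p⁻¹ * ∑ x : s, inner ℝ (ψ x) u * inner ℝ (ψ i) (ψ x) := by
    rw [Finset.mul_sum]
    exact Finset.sum_congr rfl fun k _ => by ring
  rw [h2, h1]
  field_simp
  rw [← hu]
  ring

lemma det_regGram_pos (hp : 0 < p) (s : Finset ι) : 0 < (regGram (fun j : s => ψ j) p).det := by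
  induction s using Finset.induction_on with
  | empty => simp
  | insert i s hi ih =>
    rw [det_regGram_insert hp hi]
    have := ridgeForm_self_nonneg (ψ := ψ) (s := s) hp (ψ i)
    positivity

@[simp]
lemma logDet_empty : logDet ψ ∅ p = 0 := by simp [logDet]

lemma logDet_insert (hp : 0 < p) {i : ι} (hi : i ∉ s) :
    logDet ψ (insert i s) p = logDet ψ s p + Real.log (1 + ridgeForm ψ s p (ψ i) (ψ i)) := by
  have := ridgeForm_self_nonneg (ψ := ψ) (s := s) hp (ψ i)
  rw [logDet, det_regGram_insert hp hi, Real.log_mul (det_regGram_pos hp s).ne' (by positivity)]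
  rfl

lemma logDet_congr {ψ' : ι → E} (h : ∀ i ∈ s, ψ i = ψ' i) : logDet ψ s p = logDet ψ' s p := by
  unfold logDet
  congr 3
  funext i
  exact h i i.2

/-- The log-determinant depends on the Gram matrix and the regularizer only. -/
lemma logDet_map {ι' E' : Type*} [DecidableEq ι'] [NormedAddCommGroup E'] [InnerProductSpace ℝ E']
    {ψ' : ι' → E'} {p' : ℝ} (f : ι' ↪ ι) (s' : Finset ι')
    (h : ∀ i ∈ s', ∀ j ∈ s', p⁻¹ * inner ℝ (ψ (f i)) (ψ (f j)) =
      p'⁻¹ * inner ℝ (ψ' i) (ψ' j)) :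
    logDet ψ (s'.map f) p = logDet ψ' s' p' := by
  unfold logDet
  let e : s' ≃ (s'.map f : Finset ι) :=
    Equiv.ofBijective (fun i => ⟨f i, Finset.mem_map_of_mem f i.2⟩)
      ⟨fun i j hij => Subtype.ext (f.injective (congrArg Subtype.val hij)), fun j => by
        obtain ⟨i, hi, hij⟩ := Finset.mem_map.mp j.2
        exact ⟨⟨i, hi⟩, Subtype.ext hij⟩⟩
  have he : ∀ i : s', ((e i : (s'.map f : Finset ι)) : ι) = f i := fun i => rfl
  rw [← det_regGram_equiv e]
  congr 2
  ext i j
  simp [regGram, Matrix.one_apply, he, h i i.2 j j.2]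

lemma logDet_nonneg (hp : 0 < p) (s : Finset ι) : 0 ≤ logDet ψ s p := by
  induction s using Finset.induction_on with
  | empty => simp
  | insert i s hi ih =>
    rw [logDet_insert hp hi]
    have := ridgeForm_self_nonneg (ψ := ψ) (s := s) hp (ψ i)
    exact add_nonneg ih (Real.log_nonneg (by linarith))

lemma logDet_union_le (hp : 0 < p) (t : Finset ι) :
    logDet ψ (s ∪ t) p ≤ logDet ψ s p + ∑ i ∈ t, ridgeForm ψ s p (ψ i) (ψ i) := by
  induction t using Finset.induction_on with
  | empty => simp
  | insert i t hi ih =>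
    have ha := ridgeForm_self_nonneg (ψ := ψ) (s := s) hp (ψ i)
    rw [Finset.sum_insert hi, Finset.union_insert]
    by_cases h : i ∈ s ∪ t
    · rw [Finset.insert_eq_of_mem h]
      linarith
    · rw [logDet_insert hp h]
      have h1 := ridgeForm_anti_set (ψ := ψ) hp (Finset.subset_union_left (s₁ := s) (s₂ := t)) (ψ i)
      have h2 := ridgeForm_self_nonneg (ψ := ψ) (s := s ∪ t) hp (ψ i)
      have h3 := Real.log_le_sub_one_of_pos (x := 1 + ridgeForm ψ (s ∪ t) p (ψ i) (ψ i))
        (by positivity)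
      linarith

lemma logDet_mono (hp : 0 < p) {t : Finset ι} (h : s ⊆ t) : logDet ψ s p ≤ logDet ψ t p := by
  rw [← Finset.union_sdiff_of_subset h]
  induction (t \ s) using Finset.induction_on with
  | empty => simp
  | insert i t hi ih =>
    rw [Finset.union_insert]
    by_cases h : i ∈ s ∪ t
    · rwa [Finset.insert_eq_of_mem h]
    · rw [logDet_insert hp h]
      have h2 := ridgeForm_self_nonneg (ψ := ψ) (s := s ∪ t) hp (ψ i)
      have := Real.log_nonneg (x := 1 + ridgeForm ψ (s ∪ t) p (ψ i) (ψ i)) (by linarith)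
      linarith

lemma logDet_le_sum (hp : 0 < p) (s : Finset ι) :
    logDet ψ s p ≤ ∑ i ∈ s, p⁻¹ * ‖ψ i‖ ^ 2 := by
  have := logDet_union_le (ψ := ψ) (s := ∅) hp s
  simp only [Finset.empty_union, logDet_empty, zero_add, ridgeForm_empty hp,
    real_inner_self_eq_norm_sq] at this
  exact this

lemma effDim_le_logDet (hp : 0 < p) (s : Finset ι) : effDim ψ s p ≤ logDet ψ s p := by
  induction s using Finset.induction_on with
  | empty => simp [effDim]
  | insert i s hi ih =>
    rw [logDet_insert hp hi, effDim_insert hp hi]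
    have ha := ridgeForm_self_nonneg (ψ := ψ) (s := s) hp (ψ i)
    have h1 := norm_ridgeInv_sq_le (ψ := ψ) (s := s) hp (ψ i)
    have h2 : p * ‖ridgeInv ψ s p (ψ i)‖ ^ 2 / (1 + ridgeForm ψ s p (ψ i) (ψ i)) ≤
        1 - (1 + ridgeForm ψ s p (ψ i) (ψ i))⁻¹ := by
      rw [div_le_iff₀ (by positivity), sub_mul, inv_mul_cancel₀ (by positivity)]
      linarith
    have h3 := Real.one_sub_inv_le_log_of_pos (x := 1 + ridgeForm ψ s p (ψ i) (ψ i))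
      (by positivity)
    linarith

lemma logDet_le_mul (hp : 0 < p) {r : ℝ} (hr : 1 ≤ r) (s : Finset ι) :
    logDet ψ s p ≤ r * logDet ψ s (r * p) := by
  have hrp : 0 < r * p := by positivity
  induction s using Finset.induction_on with
  | empty => simp
  | insert i s hi ih =>
    rw [logDet_insert hp hi, logDet_insert hrp hi, mul_add]
    refine add_le_add ih ?_
    have ha := ridgeForm_self_nonneg (ψ := ψ) (s := s) hp (ψ i)
    have ha' := ridgeForm_self_nonneg (ψ := ψ) (s := s) hrp (ψ i)
    have h1 := ridgeForm_le_mul_reg (ψ := ψ) (s := s) hp hr (ψ i)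
    rw [← Real.log_rpow (by positivity)]
    refine Real.log_le_log (by positivity) ?_
    have := one_add_mul_self_le_rpow_one_add
      (s := ridgeForm ψ s (r * p) (ψ i) (ψ i)) (by linarith) hr
    linarith

/-- Decreasing the regularizer by a factor `r` increases the log-determinant by at most `r - 1`
times the effective dimension. -/
lemma logDet_le_add_effDim (hp : 0 < p) {r : ℝ} (hr : 1 ≤ r) (s : Finset ι) :
    logDet ψ s p ≤ logDet ψ s (r * p) + (r - 1) * effDim ψ s (r * p) := by
  have hr0 : 0 < r := by linarith
  have hrp : 0 < r * p := by positivity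
  induction s using Finset.induction_on with
  | empty => simp [effDim]
  | insert i s hi ih =>
    rw [logDet_insert hp hi, logDet_insert hrp hi, effDim_insert hrp hi]
    set a := ridgeForm ψ s (r * p) (ψ i) (ψ i) with ha_def
    set a' := ridgeForm ψ s p (ψ i) (ψ i) with ha'_def
    set v := ridgeInv ψ s (r * p) (ψ i) with hv_def
    have ha : 0 ≤ a := ridgeForm_self_nonneg hrp _
    have ha' : 0 ≤ a' := ridgeForm_self_nonneg hp _
    have hv : ridge ψ s p v = ψ i - ((r - 1) * p) • v := by
      have h1 : ridge ψ s (r * p) v = ψ i := ridge_ridgeInv hrp _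
      rw [← h1, ridge, ridge, sub_mul, sub_smul, one_mul]
      abel
    have h1 : a' = a + (r - 1) * p * ridgeForm ψ s p (ψ i) v := by
      have h2 : ψ i = ridge ψ s p v + ((r - 1) * p) • v := by rw [hv]; abel
      have h3 : ridgeForm ψ s p (ψ i) (ridge ψ s p v) = a := by
        rw [ridgeForm, ridgeInv_eq hp rfl]
        rfl
      rw [← h3, ← ridgeForm_smul_right hp, ← ridgeForm_add_right hp, ← h2]
    have h4 : ridgeForm ψ s p (ψ i) v = ‖v‖ ^ 2 + (r - 1) * p * ridgeForm ψ s p v v := by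
      have h2 : ψ i = ridge ψ s p v + ((r - 1) * p) • v := by rw [hv]; abel
      rw [h2, ridgeForm_add_left, ridgeForm_smul_left]
      congr 1
      rw [ridgeForm_comm hp, ridgeForm, ridgeInv_eq hp rfl, real_inner_self_eq_norm_sq]
    have h5 := reg_mul_ridgeForm_le (ψ := ψ) (s := s) hp v
    have h6 : a' ≤ a + (r - 1) * (r * p * ‖v‖ ^ 2) := by
      rw [h1, h4]
      have : (r - 1) * (p * ridgeForm ψ s p v v) ≤ (r - 1) * ‖v‖ ^ 2 := by
        gcongr
      have : (r - 1) * p * ((r - 1) * (p * ridgeForm ψ s p v v)) ≤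
          (r - 1) * p * ((r - 1) * ‖v‖ ^ 2) := by
        gcongr
      linarith
    have h7 : Real.log (1 + a') ≤ Real.log (1 + a) + (a' - a) / (1 + a) := by
      have := Real.log_le_sub_one_of_pos (x := (1 + a') / (1 + a)) (by positivity)
      rw [Real.log_div (by positivity) (by positivity)] at this
      have h8 : (1 + a') / (1 + a) - 1 = (a' - a) / (1 + a) := by
        field_simp
        ring
      linarith
    have h9 : (a' - a) / (1 + a) ≤ (r - 1) * (r * p * ‖v‖ ^ 2 / (1 + a)) := by
      rw [← mul_div_assoc]
      gcongr
      linarith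
    linarith

end LogDet

end WGPUCB

namespace WGPUCB

section Replacement

variable {ι E : Type*} [NormedAddCommGroup E] [InnerProductSpace ℝ E]
  {ψ : ι → E} {s : Finset ι} {p : ℝ}

lemma ridgeForm_congr {ψ' : ι → E} (hp : 0 < p) (h : ∀ i ∈ s, ψ i = ψ' i) (z z' : E) :
    ridgeForm ψ s p z z' = ridgeForm ψ' s p z z' := by
  rw [ridgeForm, ridgeForm]
  congr 1
  apply ridgeInv_eq hp
  refine Eq.trans ?_ (ridge_ridgeInv (ψ := ψ') (s := s) hp z')
  unfold ridge
  congr 1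
  exact Finset.sum_congr rfl fun i hi => by rw [h i hi]

lemma exists_subset_card_sum_le [DecidableEq ι] (f : ι → ℝ) (t : Finset ι) {b : ℕ}
    (hb : b ≤ t.card) :
    ∃ J ⊆ t, J.card = b ∧ (t.card : ℝ) * ∑ i ∈ J, f i ≤ b * ∑ i ∈ t, f i := by
  induction hn : t.card - b generalizing b with
  | zero =>
    exact ⟨t, subset_rfl, by omega, by rw [show b = t.card by omega]⟩
  | succ n ih =>
    obtain ⟨J, hJt, hJc, hJ⟩ := ih (b := b + 1) (by omega) (by omega)
    have hne : J.Nonempty := Finset.card_pos.mp (by omega)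
    obtain ⟨i, hi, hmax⟩ := J.exists_max_image f hne
    refine ⟨J.erase i, (Finset.erase_subset _ _).trans hJt, by simp [hi, hJc], ?_⟩
    have h1 := Finset.add_sum_erase J f hi
    have h2 : ∑ j ∈ J.erase i, f j ≤ b * f i := by
      have : (J.erase i).card = b := by simp [hi, hJc]
      rw [← this, ← nsmul_eq_mul]
      exact Finset.sum_le_card_nsmul _ _ _ fun j hj => hmax j (Finset.mem_of_mem_erase hj)
    set S := ∑ j ∈ J.erase i, f j
    rw [← h1] at hJ
    push_cast at hJ
    have h3 : (b + 1 : ℝ) * ((t.card : ℝ) * S) ≤ (b + 1) * (b * ∑ i ∈ t, f i) := by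
      have h4 : (b + 1 : ℝ) * S ≤ b * (f i + S) := by linarith
      have h5 := mul_le_mul_of_nonneg_left h4 (Nat.cast_nonneg t.card : (0 : ℝ) ≤ t.card)
      have h6 := mul_le_mul_of_nonneg_left hJ (Nat.cast_nonneg b : (0 : ℝ) ≤ b)
      nlinarith
    exact le_of_mul_le_mul_left h3 (by positivity)

variable [DecidableEq ι]

/-- Effect of adding multiples of a single vector. -/
lemma logDet_union_smul (hp : 0 < p) {J : Finset ι} (hd : Disjoint s J) {c : ι → ℝ} {φ : E}
    (hJ : ∀ i ∈ J, ψ i = c i • φ) :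
    logDet ψ (s ∪ J) p =
        logDet ψ s p + Real.log (1 + (∑ i ∈ J, c i ^ 2) * ridgeForm ψ s p φ φ) ∧
      ridgeForm ψ (s ∪ J) p φ φ =
        ridgeForm ψ s p φ φ / (1 + (∑ i ∈ J, c i ^ 2) * ridgeForm ψ s p φ φ) := by
  induction J using Finset.induction_on with
  | empty => simp
  | insert i J hi ih =>
    obtain ⟨ih1, ih2⟩ := ih (hd.mono_right (Finset.subset_insert _ _))
      fun j hj => hJ j (Finset.mem_insert_of_mem hj)
    have his : i ∉ s ∪ J := by
      rw [Finset.mem_union, not_or]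
      exact ⟨fun h => Finset.disjoint_left.mp hd h (Finset.mem_insert_self _ _), hi⟩
    rw [Finset.union_insert, Finset.sum_insert hi, logDet_insert hp his, ridgeForm_insert hp his,
      hJ i (Finset.mem_insert_self _ _), ridgeForm_smul_smul hp, ridgeForm_smul_left,
      ridgeForm_smul_right hp, ih1, ih2]
    set q := ridgeForm ψ s p φ φ
    set S := ∑ j ∈ J, c j ^ 2 with hS
    have hq : 0 ≤ q := ridgeForm_self_nonneg hp _
    have hS0 : 0 ≤ S := Finset.sum_nonneg fun _ _ => sq_nonneg _
    have h1 : 0 < 1 + S * q := by positivity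
    have h2 : 0 < 1 + (c i ^ 2 + S) * q := by positivity
    constructor
    · rw [add_assoc, ← Real.log_mul h1.ne' (by positivity)]
      congr 2
      field_simp
      ring
    · have h3 : 0 < 1 + S * q + c i ^ 2 * q := by positivity
      field_simp
      ring

lemma ridgeForm_sdiff_le {J : Finset ι} (hp : 0 < p) (hJ : J ⊆ s)
    (h : ∑ i ∈ J, ridgeForm ψ s p (ψ i) (ψ i) ≤ 1 / 2) (z : E) :
    ridgeForm ψ (s \ J) p z z ≤ 2 * ridgeForm ψ s p z z := by
  have := ridgeForm_le_of_le (ψ := ψ) (s := s \ J) (ψ' := ψ) (s' := s) (c := 1 / 2) (by norm_num)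
    hp hp (fun u => by
      have h1 : inner ℝ u (ridge ψ s p u) =
          inner ℝ u (ridge ψ (s \ J) p u) + ∑ i ∈ J, inner ℝ (ψ i) u ^ 2 := by
        rw [inner_ridge_self, inner_ridge_self, ← Finset.sum_sdiff hJ, add_assoc]
      have h0 : 0 ≤ inner ℝ u (ridge ψ s p u) := le_trans (by positivity) (inner_ridge_self_ge u)
      have h2 : ∑ i ∈ J, inner ℝ (ψ i) u ^ 2 ≤ 1 / 2 * inner ℝ u (ridge ψ s p u) := by
        refine le_trans (Finset.sum_le_sum fun i _ => inner_sq_le_ridgeForm_mul (ψ := ψ) (s := s) hp (ψ i) u) ?_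
        rw [← Finset.sum_mul]
        gcongr
      linarith) z
  simpa using this

/-- Replacing vectors of small total leverage by multiples of `φ` decreases the log-determinant by
little, and gains what the direction `φ` has to offer. -/
lemma logDet_replace {J : Finset ι} {ψ' : ι → E} (hp : 0 < p) (hJ : J ⊆ s)
    (h : ∑ i ∈ J, ridgeForm ψ s p (ψ i) (ψ i) ≤ 1 / 2) {c : ι → ℝ} {φ : E}
    (hψ : ∀ i ∈ s \ J, ψ i = ψ' i) (hψJ : ∀ i ∈ J, ψ' i = c i • φ) :
    logDet ψ s p - 2 * ∑ i ∈ J, ridgeForm ψ s p (ψ i) (ψ i) +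
        Real.log (1 + (∑ i ∈ J, c i ^ 2) * ridgeForm ψ s p φ φ) ≤ logDet ψ' s p := by
  have h1 : logDet ψ s p ≤ logDet ψ (s \ J) p + 2 * ∑ i ∈ J, ridgeForm ψ s p (ψ i) (ψ i) := by
    have := logDet_union_le (ψ := ψ) (s := s \ J) hp J
    rw [Finset.sdiff_union_of_subset hJ] at this
    refine this.trans ?_
    rw [Finset.mul_sum]
    gcongr with i hi
    exact ridgeForm_sdiff_le hp hJ h _
  have h2 := (logDet_union_smul (ψ := ψ') (s := s \ J) hp Finset.sdiff_disjoint hψJ).1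
  rw [Finset.sdiff_union_of_subset hJ, ← logDet_congr hψ, ← ridgeForm_congr hp hψ] at h2
  have h3 := ridgeForm_anti_set (ψ := ψ) hp (Finset.sdiff_subset (s := s) (t := J)) φ
  have h4 := ridgeForm_self_nonneg (ψ := ψ) (s := s) hp φ
  have hS0 : 0 ≤ ∑ j ∈ J, c j ^ 2 := Finset.sum_nonneg fun _ _ => sq_nonneg _
  have h5 : Real.log (1 + (∑ i ∈ J, c i ^ 2) * ridgeForm ψ s p φ φ) ≤
      Real.log (1 + (∑ i ∈ J, c i ^ 2) * ridgeForm ψ (s \ J) p φ φ) := by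
    apply Real.log_le_log (by positivity)
    gcongr
  linarith

end Replacement

section FeatureComparison

variable {ι X E F : Type*} [NormedAddCommGroup E] [InnerProductSpace ℝ E]
  [NormedAddCommGroup F] [InnerProductSpace ℝ F] {s : Finset ι} {p ε Θ : ℝ}
  {φ : X → E} {φ' : X → F} {x : ι → X} {c : ι → ℝ}

lemma norm_sub_sum_sq (z : X) (a : ι → ℝ) :
    ‖φ z - ∑ i ∈ s, a i • (c i • φ (x i))‖ ^ 2 =
      inner ℝ (φ z) (φ z) - 2 * ∑ i ∈ s, a i * c i * inner ℝ (φ z) (φ (x i)) +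
        ∑ i ∈ s, ∑ j ∈ s, (a i * c i) * (a j * c j) * inner ℝ (φ (x i)) (φ (x j)) := by
  rw [norm_sub_sq_real, ← real_inner_self_eq_norm_sq, ← real_inner_self_eq_norm_sq]
  simp only [inner_sum, sum_inner, inner_smul_left, inner_smul_right, conj_trivial, smul_smul]
  congr 1
  simp only [Finset.mul_sum]
  rw [Finset.sum_comm]
  exact Finset.sum_congr rfl fun i _ => Finset.sum_congr rfl fun j _ => by ring

lemma norm_sub_sum_sq_le (hε : ∀ z z', |inner ℝ (φ z) (φ z') - inner ℝ (φ' z) (φ' z')| ≤ ε)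
    (z : X) (a : ι → ℝ) :
    ‖φ z - ∑ i ∈ s, a i • (c i • φ (x i))‖ ^ 2 ≤
      ‖φ' z - ∑ i ∈ s, a i • (c i • φ' (x i))‖ ^ 2 + ε * (1 + ∑ i ∈ s, |a i * c i|) ^ 2 := by
  rw [norm_sub_sum_sq, norm_sub_sum_sq]
  have h0 := (abs_le.mp (hε z z)).2
  have hterm : ∀ (r : ℝ) (z z' : X),
      |r * inner ℝ (φ z) (φ z') - r * inner ℝ (φ' z) (φ' z')| ≤ |r| * ε := by
    intro r z z'
    rw [← mul_sub, abs_mul]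
    gcongr
    exact hε z z'
  have h1 : ∑ i ∈ s, a i * c i * inner ℝ (φ' z) (φ' (x i)) -
      ∑ i ∈ s, a i * c i * inner ℝ (φ z) (φ (x i)) ≤ (∑ i ∈ s, |a i * c i|) * ε := by
    rw [← Finset.sum_sub_distrib, Finset.sum_mul]
    refine Finset.sum_le_sum fun i _ => ?_
    have := (abs_le.mp (hterm (a i * c i) z (x i))).1
    linarith
  have h2 : ∑ i ∈ s, ∑ j ∈ s, (a i * c i) * (a j * c j) * inner ℝ (φ (x i)) (φ (x j)) -
      ∑ i ∈ s, ∑ j ∈ s, (a i * c i) * (a j * c j) * inner ℝ (φ' (x i)) (φ' (x j)) ≤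
      (∑ i ∈ s, |a i * c i|) ^ 2 * ε := by
    rw [sq, Finset.sum_mul_sum, ← Finset.sum_sub_distrib, Finset.sum_mul]
    refine Finset.sum_le_sum fun i _ => ?_
    rw [← Finset.sum_sub_distrib, Finset.sum_mul]
    refine Finset.sum_le_sum fun j _ => ?_
    have := (abs_le.mp (hterm ((a i * c i) * (a j * c j)) (x i) (x j))).2
    rwa [abs_mul] at this
  nlinarith

/-- Comparison of the posterior variance with that of an approximating kernel. -/
lemma ridgeForm_le_feature (hp : 0 < p) (hε0 : 0 ≤ ε)
    (hε : ∀ z z', |inner ℝ (φ z) (φ z') - inner ℝ (φ' z) (φ' z')| ≤ ε)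
    (hΘ : ∑ i ∈ s, c i ^ 2 ≤ Θ * p) (z : X) :
    p * ridgeForm (fun i => c i • φ (x i)) s p (φ z) (φ z) ≤
      p * ridgeForm (fun i => c i • φ' (x i)) s p (φ' z) (φ' z) * (1 + 2 * ε * Θ) + 2 * ε := by
  set ψ' : ι → F := fun i => c i • φ' (x i) with hψ'
  set a : ι → ℝ := fun i => inner ℝ (ψ' i) (ridgeInv ψ' s p (φ' z)) with ha
  have h1 := reg_mul_ridgeForm_le_leastSquares (ψ := fun i => c i • φ (x i)) (s := s) hp (φ z) a
  have h2 := reg_mul_ridgeForm_eq_leastSquares (ψ := ψ') (s := s) hp (φ' z)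
  have h3 := norm_sub_sum_sq_le (s := s) (x := x) (c := c) hε z a
  have h4 : (∑ i ∈ s, |a i * c i|) ^ 2 ≤ (∑ i ∈ s, a i ^ 2) * ∑ i ∈ s, c i ^ 2 := by
    have := Finset.sum_mul_sq_le_sq_mul_sq s (fun i => |a i|) (fun i => |c i|)
    simpa only [abs_mul, sq_abs] using this
  have ha0 : 0 ≤ ∑ i ∈ s, a i ^ 2 := Finset.sum_nonneg fun _ _ => sq_nonneg _
  have h5 : p * ∑ i ∈ s, a i ^ 2 ≤ p * ridgeForm ψ' s p (φ' z) (φ' z) := by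
    rw [h2]
    exact le_add_of_nonneg_left (sq_nonneg _)
  have hΘ0 : 0 ≤ Θ := by
    have : 0 ≤ ∑ i ∈ s, c i ^ 2 := Finset.sum_nonneg fun _ _ => sq_nonneg _
    by_contra hc
    push Not at hc
    nlinarith
  have h6 : (∑ i ∈ s, |a i * c i|) ^ 2 ≤ p * ridgeForm ψ' s p (φ' z) (φ' z) * Θ := by
    calc _ ≤ (∑ i ∈ s, a i ^ 2) * (Θ * p) := h4.trans (by gcongr)
      _ = (p * ∑ i ∈ s, a i ^ 2) * Θ := by ring
      _ ≤ _ := by gcongr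
  set S := ∑ i ∈ s, |a i * c i|
  have h7 : ε * (1 + S) ^ 2 ≤ ε * (2 + 2 * S ^ 2) := by
    gcongr
    nlinarith [sq_nonneg (1 - S)]
  have h8 := mul_le_mul_of_nonneg_left h6 hε0
  nlinarith

lemma effDim_le_feature (hp : 0 < p) (hε0 : 0 ≤ ε)
    (hε : ∀ z z', |inner ℝ (φ z) (φ z') - inner ℝ (φ' z) (φ' z')| ≤ ε)
    (hΘ : ∑ i ∈ s, c i ^ 2 ≤ Θ * p) :
    effDim (fun i => c i • φ (x i)) s p ≤
      effDim (fun i => c i • φ' (x i)) s p * (1 + 2 * ε * Θ) + 2 * ε * Θ := by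
  have h1 : ∀ i ∈ s, p * ridgeForm (fun i => c i • φ (x i)) s p (c i • φ (x i)) (c i • φ (x i)) ≤
      p * ridgeForm (fun i => c i • φ' (x i)) s p (c i • φ' (x i)) (c i • φ' (x i)) *
        (1 + 2 * ε * Θ) + 2 * ε * c i ^ 2 := by
    intro i _
    rw [ridgeForm_smul_smul hp, ridgeForm_smul_smul hp]
    have := mul_le_mul_of_nonneg_left (ridgeForm_le_feature (x := x) hp hε0 hε hΘ (x i))
      (sq_nonneg (c i))
    linarith
  have h2 := Finset.sum_le_sum h1
  rw [Finset.sum_add_distrib, ← Finset.mul_sum, ← Finset.sum_mul, ← Finset.mul_sum,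
    ← Finset.mul_sum] at h2
  have h3 : 2 * ε * ∑ i ∈ s, c i ^ 2 ≤ 2 * ε * (Θ * p) := by gcongr
  refine le_of_mul_le_mul_left ?_ hp
  unfold effDim
  linarith

end FeatureComparison

end WGPUCB

namespace WGPUCB

section Identification

variable {E X : Type*} [NormedAddCommGroup E] [InnerProductSpace ℝ E]

/-- The feature vectors of the weighted problem. -/
def weightedVec (φ : X → E) (w : ℕ → ℝ) (x : ℕ → X) (i : ℕ) : E :=
  √(w (i + 1)) • φ (x (i + 1))

/-- The feature vectors of the double-weighted problem. -/
def doubleVec (φ : X → E) (w : ℕ → ℝ) (x : ℕ → X) (i : ℕ) : E :=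
  w (i + 1) • φ (x (i + 1))

lemma log_det_regGram_fin (ψ : ℕ → E) (t : ℕ) (p : ℝ) :
    Real.log (regGram (fun i : Fin t => ψ i) p).det = logDet ψ (Finset.range t) p := by
  let e : Fin t ≃ Finset.range t :=
    Equiv.ofBijective (fun i => ⟨i, Finset.mem_range.mpr i.2⟩)
      ⟨fun i j hij => Fin.ext (congrArg Subtype.val hij), fun j =>
        ⟨⟨j, Finset.mem_range.mp j.2⟩, rfl⟩⟩
  rw [logDet, ← det_regGram_equiv e]
  rfl

lemma det_gram_add_ne_zero (ψ : ℕ → E) (t : ℕ) {p : ℝ} (hp : 0 < p) :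
    (Matrix.of (fun i j : Fin t => inner ℝ (ψ i) (ψ j)) + p • (1 : Matrix (Fin t) (Fin t) ℝ)).det
      ≠ 0 := by
  have h : Matrix.of (fun i j : Fin t => inner ℝ (ψ i) (ψ j)) +
      p • (1 : Matrix (Fin t) (Fin t) ℝ) = p • regGram (fun i : Fin t => ψ i) p := by
    rw [regGram, smul_add, smul_smul, mul_inv_cancel₀ hp.ne', one_smul, add_comm]
  rw [h, Matrix.det_smul]
  refine mul_ne_zero (pow_ne_zero _ hp.ne') ?_
  let e : Fin t ≃ Finset.range t :=
    Equiv.ofBijective (fun i => ⟨i, Finset.mem_range.mpr i.2⟩)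
      ⟨fun i j hij => Fin.ext (congrArg Subtype.val hij), fun j =>
        ⟨⟨j, Finset.mem_range.mp j.2⟩, rfl⟩⟩
  have h2 := det_regGram_equiv e (fun j : Finset.range t => ψ j) p
  exact (h2.trans_ne (det_regGram_pos hp _).ne')

lemma inv_gram_mulVec (ψ : ℕ → E) (t : ℕ) {p : ℝ} (hp : 0 < p) (z : E) :
    (Matrix.of (fun i j : Fin t => inner ℝ (ψ i) (ψ j)) +
        p • (1 : Matrix (Fin t) (Fin t) ℝ))⁻¹ *ᵥ (fun i : Fin t => inner ℝ (ψ i) z) =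
      fun i : Fin t => inner ℝ (ψ i) (ridgeInv ψ (Finset.range t) p z) := by
  set M := Matrix.of (fun i j : Fin t => inner ℝ (ψ i) (ψ j)) +
        p • (1 : Matrix (Fin t) (Fin t) ℝ) with hM
  set u := ridgeInv ψ (Finset.range t) p z with hu
  have h : M *ᵥ (fun i : Fin t => inner ℝ (ψ i) u) = fun i : Fin t => inner ℝ (ψ i) z := by
    funext i
    have h1 : z = p • u + ∑ j : Fin t, inner ℝ (ψ j) u • ψ j := by
      rw [Fin.sum_univ_eq_sum_range (fun i => inner ℝ (ψ i) u • ψ i)]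
      exact (ridge_ridgeInv hp z).symm
    rw [h1, inner_add_right, inner_smul_right, inner_sum, hM, Matrix.add_mulVec, Matrix.smul_mulVec,
      Matrix.one_mulVec]
    simp only [Pi.add_apply, Pi.smul_apply, smul_eq_mul, Matrix.mulVec, dotProduct,
      Matrix.of_apply, inner_smul_right]
    rw [add_comm]
    congr 1
    exact Finset.sum_congr rfl fun j _ => mul_comm _ _
  rw [← h, Matrix.mulVec_mulVec, Matrix.nonsing_inv_mul _ (det_gram_add_ne_zero ψ t hp).isUnit,
    Matrix.one_mulVec]

variable {k : X → X → ℝ} {w : ℕ → ℝ} {lam : ℝ} {φ : X → E}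

lemma weightedGram_eq (hk : ∀ z z', k z z' = inner ℝ (φ z) (φ z')) (x : ℕ → X) (t : ℕ) :
    weightedGram k w x t =
      Matrix.of fun i j : Fin t => inner ℝ (weightedVec φ w x i) (weightedVec φ w x j) := by
  ext i j
  simp only [weightedGram, weightMatrix, Matrix.diagonal_transpose, Matrix.mul_diagonal,
    Matrix.diagonal_mul, gram, Matrix.of_apply, hk, weightedVec, inner_smul_left, inner_smul_right,
    conj_trivial]
  ring

lemma weightedKernelVec_eq (hk : ∀ z z', k z z' = inner ℝ (φ z) (φ z')) (x : ℕ → X) (t : ℕ)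
    (z : X) :
    weightedKernelVec k w x t z = fun i : Fin t => inner ℝ (weightedVec φ w x i) (φ z) := by
  funext i
  simp [weightedKernelVec, weightMatrix, Matrix.mulVec_diagonal, hk, weightedVec, inner_smul_left]

lemma postVar_eq (hk : ∀ z z', k z z' = inner ℝ (φ z) (φ z')) (x : ℕ → X) (t : ℕ)
    (hp : 0 < reg w lam t) (z : X) :
    postVar k w lam x t z = reg w lam t *
      ridgeForm (weightedVec φ w x) (Finset.range t) (reg w lam t) (φ z) (φ z) := by
  rw [postVar, weightedGram_eq hk, weightedKernelVec_eq hk, inv_gram_mulVec _ _ hp, hk]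
  set u := ridgeInv (weightedVec φ w x) (Finset.range t) (reg w lam t) (φ z) with hu
  have h1 := inner_ridge (ψ := weightedVec φ w x) (s := Finset.range t) (p := reg w lam t) (φ z) u
  rw [hu, ridge_ridgeInv hp, ← hu] at h1
  rw [h1, dotProduct, Fin.sum_univ_eq_sum_range
    (fun i => inner ℝ (weightedVec φ w x i) (φ z) * inner ℝ (weightedVec φ w x i) u),
    add_sub_cancel_right]
  rfl

lemma postMean_eq (hk : ∀ z z', k z z' = inner ℝ (φ z) (φ z')) (x : ℕ → X) (y : ℕ → ℝ) (t : ℕ)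
    (hw : ∀ t, 0 < w t) (hp : 0 < reg w lam t) (z : X) :
    postMean k w lam x y t z = ∑ i ∈ Finset.range t, (w (i + 1) * y (i + 1)) *
      inner ℝ (φ (x (i + 1)))
        (ridgeInv (weightedVec φ w x) (Finset.range t) (reg w lam t) (φ z)) := by
  have hsymm : ((Matrix.of (fun i j : Fin t => inner ℝ (weightedVec φ w x i) (weightedVec φ w x j))
      + reg w lam t • (1 : Matrix (Fin t) (Fin t) ℝ))⁻¹)ᵀ =
      (Matrix.of (fun i j : Fin t => inner ℝ (weightedVec φ w x i) (weightedVec φ w x j))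
      + reg w lam t • (1 : Matrix (Fin t) (Fin t) ℝ))⁻¹ := by
    rw [Matrix.transpose_nonsing_inv, Matrix.transpose_add, Matrix.transpose_smul,
      Matrix.transpose_one]
    congr 2
    ext i j
    simp [real_inner_comm]
  rw [postMean, weightedGram_eq hk, weightedKernelVec_eq hk, Matrix.dotProduct_mulVec,
    ← Matrix.mulVec_transpose, hsymm, inv_gram_mulVec _ _ hp]
  set u := ridgeInv (weightedVec φ w x) (Finset.range t) (reg w lam t) (φ z) with hu
  rw [← Fin.sum_univ_eq_sum_range (fun i => (w (i + 1) * y (i + 1)) * inner ℝ (φ (x (i + 1))) u),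
    dotProduct]
  refine Finset.sum_congr rfl fun i _ => ?_
  simp only [weightedVec, weightedObs, weightMatrix, Matrix.mulVec_diagonal, inner_smul_left,
    conj_trivial]
  have := Real.mul_self_sqrt (hw (i + 1)).le
  linear_combination (inner ℝ (φ (x (i + 1))) u * y (i + 1)) * this

lemma featGain_eq {m : ℕ} (feat : X → EuclideanSpace ℝ (Fin m)) (x : ℕ → X) (t : ℕ) :
    featGain w lam x t feat =
      1 / 2 * logDet (weightedVec feat w x) (Finset.range t) (reg w lam t) := by
  rw [featGain, ← log_det_regGram_fin, regGram]
  have hF : ∀ (i : Fin t) (l : Fin m),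
      featMatrix w x t feat i l = √(w (i + 1)) * feat (x (i + 1)) l := fun i l => by
    rw [featMatrix, weightMatrix, Matrix.diagonal_mul, Matrix.of_apply]
  congr 5
  ext i j
  simp only [hF, Matrix.mul_apply, Matrix.of_apply, Matrix.transpose_apply, weightedVec, inner_smul_left, inner_smul_right, conj_trivial,
    PiLp.inner_apply, RCLike.inner_apply, Finset.mul_sum]
  exact Finset.sum_congr rfl fun l _ => by ring

lemma doubleGain_term_eq (hk : ∀ z z', k z z' = inner ℝ (φ z) (φ z')) (hw : ∀ t, 0 < w t)
    (x : ℕ → X) (t : ℕ) :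
    (1 / 2) * Real.log (1 + (doubleReg w lam t)⁻¹ •
      (weightMatrix w t ^ 2 * gram k t (fun i => x (i + 1)) * (weightMatrix w t ^ 2)ᵀ)).det =
      1 / 2 * logDet (doubleVec φ w x) (Finset.range t) (doubleReg w lam t) := by
  rw [← log_det_regGram_fin, regGram]
  congr 5
  have hW : weightMatrix w t ^ 2 = Matrix.diagonal fun i : Fin t => w (i + 1) := by
    rw [weightMatrix, Matrix.diagonal_pow]
    congr 1
    funext i
    exact Real.sq_sqrt (hw _).le
  rw [hW]
  ext i j
  simp only [Matrix.diagonal_transpose, Matrix.mul_diagonal, Matrix.diagonal_mul, gram,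
    Matrix.of_apply, hk, doubleVec, inner_smul_left, inner_smul_right, conj_trivial]
  ring

end Identification

section Gain

variable {E X : Type*} [NormedAddCommGroup E] [InnerProductSpace ℝ E]
  {k : X → X → ℝ} {w : ℕ → ℝ} {lam : ℝ} {φ : X → E}

lemma doubleGain_bddAbove (hk : ∀ z z', k z z' = inner ℝ (φ z) (φ z')) (hk1 : ∀ z, k z z ≤ 1)
    (hw : ∀ t, 0 < w t) (hlam : 0 < lam) [Nonempty X] (t : ℕ) :
    BddAbove (Set.range fun a : Fin t → X => (1 / 2) * Real.log
      (1 + (doubleReg w lam t)⁻¹ •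
        (weightMatrix w t ^ 2 * gram k t a * (weightMatrix w t ^ 2)ᵀ)).det) := by
  have hp : 0 < doubleReg w lam t := mul_pos hlam (pow_pos (hw t) 2)
  refine ⟨1 / 2 * ∑ i ∈ Finset.range t, (doubleReg w lam t)⁻¹ * w (i + 1) ^ 2, ?_⟩
  rintro _ ⟨a, rfl⟩
  obtain ⟨z0⟩ := ‹Nonempty X›
  set x : ℕ → X := fun i => if h : i - 1 < t then a ⟨i - 1, h⟩ else z0 with hx
  have ha : a = fun i : Fin t => x (i + 1) := by
    funext i
    simp [hx]
  simp only
  rw [ha, doubleGain_term_eq hk hw]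
  have h1 := logDet_le_sum (ψ := doubleVec φ w x) hp (Finset.range t)
  have h2 : ∑ i ∈ Finset.range t, (doubleReg w lam t)⁻¹ * ‖doubleVec φ w x i‖ ^ 2 ≤
      ∑ i ∈ Finset.range t, (doubleReg w lam t)⁻¹ * w (i + 1) ^ 2 := by
    refine Finset.sum_le_sum fun i _ => mul_le_mul_of_nonneg_left ?_ (inv_pos.mpr hp).le
    rw [doubleVec, norm_smul, mul_pow, Real.norm_eq_abs, sq_abs, ← real_inner_self_eq_norm_sq,
      ← hk]
    exact mul_le_of_le_one_right (sq_nonneg _) (hk1 _)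
  linarith

lemma logDet_le_two_mul_doubleGain (hk : ∀ z z', k z z' = inner ℝ (φ z) (φ z'))
    (hk1 : ∀ z, k z z ≤ 1) (hw : ∀ t, 0 < w t) (hlam : 0 < lam) (x : ℕ → X) (t : ℕ) :
    logDet (doubleVec φ w x) (Finset.range t) (doubleReg w lam t) ≤
      2 * doubleGain k w lam t := by
  have : Nonempty X := ⟨x 0⟩
  have h := le_ciSup (doubleGain_bddAbove (lam := lam) hk hk1 hw hlam t) fun i => x (i + 1)
  rw [doubleGain_term_eq hk hw] at h
  unfold doubleGain
  linarith

lemma doubleGain_nonneg (hk : ∀ z z', k z z' = inner ℝ (φ z) (φ z'))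
    (hk1 : ∀ z, k z z ≤ 1) (hw : ∀ t, 0 < w t) (hlam : 0 < lam) [hX : Nonempty X] (t : ℕ) :
    0 ≤ doubleGain k w lam t := by
  have h := logDet_le_two_mul_doubleGain hk hk1 hw hlam (fun _ => hX.some) t
  have h2 := logDet_nonneg (ψ := doubleVec φ w fun _ => hX.some)
    (mul_pos hlam (pow_pos (hw t) 2)) (Finset.range t)
  unfold doubleReg at h
  linarith

lemma doubleGain_le_of_forall (hk : ∀ z z', k z z' = inner ℝ (φ z) (φ z')) (hw : ∀ t, 0 < w t)
    [hX : Nonempty X] {t : ℕ} {M : ℝ}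
    (h : ∀ x : ℕ → X, logDet (doubleVec φ w x) (Finset.range t) (doubleReg w lam t) ≤ 2 * M) :
    doubleGain k w lam t ≤ M := by
  refine ciSup_le fun a => ?_
  set x : ℕ → X := fun i => if h : i - 1 < t then a ⟨i - 1, h⟩ else hX.some with hx
  have ha : a = fun i : Fin t => x (i + 1) := by
    funext i
    simp [hx]
  rw [ha, doubleGain_term_eq hk hw]
  linarith [h x]

end Gain

section ExpWeight

variable {η : ℝ}

lemma expWeight_pos (hη : 0 < η) (t : ℕ) : 0 < expWeight η t := by
  unfold expWeight
  positivity

lemma expWeight_succ (η : ℝ) (t : ℕ) : expWeight η (t + 1) = η⁻¹ * expWeight η t := by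
  rw [expWeight, expWeight, pow_succ, mul_inv, mul_comm]

lemma expWeight_add (η : ℝ) (s t : ℕ) : expWeight η (s + t) = expWeight η s * expWeight η t := by
  rw [expWeight, expWeight, expWeight, pow_add, mul_inv]

lemma one_le_expWeight (hη : 0 < η) (hη' : η < 1) (t : ℕ) : 1 ≤ expWeight η t :=
  (one_le_inv₀ (by positivity)).mpr (pow_le_one₀ hη.le hη'.le)

lemma expWeight_mono (hη : 0 < η) (hη' : η < 1) {s t : ℕ} (h : s ≤ t) :
    expWeight η s ≤ expWeight η t := by
  obtain ⟨r, rfl⟩ := Nat.exists_eq_add_of_le h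
  rw [expWeight_add]
  exact le_mul_of_one_le_right (expWeight_pos hη s).le (one_le_expWeight hη hη' r)

lemma expWeight_eq_mul_pow (hη : 0 < η) {s t : ℕ} (h : s ≤ t) :
    expWeight η s = expWeight η t * η ^ (t - s) := by
  obtain ⟨r, rfl⟩ := Nat.exists_eq_add_of_le h
  rw [expWeight_add, Nat.add_sub_cancel_left, expWeight, expWeight, mul_assoc,
    inv_mul_cancel₀ (by positivity), mul_one]

lemma sum_pow_le (hη : 0 < η) (hη' : η < 1) (n : ℕ) :
    ∑ i ∈ Finset.range n, η ^ i ≤ (1 - η)⁻¹ := by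
  rw [← tsum_geometric_of_lt_one hη.le hη']
  exact (summable_geometric_of_lt_one hη.le hη').sum_le_tsum _ fun i _ => by positivity

lemma sum_expWeight_le (hη : 0 < η) (hη' : η < 1) (n : ℕ) :
    ∑ i ∈ Finset.range n, expWeight η (i + 1) ≤ (1 - η)⁻¹ * expWeight η n := by
  have h : ∀ i ∈ Finset.range n, expWeight η (i + 1) = expWeight η n * η ^ (n - 1 - i) := by
    intro i hi
    rw [expWeight_eq_mul_pow hη (Finset.mem_range.mp hi), Nat.sub_sub, add_comm 1 i]
  rw [Finset.sum_congr rfl h, Finset.sum_range_reflect (fun i => expWeight η n * η ^ i),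
    ← Finset.mul_sum, mul_comm]
  exact mul_le_mul_of_nonneg_right (sum_pow_le hη hη' n) (expWeight_pos hη n).le

lemma sum_expWeight_sq_le (hη : 0 < η) (hη' : η < 1) (n : ℕ) :
    ∑ i ∈ Finset.range n, expWeight η (i + 1) ^ 2 ≤ (1 - η)⁻¹ * expWeight η n ^ 2 := by
  calc _ ≤ ∑ i ∈ Finset.range n, expWeight η (i + 1) * expWeight η n := by
        refine Finset.sum_le_sum fun i hi => ?_
        rw [sq]
        exact mul_le_mul_of_nonneg_left (expWeight_mono hη hη' (Finset.mem_range.mp hi))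
          (expWeight_pos hη _).le
    _ = (∑ i ∈ Finset.range n, expWeight η (i + 1)) * expWeight η n := by rw [Finset.sum_mul]
    _ ≤ (1 - η)⁻¹ * expWeight η n * expWeight η n :=
        mul_le_mul_of_nonneg_right (sum_expWeight_le hη hη' n) (expWeight_pos hη n).le
    _ = _ := by ring

variable {E X : Type*} [NormedAddCommGroup E] [InnerProductSpace ℝ E]
  {k : X → X → ℝ} {lam : ℝ} {φ : X → E}

lemma doubleGain_le_succ (hk : ∀ z z', k z z' = inner ℝ (φ z) (φ z')) (hk1 : ∀ z, k z z ≤ 1)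
    (hη : 0 < η) (hlam : 0 < lam) [Nonempty X] (t : ℕ) :
    doubleGain k (expWeight η) lam t ≤ doubleGain k (expWeight η) lam (t + 1) := by
  have hw := expWeight_pos hη
  refine doubleGain_le_of_forall hk hw fun x => ?_
  refine le_trans ?_ (logDet_le_two_mul_doubleGain hk hk1 hw hlam (fun i => x (i - 1)) (t + 1))
  have hp : 0 < doubleReg (expWeight η) lam (t + 1) := mul_pos hlam (pow_pos (hw _) 2)
  refine le_trans (le_of_eq ?_) (logDet_mono hp (s := (Finset.range t).map (addRightEmbedding 1))
    fun i hi => ?_)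
  · symm
    apply logDet_map
    intro i _ j _
    simp only [doubleVec, doubleReg, addRightEmbedding_apply, Nat.add_sub_cancel,
      inner_smul_left, inner_smul_right, conj_trivial, expWeight_succ η (i + 1),
      expWeight_succ η (j + 1), expWeight_succ η t]
    have := (hw t).ne'
    field_simp
  · obtain ⟨j, hj, rfl⟩ := Finset.mem_map.mp hi
    simpa using hj

lemma doubleGain_mono (hk : ∀ z z', k z z' = inner ℝ (φ z) (φ z')) (hk1 : ∀ z, k z z ≤ 1)
    (hη : 0 < η) (hlam : 0 < lam) [Nonempty X] :
    Monotone (doubleGain k (expWeight η) lam) :=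
  monotone_nat_of_le_succ (doubleGain_le_succ hk hk1 hη hlam)

end ExpWeight

end WGPUCB

namespace WGPUCB

section Gaussian

open Real ENNReal

lemma lintegral_exp_quadratic {A : ℝ} (hA : 0 < A) (b : ℝ) :
    ∫⁻ g : ℝ, ENNReal.ofReal (exp (-A * g ^ 2 + b * g)) =
      ENNReal.ofReal (√(π / A) * exp (b ^ 2 / (4 * A))) := by
  have h1 : ∀ g : ℝ, exp (-A * g ^ 2 + b * g) =
      exp (b ^ 2 / (4 * A)) * exp (-A * (g - b / (2 * A)) ^ 2) := by
    intro g
    rw [← exp_add]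
    congr 1
    field_simp
    ring
  simp only [h1, ENNReal.ofReal_mul (exp_pos _).le]
  rw [lintegral_const_mul _ (by fun_prop),
    lintegral_sub_right_eq_self (fun g => ENNReal.ofReal (exp (-A * g ^ 2))),
    ← ofReal_integral_eq_lintegral_ofReal (integrable_exp_neg_mul_sq hA)
      (Filter.Eventually.of_forall fun _ => (exp_pos _).le), integral_gaussian, mul_comm,
    ENNReal.ofReal_mul (sqrt_nonneg _)]

lemma mul_ofReal_mul_ofReal (z : ENNReal) {a b : ℝ} (ha : 0 ≤ a) :
    z * ENNReal.ofReal a * ENNReal.ofReal b = z * ENNReal.ofReal (a * b) := by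
  rw [mul_assoc, ← ENNReal.ofReal_mul ha]

end Gaussian

section OneStep

open Real

variable {Ω : Type*} {F m0 : MeasurableSpace Ω} {μ : @Measure Ω m0} {ζ : Ω → ℝ}

lemma lintegral_mul_exp_const_le [IsProbabilityMeasure μ] (hF : F ≤ m0)
    (hζ : @Measurable _ _ m0 _ ζ) (hsub : @CondSubGaussian Ω m0 μ F ζ 1) (u : ℝ) {Y : Ω → ENNReal}
    (hY : @Measurable _ _ F _ Y) :
    ∫⁻ ω, Y ω * ENNReal.ofReal (exp (u * ζ ω)) ∂μ ≤
      ∫⁻ ω, Y ω * ENNReal.ofReal (exp (u ^ 2 / 2)) ∂μ := by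
  set g : Ω → ENNReal := fun ω => ENNReal.ofReal (exp (u * ζ ω)) with hg
  set c := ENNReal.ofReal (exp (u ^ 2 / 2)) with hc
  have hgm : @Measurable _ _ m0 _ g := by fun_prop
  have hYm : @Measurable _ _ m0 _ Y := hY.mono hF le_rfl
  obtain ⟨hint, hcond⟩ := hsub u
  have hle : (μ.withDensity g).trim hF ≤ (c • μ).trim hF := by
    refine Measure.le_iff.mpr fun s hs => ?_
    rw [trim_measurableSet_eq hF hs, trim_measurableSet_eq hF hs, withDensity_apply _ (hF s hs),
      Measure.smul_apply, smul_eq_mul,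
      ← ofReal_integral_eq_lintegral_ofReal hint.integrableOn
        (Filter.Eventually.of_forall fun _ => (exp_pos _).le),
      ← setIntegral_condExp hF hint hs]
    have h1 : ∫ ω in s, (μ[fun ω => exp (u * ζ ω) | F]) ω ∂μ ≤
        ∫ _ω in s, exp (u ^ 2 / 2) ∂μ := by
      refine setIntegral_mono_ae integrable_condExp.integrableOn
        (integrable_const _).integrableOn ?_
      filter_upwards [hcond] with ω hω
      simpa using hω
    refine (ENNReal.ofReal_le_ofReal h1).trans (le_of_eq ?_)
    rw [setIntegral_const, smul_eq_mul, mul_comm, ENNReal.ofReal_mul (exp_pos _).le, measureReal_def,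
      ENNReal.ofReal_toReal (measure_ne_top _ _)]
  have h2 : ∫⁻ ω, Y ω * g ω ∂μ = ∫⁻ ω, Y ω ∂((μ.withDensity g).trim hF) := by
    rw [lintegral_trim hF hY, lintegral_withDensity_eq_lintegral_mul _ hgm hYm]
    exact lintegral_congr fun ω => mul_comm _ _
  rw [h2]
  refine (lintegral_mono' hle le_rfl).trans (le_of_eq ?_)
  rw [lintegral_trim hF hY, lintegral_smul_measure, lintegral_mul_const _ hYm, smul_eq_mul, mul_comm]

/-- Rounding towards zero. -/
def roundToZero (r : ℝ) : ℤ := if 0 ≤ r then ⌊r⌋ else ⌈r⌉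

lemma measurable_roundToZero : Measurable roundToZero :=
  Measurable.ite measurableSet_Ici Int.measurable_floor Int.measurable_ceil

lemma abs_roundToZero_le (r : ℝ) : |(roundToZero r : ℝ)| ≤ |r| := by
  unfold roundToZero
  split_ifs with h
  · rw [abs_of_nonneg h, abs_of_nonneg (by exact_mod_cast Int.floor_nonneg.mpr h)]
    exact Int.floor_le r
  · push Not at h
    have h1 : ((⌈r⌉ : ℤ) : ℝ) ≤ 0 := by exact_mod_cast Int.ceil_le.mpr (by simpa using h.le)
    rw [abs_of_neg h, abs_of_nonpos h1]
    linarith [Int.le_ceil r]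

lemma abs_roundToZero_sub_le (r : ℝ) : |(roundToZero r : ℝ) - r| ≤ 1 := by
  unfold roundToZero
  rw [abs_le]
  split_ifs with h
  · constructor <;> linarith [Int.floor_le r, Int.lt_floor_add_one r]
  · constructor <;> linarith [Int.le_ceil r, Int.ceil_lt_add_one r]

lemma lintegral_mul_exp_le [IsProbabilityMeasure μ] (hF : F ≤ m0)
    (hζ : @Measurable _ _ m0 _ ζ) (hsub : @CondSubGaussian Ω m0 μ F ζ 1) {U : Ω → ℝ}
    (hU : @Measurable _ _ F _ U) {Y : Ω → ENNReal} (hY : @Measurable _ _ F _ Y) :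
    ∫⁻ ω, Y ω * ENNReal.ofReal (exp (U ω * ζ ω)) ∂μ ≤
      ∫⁻ ω, Y ω * ENNReal.ofReal (exp (U ω ^ 2 / 2)) ∂μ := by
  have hYm : @Measurable _ _ m0 _ Y := hY.mono hF le_rfl
  set N : ℕ → Ω → ℤ := fun k ω => roundToZero ((k + 1) * U ω) with hN
  set V : ℕ → Ω → ℝ := fun k ω => (N k ω : ℝ) / (k + 1) with hV
  have hNm : ∀ k, @Measurable _ _ F _ (N k) := fun k =>
    measurable_roundToZero.comp (hU.const_mul _)
  have hVm : ∀ k, @Measurable _ _ m0 _ (V k) := fun k =>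
    ((measurable_from_top (f := fun n : ℤ => (n : ℝ) / (k + 1))).comp (hNm k)).mono hF le_rfl
  have habs : ∀ k ω, |V k ω| ≤ |U ω| := by
    intro k ω
    have h := abs_roundToZero_le ((k + 1) * U ω)
    have hk : (0 : ℝ) < k + 1 := by positivity
    rw [abs_mul, abs_of_pos hk] at h
    rw [hV]
    simp only
    rw [abs_div, abs_of_pos hk, div_le_iff₀ hk, mul_comm]
    exact h
  have hlim : ∀ ω, Filter.Tendsto (fun k => V k ω) Filter.atTop (nhds (U ω)) := by
    intro ω
    rw [tendsto_iff_dist_tendsto_zero]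
    refine squeeze_zero (fun _ => dist_nonneg) (fun k => ?_) tendsto_one_div_add_atTop_nhds_zero_nat
    have h := abs_roundToZero_sub_le ((k + 1) * U ω)
    have hk : (0 : ℝ) < k + 1 := by positivity
    rw [Real.dist_eq, hV, le_div_iff₀ hk, ← abs_of_pos hk, ← abs_mul]
    simp only
    rw [sub_mul, div_mul_cancel₀ _ hk.ne', mul_comm (U ω)]
    exact h
  have hstep : ∀ k, ∫⁻ ω, Y ω * ENNReal.ofReal (exp (V k ω * ζ ω)) ∂μ ≤
      ∫⁻ ω, Y ω * ENNReal.ofReal (exp (U ω ^ 2 / 2)) ∂μ := by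
    intro k
    have hset : ∀ n : ℤ, @MeasurableSet _ F (N k ⁻¹' {n}) := fun n =>
      hNm k (measurableSet_singleton n)
    have hdecomp : ∀ f : Ω → ENNReal,
        ∫⁻ ω, f ω ∂μ = ∑' n : ℤ, ∫⁻ ω in N k ⁻¹' {n}, f ω ∂μ := by
      intro f
      rw [← lintegral_iUnion (fun n => hF _ (hset n)), ← Set.preimage_iUnion,
        Set.iUnion_of_singleton, Set.preimage_univ, Measure.restrict_univ]
      intro i j hij
      exact Disjoint.preimage _ (Set.disjoint_singleton.mpr hij)
    rw [hdecomp, hdecomp (fun ω => Y ω * ENNReal.ofReal (exp (U ω ^ 2 / 2)))]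
    refine ENNReal.tsum_le_tsum fun n => ?_
    have h1 := lintegral_mul_exp_const_le hF hζ hsub ((n : ℝ) / (k + 1))
      (hY.indicator (hset n))
    calc ∫⁻ ω in N k ⁻¹' {n}, Y ω * ENNReal.ofReal (exp (V k ω * ζ ω)) ∂μ
        = ∫⁻ ω, (N k ⁻¹' {n}).indicator Y ω *
            ENNReal.ofReal (exp ((n : ℝ) / (k + 1) * ζ ω)) ∂μ := by
          rw [← lintegral_indicator (hF _ (hset n))]
          refine lintegral_congr fun ω => ?_
          by_cases h : ω ∈ N k ⁻¹' {n}
          · have h' : N k ω = n := h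
            simp [hV, h']
          · simp [Set.indicator_of_notMem h]
      _ ≤ ∫⁻ ω, (N k ⁻¹' {n}).indicator Y ω *
            ENNReal.ofReal (exp (((n : ℝ) / (k + 1)) ^ 2 / 2)) ∂μ := h1
      _ ≤ ∫⁻ ω in N k ⁻¹' {n}, Y ω * ENNReal.ofReal (exp (U ω ^ 2 / 2)) ∂μ := by
          rw [← lintegral_indicator (hF _ (hset n))]
          refine lintegral_mono fun ω => ?_
          by_cases h : ω ∈ N k ⁻¹' {n}
          · have h' : N k ω = n := h
            simp only [Set.indicator_of_mem h]
            refine mul_le_mul' le_rfl (ENNReal.ofReal_le_ofReal (exp_le_exp.mpr ?_))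
            have := habs k ω
            simp only [hV, h'] at this
            linarith [sq_le_sq.mpr this]
          · simp [Set.indicator_of_notMem h]
  calc ∫⁻ ω, Y ω * ENNReal.ofReal (exp (U ω * ζ ω)) ∂μ
      ≤ ∫⁻ ω, Filter.liminf (fun k => Y ω * ENNReal.ofReal (exp (V k ω * ζ ω))) Filter.atTop ∂μ := by
        refine lintegral_mono fun ω => le_of_eq (Eq.symm ?_)
        apply Filter.Tendsto.liminf_eq
        refine ENNReal.Tendsto.const_mul ?_ (Or.inl (ENNReal.ofReal_pos.mpr (exp_pos _)).ne')
        exact ENNReal.tendsto_ofReal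
          ((continuous_exp.tendsto _).comp ((hlim ω).mul_const (ζ ω)))
    _ ≤ Filter.liminf (fun k => ∫⁻ ω, Y ω * ENNReal.ofReal (exp (V k ω * ζ ω)) ∂μ) Filter.atTop :=
        lintegral_liminf_le fun k => by
          have := hVm k
          fun_prop
    _ ≤ Filter.liminf (fun _ : ℕ => ∫⁻ ω, Y ω * ENNReal.ofReal (exp (U ω ^ 2 / 2)) ∂μ)
          Filter.atTop := Filter.liminf_le_liminf (Filter.Eventually.of_forall hstep)
    _ = _ := Filter.liminf_const _

/-- One step of the method of mixtures. -/
lemma lintegral_mul_exp_quadratic_le [IsProbabilityMeasure μ] (hF : F ≤ m0)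
    (hζ : @Measurable _ _ m0 _ ζ) (hsub : @CondSubGaussian Ω m0 μ F ζ 1) {a b : Ω → ℝ}
    (ha : @Measurable _ _ F _ a) (hb : @Measurable _ _ F _ b) (ha0 : ∀ ω, 0 ≤ a ω)
    {Y : Ω → ENNReal} (hY : @Measurable _ _ F _ Y) :
    ∫⁻ ω, Y ω * ENNReal.ofReal
        (exp ((ζ ω ^ 2 * a ω + 2 * ζ ω * b ω - b ω ^ 2) / (2 * (1 + a ω))) / √(1 + a ω)) ∂μ ≤
      ∫⁻ ω, Y ω ∂μ := by
  set β : Ω → ℝ := fun ω => b ω / (1 + a ω) with hβ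
  set c : Ω → ℝ := fun ω => √(a ω / (1 + a ω)) with hc
  set Z : Ω → ENNReal := fun ω => Y ω * ENNReal.ofReal
    (exp (-(b ω ^ 2 / (2 * (1 + a ω)))) / √(1 + a ω) / √(2 * π)) with hZ
  have hβF : @Measurable _ _ F _ β := hb.div (ha.const_add 1)
  have hcF : @Measurable _ _ F _ c := (ha.div (ha.const_add 1)).sqrt
  have hZF : @Measurable _ _ F _ Z := by fun_prop
  have hβm : @Measurable _ _ m0 _ β := hβF.mono hF le_rfl
  have hcm : @Measurable _ _ m0 _ c := hcF.mono hF le_rfl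
  have hZm : @Measurable _ _ m0 _ Z := hZF.mono hF le_rfl
  have hcsq : ∀ ω, c ω ^ 2 = a ω / (1 + a ω) := fun ω =>
    Real.sq_sqrt (div_nonneg (ha0 ω) (by linarith [ha0 ω]))
  have h1 : ∀ ω, Y ω * ENNReal.ofReal
        (exp ((ζ ω ^ 2 * a ω + 2 * ζ ω * b ω - b ω ^ 2) / (2 * (1 + a ω))) / √(1 + a ω)) =
      ∫⁻ g : ℝ, Z ω * ENNReal.ofReal (exp (-(g ^ 2 / 2))) *
        ENNReal.ofReal (exp ((β ω + c ω * g) * ζ ω)) := by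
    intro ω
    have hpos : 0 < 1 + a ω := by linarith [ha0 ω]
    have h2 : ∀ g : ℝ, Z ω * ENNReal.ofReal (exp (-(g ^ 2 / 2))) *
        ENNReal.ofReal (exp ((β ω + c ω * g) * ζ ω)) = Z ω * ENNReal.ofReal (exp (β ω * ζ ω)) *
          ENNReal.ofReal (exp (-(1 / 2) * g ^ 2 + (c ω * ζ ω) * g)) := by
      intro g
      rw [mul_ofReal_mul_ofReal _ (exp_pos _).le, mul_ofReal_mul_ofReal _ (exp_pos _).le,
        ← exp_add, ← exp_add]
      congr 3
      ring
    simp only [h2]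
    rw [lintegral_const_mul _ (by fun_prop), lintegral_exp_quadratic (by norm_num), hZ]
    simp only
    rw [mul_ofReal_mul_ofReal _ (by positivity), mul_ofReal_mul_ofReal _ (by positivity)]
    congr 2
    have h3 : π / (1 / 2) = 2 * π := by ring
    have h4 : √(2 * π) ≠ 0 := by positivity
    have h5 : exp ((ζ ω ^ 2 * a ω + 2 * ζ ω * b ω - b ω ^ 2) / (2 * (1 + a ω))) =
        exp (-(b ω ^ 2 / (2 * (1 + a ω)))) * (exp (β ω * ζ ω) *
          exp ((c ω * ζ ω) ^ 2 / (4 * (1 / 2)))) := by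
      rw [← exp_add, ← exp_add]
      congr 1
      rw [mul_pow, hcsq, hβ]
      simp only
      field_simp
      ring
    rw [h3, h5]
    field_simp
  have h6 : ∀ ω, ∫⁻ g : ℝ, Z ω * ENNReal.ofReal (exp (-(g ^ 2 / 2))) *
        ENNReal.ofReal (exp ((β ω + c ω * g) ^ 2 / 2)) = Y ω := by
    intro ω
    have hpos : 0 < 1 + a ω := by linarith [ha0 ω]
    have h2 : ∀ g : ℝ, Z ω * ENNReal.ofReal (exp (-(g ^ 2 / 2))) *
        ENNReal.ofReal (exp ((β ω + c ω * g) ^ 2 / 2)) = Z ω * ENNReal.ofReal (exp (β ω ^ 2 / 2)) *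
          ENNReal.ofReal (exp (-(1 / (2 * (1 + a ω))) * g ^ 2 + (β ω * c ω) * g)) := by
      intro g
      rw [mul_ofReal_mul_ofReal _ (exp_pos _).le, mul_ofReal_mul_ofReal _ (exp_pos _).le,
        ← exp_add, ← exp_add]
      congr 3
      have h7 : (β ω + c ω * g) ^ 2 = β ω ^ 2 + 2 * (β ω * c ω) * g + c ω ^ 2 * g ^ 2 := by ring
      rw [h7, hcsq]
      field_simp
      ring
    simp only [h2]
    rw [lintegral_const_mul _ (by fun_prop), lintegral_exp_quadratic (by positivity), hZ]
    simp only
    rw [mul_ofReal_mul_ofReal _ (by positivity), mul_ofReal_mul_ofReal _ (by positivity)]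
    have h8 : exp (-(b ω ^ 2 / (2 * (1 + a ω)))) / √(1 + a ω) / √(2 * π) *
        (exp (β ω ^ 2 / 2) * (√(π / (1 / (2 * (1 + a ω)))) *
          exp ((β ω * c ω) ^ 2 / (4 * (1 / (2 * (1 + a ω))))))) = 1 := by
      have h3 : π / (1 / (2 * (1 + a ω))) = (2 * π) * (1 + a ω) := by field_simp
      have h4 : √(2 * π) ≠ 0 := by positivity
      have h9 : √(1 + a ω) ≠ 0 := by positivity
      have h10 : exp (-(b ω ^ 2 / (2 * (1 + a ω)))) * (exp (β ω ^ 2 / 2) *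
          exp ((β ω * c ω) ^ 2 / (4 * (1 / (2 * (1 + a ω)))))) = 1 := by
        rw [← exp_add, ← exp_add, exp_eq_one_iff, mul_pow, hcsq, hβ]
        simp only
        field_simp
        ring
      rw [h3, Real.sqrt_mul (show (0 : ℝ) ≤ 2 * π by positivity)]
      generalize √(2 * π) = r at h4 ⊢
      generalize √(1 + a ω) = r' at h9 ⊢
      generalize exp (β ω ^ 2 / 2) = e₁ at h10 ⊢
      generalize exp (-(b ω ^ 2 / (2 * (1 + a ω)))) = e₂ at h10 ⊢
      generalize exp ((β ω * c ω) ^ 2 / (4 * (1 / (2 * (1 + a ω))))) = e₃ at h10 ⊢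
      field_simp
      linarith
    rw [h8, ENNReal.ofReal_one, mul_one]
  calc _ = ∫⁻ ω, ∫⁻ g : ℝ, Z ω * ENNReal.ofReal (exp (-(g ^ 2 / 2))) *
        ENNReal.ofReal (exp ((β ω + c ω * g) * ζ ω)) ∂volume ∂μ := lintegral_congr h1
    _ = ∫⁻ g : ℝ, ∫⁻ ω, Z ω * ENNReal.ofReal (exp (-(g ^ 2 / 2))) *
        ENNReal.ofReal (exp ((β ω + c ω * g) * ζ ω)) ∂μ := by
          rw [lintegral_lintegral_swap]
          fun_prop
    _ ≤ ∫⁻ g : ℝ, ∫⁻ ω, Z ω * ENNReal.ofReal (exp (-(g ^ 2 / 2))) *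
        ENNReal.ofReal (exp ((β ω + c ω * g) ^ 2 / 2)) ∂μ := by
          refine lintegral_mono fun g => ?_
          exact lintegral_mul_exp_le hF hζ hsub (hβF.add (hcF.mul_const g)) (hZF.mul_const _)
    _ = ∫⁻ ω, ∫⁻ g : ℝ, Z ω * ENNReal.ofReal (exp (-(g ^ 2 / 2))) *
        ENNReal.ofReal (exp ((β ω + c ω * g) ^ 2 / 2)) ∂volume ∂μ := by
          rw [lintegral_lintegral_swap]
          fun_prop
    _ = _ := lintegral_congr h6

end OneStep

end WGPUCB

namespace WGPUCB

section NoiseProcess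

variable {E X : Type*} [NormedAddCommGroup E] [InnerProductSpace ℝ E]

/-- The weighted noise `∑ wᵢ ζᵢ φ(xᵢ)`. -/
def noiseSum (φ : X → E) (w : ℕ → ℝ) (x : ℕ → X) (ζ : ℕ → ℝ) (n : ℕ) : E :=
  ∑ i ∈ Finset.range n, ζ (i + 1) • doubleVec φ w x i

/-- The squared self-normalized noise. -/
def noiseForm (φ : X → E) (w : ℕ → ℝ) (x : ℕ → X) (ζ : ℕ → ℝ) (p : ℝ) (n : ℕ) : ℝ :=
  ridgeForm (doubleVec φ w x) (Finset.range n) p (noiseSum φ w x ζ n) (noiseSum φ w x ζ n)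

/-- The mixture supermartingale. -/
def mixture (φ : X → E) (w : ℕ → ℝ) (x : ℕ → X) (ζ : ℕ → ℝ) (p : ℝ) (n : ℕ) : ℝ :=
  Real.exp ((noiseForm φ w x ζ p n - logDet (doubleVec φ w x) (Finset.range n) p) / 2)

variable {φ : X → E} {w : ℕ → ℝ} {p : ℝ}

lemma ridgeForm_add_self {ι : Type*} {ψ : ι → E} {s : Finset ι} (hp : 0 < p) (u v : E) (r : ℝ) :
    ridgeForm ψ s p (u + r • v) (u + r • v) =
      ridgeForm ψ s p u u + 2 * r * ridgeForm ψ s p v u + r ^ 2 * ridgeForm ψ s p v v := by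
  rw [ridgeForm_add_left, ridgeForm_add_right hp, ridgeForm_add_right hp, ridgeForm_smul_left,
    ridgeForm_smul_left, ridgeForm_smul_right hp, ridgeForm_smul_right hp, ridgeForm_comm hp u v]
  ring

lemma noiseForm_succ (hp : 0 < p) (x : ℕ → X) (ζ : ℕ → ℝ) (n : ℕ) :
    noiseForm φ w x ζ p (n + 1) = noiseForm φ w x ζ p n +
      (ζ (n + 1) ^ 2 * ridgeForm (doubleVec φ w x) (Finset.range n) p (doubleVec φ w x n)
          (doubleVec φ w x n) +
        2 * ζ (n + 1) * ridgeForm (doubleVec φ w x) (Finset.range n) p (doubleVec φ w x n)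
          (noiseSum φ w x ζ n) -
        ridgeForm (doubleVec φ w x) (Finset.range n) p (doubleVec φ w x n)
          (noiseSum φ w x ζ n) ^ 2) /
      (1 + ridgeForm (doubleVec φ w x) (Finset.range n) p (doubleVec φ w x n)
          (doubleVec φ w x n)) := by
  have ha := ridgeForm_self_nonneg (ψ := doubleVec φ w x) (s := Finset.range n) hp
    (doubleVec φ w x n)
  have hS : noiseSum φ w x ζ (n + 1) = noiseSum φ w x ζ n + ζ (n + 1) • doubleVec φ w x n := by
    rw [noiseSum, Finset.sum_range_succ, noiseSum]
  rw [noiseForm, hS, Finset.range_add_one, ridgeForm_insert hp Finset.notMem_range_self,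
    ridgeForm_add_self hp, noiseForm, ridgeForm_comm hp (noiseSum φ w x ζ n + _),
    ridgeForm_add_right hp, ridgeForm_smul_right hp]
  have : 1 + ridgeForm (doubleVec φ w x) (Finset.range n) p (doubleVec φ w x n)
    (doubleVec φ w x n) ≠ 0 := by positivity
  field_simp
  ring

lemma mixture_succ (hp : 0 < p) (x : ℕ → X) (ζ : ℕ → ℝ) (n : ℕ) :
    mixture φ w x ζ p (n + 1) = mixture φ w x ζ p n *
      (Real.exp ((ζ (n + 1) ^ 2 * ridgeForm (doubleVec φ w x) (Finset.range n) p
          (doubleVec φ w x n) (doubleVec φ w x n) +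
        2 * ζ (n + 1) * ridgeForm (doubleVec φ w x) (Finset.range n) p (doubleVec φ w x n)
          (noiseSum φ w x ζ n) -
        ridgeForm (doubleVec φ w x) (Finset.range n) p (doubleVec φ w x n)
          (noiseSum φ w x ζ n) ^ 2) /
      (2 * (1 + ridgeForm (doubleVec φ w x) (Finset.range n) p (doubleVec φ w x n)
          (doubleVec φ w x n)))) /
        √(1 + ridgeForm (doubleVec φ w x) (Finset.range n) p (doubleVec φ w x n)
          (doubleVec φ w x n))) := by
  have ha := ridgeForm_self_nonneg (ψ := doubleVec φ w x) (s := Finset.range n) hp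
    (doubleVec φ w x n)
  rw [mixture, mixture, noiseForm_succ hp, Finset.range_add_one,
    logDet_insert hp Finset.notMem_range_self]
  set a := ridgeForm (doubleVec φ w x) (Finset.range n) p (doubleVec φ w x n) (doubleVec φ w x n)
  have hsqrt : √(1 + a) = Real.exp (Real.log (1 + a) / 2) := by
    rw [Real.sqrt_eq_rpow, Real.rpow_def_of_pos (by positivity)]
    ring_nf
  rw [hsqrt, ← Real.exp_sub, ← Real.exp_add]
  congr 1
  field_simp
  ring

lemma mixture_zero (hp : 0 < p) (x : ℕ → X) (ζ : ℕ → ℝ) : mixture φ w x ζ p 0 = 1 := by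
  simp [mixture, noiseForm, noiseSum, ridgeForm_empty hp]

section Measurability

variable {Ω : Type*} [MeasurableSpace Ω] [MeasurableSpace X] {x : ℕ → Ω → X} {ζ : ℕ → Ω → ℝ}

lemma measurable_ridgeForm_path (hp : 0 < p)
    (hφ : Measurable fun q : X × X => inner ℝ (φ q.1) (φ q.2)) (n : ℕ)
    (hx : ∀ i < n, Measurable (x (i + 1))) :
    Measurable fun q : Ω × X × X =>
      ridgeForm (doubleVec φ w fun i => x i q.1) (Finset.range n) p (φ q.2.1) (φ q.2.2) := by
  induction n with
  | zero =>
    simp only [Finset.range_zero, ridgeForm_empty hp]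
    exact (hφ.comp measurable_snd).const_mul _
  | succ n ih =>
    have ih' := ih fun i hi => hx i (by omega)
    have hxn := hx n (by omega)
    simp only [Finset.range_add_one, ridgeForm_insert hp Finset.notMem_range_self]
    have h : ∀ (ω : Ω), doubleVec φ w (fun i => x i ω) n = w (n + 1) • φ (x (n + 1) ω) :=
      fun _ => rfl
    simp only [h, ridgeForm_smul_left, ridgeForm_smul_right hp]
    have h1 : Measurable fun q : Ω × X × X => ridgeForm (doubleVec φ w fun i => x i q.1)
        (Finset.range n) p (φ q.2.1) (φ (x (n + 1) q.1)) :=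
      ih'.comp (measurable_fst.prodMk
        ((measurable_fst.comp measurable_snd).prodMk (hxn.comp measurable_fst)))
    have h2 : Measurable fun q : Ω × X × X => ridgeForm (doubleVec φ w fun i => x i q.1)
        (Finset.range n) p (φ (x (n + 1) q.1)) (φ q.2.2) :=
      ih'.comp (measurable_fst.prodMk
        ((hxn.comp measurable_fst).prodMk (measurable_snd.comp measurable_snd)))
    have h3 : Measurable fun q : Ω × X × X => ridgeForm (doubleVec φ w fun i => x i q.1)
        (Finset.range n) p (φ (x (n + 1) q.1)) (φ (x (n + 1) q.1)) :=
      ih'.comp (measurable_fst.prodMk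
        ((hxn.comp measurable_fst).prodMk (hxn.comp measurable_fst)))
    exact ih'.sub (((h1.const_mul _).mul (h2.const_mul _)).div
      (((h3.const_mul _).const_mul _).const_add _))

lemma measurable_ridgeForm_noiseSum (hp : 0 < p)
    (hφ : Measurable fun q : X × X => inner ℝ (φ q.1) (φ q.2)) (n : ℕ)
    (hx : ∀ i < n, Measurable (x (i + 1))) (hζ : ∀ i < n, Measurable (ζ (i + 1))) :
    Measurable fun q : Ω × X => ridgeForm (doubleVec φ w fun i => x i q.1) (Finset.range n) p
      (φ q.2) (noiseSum φ w (fun i => x i q.1) (fun i => ζ i q.1) n) := by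
  have h : ∀ q : Ω × X, ridgeForm (doubleVec φ w fun i => x i q.1) (Finset.range n) p
      (φ q.2) (noiseSum φ w (fun i => x i q.1) (fun i => ζ i q.1) n) =
      ∑ i ∈ Finset.range n, ζ (i + 1) q.1 * (w (i + 1) *
        ridgeForm (doubleVec φ w fun i => x i q.1) (Finset.range n) p (φ q.2)
          (φ (x (i + 1) q.1))) := by
    intro q
    rw [ridgeForm_comm hp, ridgeForm, noiseSum, sum_inner]
    refine Finset.sum_congr rfl fun i _ => ?_
    rw [inner_smul_left, doubleVec, inner_smul_left, ridgeForm_comm hp (φ q.2)]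
    rfl
  simp only [h]
  refine Finset.measurable_sum _ fun i hi => ?_
  have hi' := Finset.mem_range.mp hi
  exact ((hζ i hi').comp measurable_fst).mul ((((measurable_ridgeForm_path hp hφ n hx).comp
    (measurable_fst.prodMk (measurable_snd.prodMk
      ((hx i hi').comp measurable_fst)))).const_mul _))

lemma measurable_gain_step (hp : 0 < p)
    (hφ : Measurable fun q : X × X => inner ℝ (φ q.1) (φ q.2)) (n : ℕ)
    (hx : ∀ i < n + 1, Measurable (x (i + 1))) :
    Measurable fun ω => ridgeForm (doubleVec φ w fun i => x i ω) (Finset.range n) p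
      (doubleVec φ w (fun i => x i ω) n) (doubleVec φ w (fun i => x i ω) n) := by
  have h : ∀ (ω : Ω), doubleVec φ w (fun i => x i ω) n = w (n + 1) • φ (x (n + 1) ω) :=
    fun _ => rfl
  simp only [h, ridgeForm_smul_left, ridgeForm_smul_right hp]
  have hxn := hx n (by omega)
  exact (((measurable_ridgeForm_path hp hφ n fun i hi => hx i (by omega)).comp
    (measurable_id.prodMk (hxn.prodMk hxn))).const_mul _).const_mul _

lemma measurable_noise_step (hp : 0 < p)
    (hφ : Measurable fun q : X × X => inner ℝ (φ q.1) (φ q.2)) (n : ℕ)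
    (hx : ∀ i < n + 1, Measurable (x (i + 1))) (hζ : ∀ i < n, Measurable (ζ (i + 1))) :
    Measurable fun ω => ridgeForm (doubleVec φ w fun i => x i ω) (Finset.range n) p
      (doubleVec φ w (fun i => x i ω) n)
        (noiseSum φ w (fun i => x i ω) (fun i => ζ i ω) n) := by
  have h : ∀ (ω : Ω), doubleVec φ w (fun i => x i ω) n = w (n + 1) • φ (x (n + 1) ω) :=
    fun _ => rfl
  simp only [h, ridgeForm_smul_left]
  have hxn := hx n (by omega)
  exact ((measurable_ridgeForm_noiseSum hp hφ n (fun i hi => hx i (by omega)) hζ).comp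
    (measurable_id.prodMk hxn)).const_mul _

lemma measurable_mixture (hp : 0 < p)
    (hφ : Measurable fun q : X × X => inner ℝ (φ q.1) (φ q.2)) (n : ℕ)
    (hx : ∀ i < n, Measurable (x (i + 1))) (hζ : ∀ i < n, Measurable (ζ (i + 1))) :
    Measurable fun ω => mixture φ w (fun i => x i ω) (fun i => ζ i ω) p n := by
  induction n with
  | zero =>
    simp only [mixture_zero hp]
    exact measurable_const
  | succ n ih =>
    have ih' := ih (fun i hi => hx i (by omega)) (fun i hi => hζ i (by omega))
    have h1 := measurable_gain_step (w := w) hp hφ n hx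
    have h2 := measurable_noise_step (w := w) hp hφ n hx fun i hi => hζ i (by omega)
    have h3 := hζ n (by omega)
    simp only [mixture_succ hp]
    fun_prop

end Measurability

section Supermartingale

variable {Ω : Type*} [m0 : MeasurableSpace Ω] [MeasurableSpace X] {μ : Measure Ω}
  [IsProbabilityMeasure μ] {x : ℕ → Ω → X} {ζ : ℕ → Ω → ℝ} {F : ℕ → MeasurableSpace Ω} {T : ℕ}

/-- The hypotheses on a filtration, an adapted sequence of queries and a conditionally
`1`-sub-Gaussian noise during the rounds `1, …, T`. -/
structure IsNoise (μ : Measure Ω) (F : ℕ → MeasurableSpace Ω) (x : ℕ → Ω → X) (ζ : ℕ → Ω → ℝ)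
    (T : ℕ) : Prop where
  le : ∀ n < T, F (n + 1) ≤ m0
  meas_query : ∀ n < T, ∀ i < n + 1, Measurable[F (n + 1)] (x (i + 1))
  meas_noise : ∀ n < T, ∀ i < n, Measurable[F (n + 1)] (ζ (i + 1))
  meas : ∀ n < T, Measurable (ζ (n + 1))
  sub : ∀ n < T, CondSubGaussian μ (F (n + 1)) (ζ (n + 1)) 1

lemma IsNoise.lintegral_mixture_succ_le (h : IsNoise μ F x ζ T) (hp : 0 < p)
    (hφ : Measurable fun q : X × X => inner ℝ (φ q.1) (φ q.2)) {n : ℕ} (hn : n < T)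
    {Y : Ω → ENNReal} (hY : Measurable[F (n + 1)] Y) :
    ∫⁻ ω, Y ω * ENNReal.ofReal
        (mixture φ w (fun i => x i ω) (fun i => ζ i ω) p (n + 1)) ∂μ ≤
      ∫⁻ ω, Y ω * ENNReal.ofReal (mixture φ w (fun i => x i ω) (fun i => ζ i ω) p n) ∂μ := by
  have hmix : ∀ ω, 0 ≤ mixture φ w (fun i => x i ω) (fun i => ζ i ω) p n :=
    fun _ => (Real.exp_pos _).le
  simp only [mixture_succ hp, ENNReal.ofReal_mul (hmix _), ← mul_assoc]
  have h1 := @measurable_gain_step E X _ _ φ w p Ω (F (n + 1)) _ x hp hφ n (h.meas_query n hn)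
  have h2 := @measurable_noise_step E X _ _ φ w p Ω (F (n + 1)) _ x ζ hp hφ n (h.meas_query n hn)
    (h.meas_noise n hn)
  have h3 := @measurable_mixture E X _ _ φ w p Ω (F (n + 1)) _ x ζ hp hφ n
    (fun i hi => h.meas_query n hn i (by omega)) (h.meas_noise n hn)
  exact lintegral_mul_exp_quadratic_le (h.le n hn) (h.meas n hn) (h.sub n hn) h1 h2
    (fun ω => ridgeForm_self_nonneg hp _) (hY.mul h3.ennreal_ofReal)

lemma IsNoise.lintegral_mixture_le_one (h : IsNoise μ F x ζ T) (hp : 0 < p)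
    (hφ : Measurable fun q : X × X => inner ℝ (φ q.1) (φ q.2)) {n : ℕ} (hn : n ≤ T) :
    ∫⁻ ω, ENNReal.ofReal (mixture φ w (fun i => x i ω) (fun i => ζ i ω) p n) ∂μ ≤ 1 := by
  induction n with
  | zero => simp [mixture_zero hp]
  | succ n ih =>
    have h1 := h.lintegral_mixture_succ_le (w := w) (φ := φ) hp hφ (n := n) (by omega)
      (Y := fun _ => 1) measurable_const
    simp only [one_mul] at h1
    exact h1.trans (ih (by omega))

/-- The maximal inequality for the mixture supermartingale. -/
lemma IsNoise.measure_mixture_le (h : IsNoise μ F x ζ T) (hp : 0 < p)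
    (hφ : Measurable fun q : X × X => inner ℝ (φ q.1) (φ q.2)) {δ : ℝ} (hδ : 0 < δ) {n : ℕ}
    (hn : n ≤ T) :
    μ {ω | ∀ j ≤ n, mixture φ w (fun i => x i ω) (fun i => ζ i ω) p j ≤ 1 / δ}ᶜ ≤
      ENNReal.ofReal δ := by
  set M : ℕ → Ω → ℝ := fun j ω => mixture φ w (fun i => x i ω) (fun i => ζ i ω) p j with hM
  set A : ℕ → Set Ω := fun n => {ω | ∀ j ≤ n, M j ω ≤ 1 / δ} with hA
  have hAeq : ∀ n, A n = ⋂ j ∈ Finset.range (n + 1), {ω | M j ω ≤ 1 / δ} := by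
    intro n
    ext ω
    simp [hA]
  have hAF : ∀ n < T, MeasurableSet[F (n + 1)] (A n) := by
    intro n hn
    rw [hAeq]
    refine Finset.measurableSet_biInter _ fun j hj => ?_
    have hj' := Finset.mem_range.mp hj
    have := @measurable_mixture E X _ _ φ w p Ω (F (n + 1)) _ x ζ hp hφ j
      (fun i hi => h.meas_query n hn i (by omega)) (fun i hi => h.meas_noise n hn i (by omega))
    exact this measurableSet_Iic
  have hMm : ∀ n ≤ T, Measurable (M n) := fun n hn => by
    rcases n with _ | n
    · simp only [hM, mixture_zero hp]
      exact measurable_const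
    · refine measurable_mixture hp hφ (n + 1) (fun i hi => ?_) (fun i hi => ?_)
      · exact (h.meas_query n (by omega) i hi).mono (h.le n (by omega)) le_rfl
      · exact h.meas i (by omega)
  have hAm : ∀ n ≤ T, MeasurableSet (A n) := by
    intro n hn
    rw [hAeq]
    refine Finset.measurableSet_biInter _ fun j hj => ?_
    exact hMm j (by have := Finset.mem_range.mp hj; omega) measurableSet_Iic
  have key : ∀ n ≤ T, ENNReal.ofReal (1 / δ) * μ (A n)ᶜ +
      ∫⁻ ω in A n, ENNReal.ofReal (M n ω) ∂μ ≤ 1 := by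
    intro n hn
    induction n with
    | zero =>
      have h0 : A 0 ⊆ Set.univ := Set.subset_univ _
      by_cases hδ1 : 1 ≤ 1 / δ
      · have : A 0 = Set.univ := by
          ext ω
          simp only [hA, hM, Set.mem_ofPred_eq, Set.mem_univ, iff_true]
          intro j hj
          rw [Nat.le_zero.mp hj, mixture_zero hp]
          exact hδ1
        rw [this]
        simp [hM, mixture_zero hp]
      · have : A 0 = ∅ := by
          ext ω
          simp only [hA, hM, Set.mem_ofPred_eq, Set.mem_empty_iff_false, iff_false]
          intro hc
          have := hc 0 le_rfl
          rw [mixture_zero hp] at this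
          exact hδ1 this
        rw [this]
        push Not at hδ1
        simp only [Set.compl_empty, measure_univ, mul_one, Measure.restrict_empty,
          lintegral_zero_measure, add_zero]
        exact ENNReal.ofReal_le_one.mpr hδ1.le
    | succ n ih =>
      have hsub : A (n + 1) ⊆ A n := fun ω hω j hj => hω j (by omega)
      have hY : Measurable[F (n + 1)] ((A n).indicator (1 : Ω → ENNReal)) := by
        have h1 : Measurable[F (n + 1)] (1 : Ω → ENNReal) := @measurable_one _ _ _ (F (n + 1)) _
        exact h1.indicator (hAF n (by omega))
      have h1 := h.lintegral_mixture_succ_le (w := w) (φ := φ) hp hφ (n := n) (by omega)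
        (Y := (A n).indicator 1) hY
      have h2 : ∀ j, ∫⁻ ω, (A n).indicator 1 ω * ENNReal.ofReal (M j ω) ∂μ =
          ∫⁻ ω in A n, ENNReal.ofReal (M j ω) ∂μ := by
        intro j
        rw [← lintegral_indicator (hAm n (by omega))]
        refine lintegral_congr fun ω => ?_
        by_cases hω : ω ∈ A n <;> simp [hω]
      change ∫⁻ ω, (A n).indicator 1 ω * ENNReal.ofReal (M (n + 1) ω) ∂μ ≤
        ∫⁻ ω, (A n).indicator 1 ω * ENNReal.ofReal (M n ω) ∂μ at h1
      rw [h2, h2] at h1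
      have h3 : ∫⁻ ω in A n, ENNReal.ofReal (M (n + 1) ω) ∂μ =
          ∫⁻ ω in A (n + 1), ENNReal.ofReal (M (n + 1) ω) ∂μ +
            ∫⁻ ω in A n \ A (n + 1), ENNReal.ofReal (M (n + 1) ω) ∂μ := by
        rw [← lintegral_union ((hAm n (by omega)).diff (hAm (n + 1) hn)) Set.disjoint_sdiff_right,
          Set.union_sdiff_cancel hsub]
      have h4 : ENNReal.ofReal (1 / δ) * μ (A n \ A (n + 1)) ≤
          ∫⁻ ω in A n \ A (n + 1), ENNReal.ofReal (M (n + 1) ω) ∂μ := by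
        rw [← setLIntegral_const]
        refine setLIntegral_mono' ((hAm n (by omega)).diff (hAm (n + 1) hn)) fun ω hω => ?_
        refine ENNReal.ofReal_le_ofReal ?_
        by_contra hc
        push Not at hc
        refine hω.2 fun j hj => ?_
        rcases Nat.lt_or_eq_of_le hj with hj | rfl
        · exact hω.1 j (by omega)
        · exact hc.le
      have h5 : μ (A (n + 1))ᶜ ≤ μ (A n)ᶜ + μ (A n \ A (n + 1)) := by
        refine (measure_mono ?_).trans (measure_union_le _ _)
        intro ω hω
        by_cases hωn : ω ∈ A n
        · exact Or.inr ⟨hωn, hω⟩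
        · exact Or.inl hωn
      calc _ ≤ ENNReal.ofReal (1 / δ) * (μ (A n)ᶜ + μ (A n \ A (n + 1))) +
            ∫⁻ ω in A (n + 1), ENNReal.ofReal (M (n + 1) ω) ∂μ := by gcongr
        _ = ENNReal.ofReal (1 / δ) * μ (A n)ᶜ + (ENNReal.ofReal (1 / δ) * μ (A n \ A (n + 1)) +
            ∫⁻ ω in A (n + 1), ENNReal.ofReal (M (n + 1) ω) ∂μ) := by rw [mul_add, add_assoc]
        _ ≤ ENNReal.ofReal (1 / δ) * μ (A n)ᶜ + ∫⁻ ω in A n, ENNReal.ofReal (M (n + 1) ω) ∂μ := by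
            rw [h3, add_comm (∫⁻ ω in A (n + 1), _ ∂μ)]
            gcongr
        _ ≤ ENNReal.ofReal (1 / δ) * μ (A n)ᶜ + ∫⁻ ω in A n, ENNReal.ofReal (M n ω) ∂μ := by
            gcongr
        _ ≤ 1 := ih (by omega)
  have h1 : ENNReal.ofReal (1 / δ) * μ (A n)ᶜ ≤ 1 := le_trans le_self_add (key n hn)
  have hδ0 : ENNReal.ofReal δ * ENNReal.ofReal (1 / δ) = 1 := by
    rw [← ENNReal.ofReal_mul hδ.le, mul_one_div_cancel hδ.ne', ENNReal.ofReal_one]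
  calc μ (A n)ᶜ = ENNReal.ofReal δ * (ENNReal.ofReal (1 / δ) * μ (A n)ᶜ) := by
        rw [← mul_assoc, hδ0, one_mul]
    _ ≤ ENNReal.ofReal δ * 1 := by gcongr
    _ = _ := mul_one _

/-- Markov's inequality for a weighted average of mixtures with different regularizers. -/
lemma IsNoise.measure_sum_mixture_le (h : IsNoise μ F x ζ T) {reg : ℕ → ℝ} (hp : ∀ n, 0 < reg n)
    (hφ : Measurable fun q : X × X => inner ℝ (φ q.1) (φ q.2)) {δ : ℝ} (hδ : 0 < δ)
    {c : ℕ → ℝ} (hc : ∀ n, 0 ≤ c n) (hsum : 0 < ∑ n ∈ Finset.range T, c n) :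
    μ {ω | ∑ n ∈ Finset.range T, c n *
        mixture φ w (fun i => x i ω) (fun i => ζ i ω) (reg n) n ≤
          (1 / δ) * ∑ n ∈ Finset.range T, c n}ᶜ ≤ ENNReal.ofReal δ := by
  set P := ∑ n ∈ Finset.range T, c n with hP
  set S : Ω → ℝ := fun ω => ∑ n ∈ Finset.range T, c n *
        mixture φ w (fun i => x i ω) (fun i => ζ i ω) (reg n) n with hS
  have hmix : ∀ n ω, 0 ≤ mixture φ w (fun i => x i ω) (fun i => ζ i ω) (reg n) n :=
    fun _ _ => (Real.exp_pos _).le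
  have hMm : ∀ n ≤ T, Measurable fun ω =>
      mixture φ w (fun i => x i ω) (fun i => ζ i ω) (reg n) n := fun n hn => by
    rcases n with _ | n
    · simp only [mixture_zero (hp 0)]
      exact measurable_const
    · refine measurable_mixture (hp _) hφ (n + 1) (fun i hi => ?_) (fun i hi => ?_)
      · exact (h.meas_query n (by omega) i hi).mono (h.le n (by omega)) le_rfl
      · exact h.meas i (by omega)
  have hSm : Measurable S := Finset.measurable_sum _ fun n hn =>
    (hMm n (Finset.mem_range.mp hn).le).const_mul _
  have hint : ∫⁻ ω, ENNReal.ofReal (S ω) ∂μ ≤ ENNReal.ofReal P := by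
    have h1 : ∀ ω, ENNReal.ofReal (S ω) = ∑ n ∈ Finset.range T, ENNReal.ofReal (c n) *
        ENNReal.ofReal (mixture φ w (fun i => x i ω) (fun i => ζ i ω) (reg n) n) := by
      intro ω
      rw [hS, ENNReal.ofReal_sum_of_nonneg fun n _ => mul_nonneg (hc n) (hmix n ω)]
      exact Finset.sum_congr rfl fun n _ => ENNReal.ofReal_mul (hc n)
    simp only [h1]
    rw [lintegral_finsetSum _ fun n hn =>
      ((hMm n (Finset.mem_range.mp hn).le).ennreal_ofReal).const_mul _, hP,
      ENNReal.ofReal_sum_of_nonneg fun n _ => hc n]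
    refine Finset.sum_le_sum fun n hn => ?_
    have hn' := (Finset.mem_range.mp hn).le
    rw [lintegral_const_mul _ (hMm n hn').ennreal_ofReal]
    exact mul_le_of_le_one_right' (h.lintegral_mixture_le_one (hp n) hφ hn')
  have hPδ : 0 < (1 / δ) * P := by positivity
  have h2 := mul_meas_ge_le_lintegral (μ := μ) hSm.ennreal_ofReal (ENNReal.ofReal ((1 / δ) * P))
  have h3 : {ω | S ω ≤ (1 / δ) * P}ᶜ ⊆
      {ω | ENNReal.ofReal ((1 / δ) * P) ≤ ENNReal.ofReal (S ω)} := by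
    intro ω hω
    simp only [Set.mem_compl_iff, Set.mem_ofPred_eq, not_le] at hω
    exact ENNReal.ofReal_le_ofReal hω.le
  have h4 : ENNReal.ofReal ((1 / δ) * P) * μ {ω | S ω ≤ (1 / δ) * P}ᶜ ≤ ENNReal.ofReal P :=
    (mul_le_mul' le_rfl (measure_mono h3)).trans (h2.trans hint)
  have h5 : ENNReal.ofReal P = ENNReal.ofReal ((1 / δ) * P) * ENNReal.ofReal δ := by
    rw [← ENNReal.ofReal_mul hPδ.le]
    congr 1
    field_simp
  rw [h5] at h4
  exact (ENNReal.mul_le_mul_iff_right (ENNReal.ofReal_pos.mpr hPδ).ne' ENNReal.ofReal_ne_top).mp h4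

end Supermartingale

end NoiseProcess

end WGPUCB

namespace WGPUCB

section RecentDrift

variable {E : Type*} [NormedAddCommGroup E]

/-- The variation of the rewards over the `c` rounds preceding round `n + 1`. -/
def recentDrift (f : ℕ → E) (c n : ℕ) : ℝ :=
  ∑ p ∈ Finset.Ico (max 1 (n + 1 - c)) (n + 1), ‖f (p + 1) - f p‖

lemma recentDrift_nonneg (f : ℕ → E) (c n : ℕ) : 0 ≤ recentDrift f c n :=
  Finset.sum_nonneg fun _ _ => norm_nonneg _

lemma sum_recentDrift_le (f : ℕ → E) (c T : ℕ) :
    ∑ n ∈ Finset.range T, recentDrift f c n ≤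
      c * ∑ p ∈ Finset.Ico 1 T, ‖f (p + 1) - f p‖ := by
  have h1 : ∀ n ∈ Finset.range T, recentDrift f c n =
      ∑ p ∈ Finset.Ico 1 T, if p ≤ n ∧ n < p + c then ‖f (p + 1) - f p‖ else 0 := by
    intro n hn
    have hn' := Finset.mem_range.mp hn
    rw [← Finset.sum_filter, recentDrift]
    refine Finset.sum_congr ?_ fun _ _ => rfl
    ext p
    simp only [Finset.mem_Ico, Finset.mem_filter]
    omega
  rw [Finset.sum_congr rfl h1, Finset.sum_comm, Finset.mul_sum]
  refine Finset.sum_le_sum fun p _ => ?_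
  rw [← Finset.sum_filter, Finset.sum_const, nsmul_eq_mul]
  refine mul_le_mul_of_nonneg_right ?_ (norm_nonneg _)
  have h2 : {n ∈ Finset.range T | p ≤ n ∧ n < p + c} ⊆ Finset.Ico p (p + c) := by
    intro n hn
    simp only [Finset.mem_filter] at hn
    exact Finset.mem_Ico.mpr hn.2
  have h3 := Finset.card_le_card h2
  rw [Nat.card_Ico, Nat.add_sub_cancel_left] at h3
  exact_mod_cast h3

lemma norm_sub_le_recentDrift (f : ℕ → E) {c n i : ℕ} (hi : i < n) (hc : n < i + 1 + c) :
    ‖f (i + 1) - f (n + 1)‖ ≤ recentDrift f c n := by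
  have h1 := dist_le_Ico_sum_dist f (show i + 1 ≤ n + 1 by omega)
  rw [dist_eq_norm] at h1
  refine h1.trans ?_
  have h2 : ∑ p ∈ Finset.Ico (i + 1) (n + 1), dist (f p) (f (p + 1)) =
      ∑ p ∈ Finset.Ico (i + 1) (n + 1), ‖f (p + 1) - f p‖ :=
    Finset.sum_congr rfl fun p _ => by rw [dist_comm, dist_eq_norm]
  rw [h2]
  refine Finset.sum_le_sum_of_subset_of_nonneg ?_ fun _ _ _ => norm_nonneg _
  exact Finset.Ico_subset_Ico (by omega) le_rfl

end RecentDrift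

section Confidence

variable {E X : Type*} [NormedAddCommGroup E] [InnerProductSpace ℝ E]
  {k : X → X → ℝ} {φ : X → E} {η lam : ℝ}

lemma reg_pos (hη : 0 < η) (hlam : 0 < lam) (n : ℕ) : 0 < reg (expWeight η) lam n :=
  mul_pos hlam (expWeight_pos hη n)

lemma doubleReg_pos (hη : 0 < η) (hlam : 0 < lam) (n : ℕ) : 0 < doubleReg (expWeight η) lam n :=
  mul_pos hlam (pow_pos (expWeight_pos hη n) 2)

lemma inner_weightedVec_sq (hη : 0 < η) (x : ℕ → X) (i : ℕ) (u : E) :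
    inner ℝ (weightedVec φ (expWeight η) x i) u ^ 2 =
      expWeight η (i + 1) * inner ℝ (φ (x (i + 1))) u ^ 2 := by
  rw [weightedVec, inner_smul_left, mul_pow]
  simp only [conj_trivial]
  rw [Real.sq_sqrt (expWeight_pos hη _).le]

lemma inner_doubleVec_sq (w : ℕ → ℝ) (x : ℕ → X) (i : ℕ) (u : E) :
    inner ℝ (doubleVec φ w x i) u ^ 2 = w (i + 1) ^ 2 * inner ℝ (φ (x (i + 1))) u ^ 2 := by
  rw [doubleVec, inner_smul_left, mul_pow]
  simp only [conj_trivial]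

lemma inner_ridge_doubleVec_le (hη : 0 < η) (hη' : η < 1) (x : ℕ → X) (n : ℕ)
    (u : E) :
    inner ℝ u (ridge (doubleVec φ (expWeight η) x) (Finset.range n)
        (doubleReg (expWeight η) lam n) u) ≤
      expWeight η n * inner ℝ u (ridge (weightedVec φ (expWeight η) x) (Finset.range n)
        (reg (expWeight η) lam n) u) := by
  rw [inner_ridge_self, inner_ridge_self, mul_add, Finset.mul_sum, doubleReg, reg]
  refine add_le_add (le_of_eq (by ring)) (Finset.sum_le_sum fun i hi => ?_)
  rw [inner_weightedVec_sq hη, inner_doubleVec_sq, ← mul_assoc, sq (expWeight η (i + 1))]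
  have h1 := expWeight_mono hη hη' (Finset.mem_range.mp hi : i + 1 ≤ n)
  have h2 := expWeight_pos hη (i + 1)
  gcongr

lemma ridgeForm_weightedVec_le (hη : 0 < η) (hη' : η < 1) (hlam : 0 < lam) (x : ℕ → X) (n : ℕ)
    (z : E) :
    reg (expWeight η) lam n * ridgeForm (weightedVec φ (expWeight η) x) (Finset.range n)
        (reg (expWeight η) lam n) z z ≤
      doubleReg (expWeight η) lam n * ridgeForm (doubleVec φ (expWeight η) x) (Finset.range n)
        (doubleReg (expWeight η) lam n) z z := by
  have hw := expWeight_pos hη n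
  have h := ridgeForm_le_of_le (ψ := weightedVec φ (expWeight η) x) (s := Finset.range n)
    (ψ' := doubleVec φ (expWeight η) x) (s' := Finset.range n) (c := (expWeight η n)⁻¹)
    (inv_pos.mpr hw) (reg_pos hη hlam n) (doubleReg_pos hη hlam n) (fun u => by
      rw [inv_mul_le_iff₀ hw]
      exact inner_ridge_doubleVec_le hη hη' x n u) z
  rw [inv_inv] at h
  calc _ ≤ reg (expWeight η) lam n * (expWeight η n * _) :=
        mul_le_mul_of_nonneg_left h (reg_pos hη hlam n).le
    _ = _ := by
        rw [reg, doubleReg]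
        ring

/-- The bias of the posterior mean at time `n` caused by the variation of the rewards. -/
def driftBias (φ : X → E) (η lam : ℝ) (x : ℕ → X) (f : ℕ → E) (n : ℕ) (z : X) : ℝ :=
  ∑ i ∈ Finset.range n, expWeight η (i + 1) * inner ℝ (φ (x (i + 1)))
    (ridgeInv (weightedVec φ (expWeight η) x) (Finset.range n) (reg (expWeight η) lam n) (φ z)) *
      inner ℝ (f (i + 1) - f (n + 1)) (φ (x (i + 1)))

lemma abs_postMean_sub_le (hη : 0 < η) (hη' : η < 1) (hlam : 0 < lam)
    (hk : ∀ z z', k z z' = inner ℝ (φ z) (φ z')) {x : ℕ → X} {y ζ : ℕ → ℝ} {f : ℕ → E} {R B : ℝ}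
    (hR : 0 ≤ R) {n : ℕ}
    (hy : ∀ i < n, y (i + 1) = inner ℝ (f (i + 1)) (φ (x (i + 1))) + R * ζ (i + 1))
    (hB : ‖f (n + 1)‖ ≤ B) (z : X) :
    |postMean k (expWeight η) lam x y n z - inner ℝ (f (n + 1)) (φ z)| ≤
      |driftBias φ η lam x f n z| + (B + (1 / √lam) * R *
        √(noiseForm φ (expWeight η) x ζ (doubleReg (expWeight η) lam n) n)) *
          postStd k (expWeight η) lam x n z := by
  have hp := reg_pos hη hlam n
  have hpD := doubleReg_pos hη hlam n
  have hw := expWeight_pos hη n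
  set u := ridgeInv (weightedVec φ (expWeight η) x) (Finset.range n) (reg (expWeight η) lam n) (φ z)
    with hu
  set Q := ridgeForm (weightedVec φ (expWeight η) x) (Finset.range n) (reg (expWeight η) lam n)
    (φ z) (φ z) with hQ
  have hQ0 : 0 ≤ Q := ridgeForm_self_nonneg hp _
  have hQu : Q = inner ℝ u (ridge (weightedVec φ (expWeight η) x) (Finset.range n)
      (reg (expWeight η) lam n) u) := by
    rw [hu, ridge_ridgeInv hp, real_inner_comm]
    rfl
  have hstd : postStd k (expWeight η) lam x n z = √(reg (expWeight η) lam n * Q) := by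
    rw [postStd, postVar_eq hk x n hp]
  set σ := postStd k (expWeight η) lam x n z with hσ
  have hσ0 : 0 ≤ σ := Real.sqrt_nonneg _
  have hσsq : σ ^ 2 = reg (expWeight η) lam n * Q := by
    rw [hstd, Real.sq_sqrt (by positivity)]
  have hwsq : ∀ i, √(expWeight η (i + 1)) * √(expWeight η (i + 1)) = expWeight η (i + 1) :=
    fun i => Real.mul_self_sqrt (expWeight_pos hη _).le
  -- decomposition of the error
  have hdecomp : postMean k (expWeight η) lam x y n z - inner ℝ (f (n + 1)) (φ z) =
      driftBias φ η lam x f n z + R * inner ℝ (noiseSum φ (expWeight η) x ζ n) u -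
        reg (expWeight η) lam n * inner ℝ (f (n + 1)) u := by
    have h1 : inner ℝ (f (n + 1)) (φ z) = reg (expWeight η) lam n * inner ℝ (f (n + 1)) u +
        ∑ i ∈ Finset.range n, expWeight η (i + 1) * inner ℝ (φ (x (i + 1))) u *
          inner ℝ (f (n + 1)) (φ (x (i + 1))) := by
      conv_lhs => rw [← ridge_ridgeInv (ψ := weightedVec φ (expWeight η) x)
        (s := Finset.range n) hp (φ z), ← hu]
      rw [inner_ridge]
      congr 1
      refine Finset.sum_congr rfl fun i _ => ?_
      rw [weightedVec, inner_smul_left, inner_smul_left, real_inner_comm (f (n + 1))]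
      simp only [conj_trivial]
      linear_combination (inner ℝ (f (n + 1)) (φ (x (i + 1))) * inner ℝ (φ (x (i + 1))) u) * hwsq i
    have h2 : R * inner ℝ (noiseSum φ (expWeight η) x ζ n) u = ∑ i ∈ Finset.range n,
        expWeight η (i + 1) * inner ℝ (φ (x (i + 1))) u * (R * ζ (i + 1)) := by
      rw [noiseSum, sum_inner, Finset.mul_sum]
      refine Finset.sum_congr rfl fun i _ => ?_
      rw [inner_smul_left, doubleVec, inner_smul_left]
      simp only [conj_trivial]
      ring
    rw [postMean_eq hk x y n (expWeight_pos hη) hp, h1, h2, driftBias, ← hu]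
    rw [add_sub_right_comm, sub_add_eq_sub_sub, sub_right_comm, ← Finset.sum_sub_distrib,
      sub_left_inj.mpr rfl, add_comm, add_comm_sub]
    rw [show ∀ a b c d : ℝ, a - b = c + (d - b) ↔ a = c + d from fun a b c d => by
      constructor <;> intro h <;> linarith, ← Finset.sum_add_distrib]
    refine Finset.sum_congr rfl fun i hi => ?_
    rw [hy i (Finset.mem_range.mp hi), inner_sub_left]
    ring
  have hnoise : |inner ℝ (noiseSum φ (expWeight η) x ζ n) u| ≤
      1 / √lam * √(noiseForm φ (expWeight η) x ζ (doubleReg (expWeight η) lam n) n) * σ := by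
    have h1 := inner_sq_le_ridgeForm_mul (ψ := doubleVec φ (expWeight η) x) (s := Finset.range n)
      hpD (noiseSum φ (expWeight η) x ζ n) u
    have h2 := inner_ridge_doubleVec_le (φ := φ) (lam := lam) hη hη' x n u
    rw [← hQu] at h2
    have h3 : 0 ≤ noiseForm φ (expWeight η) x ζ (doubleReg (expWeight η) lam n) n :=
      ridgeForm_self_nonneg hpD _
    apply abs_le_of_sq_le_sq _ (by positivity)
    rw [mul_pow, mul_pow, Real.sq_sqrt h3, hσsq, div_pow, one_pow, Real.sq_sqrt hlam.le, reg]
    calc _ ≤ _ := h1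
      _ ≤ noiseForm φ (expWeight η) x ζ (doubleReg (expWeight η) lam n) n *
          (expWeight η n * Q) := mul_le_mul_of_nonneg_left h2 h3
      _ = _ := by
        field_simp
  have hreg : |reg (expWeight η) lam n * inner ℝ (f (n + 1)) u| ≤ B * σ := by
    have h1 := norm_ridgeInv_sq_le (ψ := weightedVec φ (expWeight η) x) (s := Finset.range n)
      hp (φ z)
    rw [← hu, ← hQ] at h1
    have h2 : reg (expWeight η) lam n * ‖u‖ ≤ σ := by
      apply le_of_sq_le_sq _ hσ0
      rw [hσsq, mul_pow, sq (reg (expWeight η) lam n), mul_assoc]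
      exact mul_le_mul_of_nonneg_left h1 hp.le
    rw [abs_mul, abs_of_pos hp]
    calc _ ≤ reg (expWeight η) lam n * (‖f (n + 1)‖ * ‖u‖) :=
          mul_le_mul_of_nonneg_left (abs_real_inner_le_norm _ _) hp.le
      _ = ‖f (n + 1)‖ * (reg (expWeight η) lam n * ‖u‖) := by ring
      _ ≤ B * σ := mul_le_mul hB h2 (by positivity) ((norm_nonneg _).trans hB)
  rw [hdecomp]
  have h4 : |R * inner ℝ (noiseSum φ (expWeight η) x ζ n) u| ≤
      R * (1 / √lam * √(noiseForm φ (expWeight η) x ζ (doubleReg (expWeight η) lam n) n) * σ) := by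
    rw [abs_mul, abs_of_nonneg hR]
    exact mul_le_mul_of_nonneg_left hnoise hR
  refine (abs_sub _ _).trans ((add_le_add (abs_add_le _ _) le_rfl).trans ?_)
  linarith

lemma sum_old_expWeight_le (hη : 0 < η) (hη' : η < 1) (c n : ℕ) :
    ∑ i ∈ Finset.range n with i + 1 + c ≤ n, expWeight η (i + 1) ≤
      η ^ c / (1 - η) * expWeight η n := by
  have hη1 : 0 < 1 - η := by linarith
  by_cases hcn : c ≤ n
  · have h1 : {i ∈ Finset.range n | i + 1 + c ≤ n} = Finset.range (n - c) := by
      ext i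
      simp only [Finset.mem_filter, Finset.mem_range]
      omega
    rw [h1]
    refine (sum_expWeight_le hη hη' (n - c)).trans (le_of_eq ?_)
    rw [expWeight_eq_mul_pow hη (Nat.sub_le n c), Nat.sub_sub_self hcn]
    ring
  · have h1 : {i ∈ Finset.range n | i + 1 + c ≤ n} = ∅ := by
      ext i
      simp only [Finset.mem_filter, Finset.mem_range, Finset.notMem_empty, iff_false]
      omega
    rw [h1, Finset.sum_empty]
    have := expWeight_pos hη n
    positivity

lemma abs_driftBias_le (hη : 0 < η) (hη' : η < 1) (hlam : 0 < lam)
    (hφ : ∀ z, ‖φ z‖ ≤ 1) (x : ℕ → X) {f : ℕ → E} {B : ℝ} (c : ℕ) {n : ℕ}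
    (hB : ∀ i ≤ n, ‖f (i + 1)‖ ≤ B) (z : X) :
    |driftBias φ η lam x f n z| ≤ 2 * B / lam * (η ^ c / (1 - η)) +
      recentDrift f c n * √(c * effDim (weightedVec φ (expWeight η) x) (Finset.range n)
        (reg (expWeight η) lam n) / lam) := by
  have hp := reg_pos hη hlam n
  have hw := expWeight_pos hη n
  have hB0 : 0 ≤ B := (norm_nonneg _).trans (hB n le_rfl)
  set ψ := weightedVec φ (expWeight η) x with hψ
  set p := reg (expWeight η) lam n with hp_def
  set u := ridgeInv ψ (Finset.range n) p (φ z) with hu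
  have hnu : ‖u‖ ≤ 1 / p := by
    have h1 := norm_ridgeInv_sq_le (ψ := ψ) (s := Finset.range n) hp (φ z)
    have h2 := reg_mul_ridgeForm_le (ψ := ψ) (s := Finset.range n) hp (φ z)
    have h3 : ‖φ z‖ ^ 2 ≤ 1 := pow_le_one₀ (norm_nonneg _) (hφ z)
    rw [le_div_iff₀ hp]
    apply le_of_sq_le_sq _ zero_le_one
    rw [mul_pow]
    nlinarith [mul_le_mul_of_nonneg_left h1 hp.le]
  have hQ : p * ridgeForm ψ (Finset.range n) p (φ z) (φ z) ≤ 1 :=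
    (reg_mul_ridgeForm_le hp (φ z)).trans (pow_le_one₀ (norm_nonneg _) (hφ z))
  have hinner : ∀ (v : E) (z' : X), |inner ℝ v (φ z')| ≤ ‖v‖ := fun v z' =>
    (abs_real_inner_le_norm _ _).trans (mul_le_of_le_one_right (norm_nonneg _) (hφ z'))
  have hterm : ∀ i, |expWeight η (i + 1) * inner ℝ (φ (x (i + 1))) u *
      inner ℝ (f (i + 1) - f (n + 1)) (φ (x (i + 1)))| ≤
      expWeight η (i + 1) * |inner ℝ (φ (x (i + 1))) u| * ‖f (i + 1) - f (n + 1)‖ := by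
    intro i
    rw [abs_mul, abs_mul, abs_of_pos (expWeight_pos hη _)]
    exact mul_le_mul_of_nonneg_left (hinner _ _)
      (mul_nonneg (expWeight_pos hη _).le (abs_nonneg _))
  refine (Finset.abs_sum_le_sum_abs _ _).trans ?_
  refine (Finset.sum_le_sum fun i _ => hterm i).trans ?_
  rw [← Finset.sum_filter_add_sum_filter_not _ (fun i => i + 1 + c ≤ n)]
  refine add_le_add ?_ ?_
  · have h1 : ∀ i ∈ ({i ∈ Finset.range n | i + 1 + c ≤ n} : Finset ℕ),
        expWeight η (i + 1) * |inner ℝ (φ (x (i + 1))) u| * ‖f (i + 1) - f (n + 1)‖ ≤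
          expWeight η (i + 1) * (1 / p * (2 * B)) := by
      intro i hi
      have hi' := Finset.mem_range.mp (Finset.mem_filter.mp hi).1
      rw [mul_assoc]
      refine mul_le_mul_of_nonneg_left ?_ (expWeight_pos hη _).le
      refine mul_le_mul ?_ ?_ (norm_nonneg _) (by positivity)
      · rw [real_inner_comm]
        exact (hinner u _).trans hnu
      · refine (norm_sub_le _ _).trans ?_
        linarith [hB i hi'.le, hB n le_rfl]
    refine (Finset.sum_le_sum h1).trans ?_
    rw [← Finset.sum_mul]
    refine (mul_le_mul_of_nonneg_right (sum_old_expWeight_le hη hη' c n) (by positivity)).trans ?_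
    refine le_of_eq ?_
    rw [hp_def, reg]
    field_simp
  · have h1 : ∀ i ∈ ({i ∈ Finset.range n | ¬ i + 1 + c ≤ n} : Finset ℕ),
        expWeight η (i + 1) * |inner ℝ (φ (x (i + 1))) u| * ‖f (i + 1) - f (n + 1)‖ ≤
          recentDrift f c n * (√(1 / lam) *
            √(ridgeForm ψ (Finset.range n) p (ψ i) (ψ i))) := by
      intro i hi
      obtain ⟨hi1, hi2⟩ := Finset.mem_filter.mp hi
      have hi' := Finset.mem_range.mp hi1
      rw [mul_comm]
      refine mul_le_mul (norm_sub_le_recentDrift f hi' (by omega)) ?_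
        (mul_nonneg (expWeight_pos hη _).le (abs_nonneg _)) (recentDrift_nonneg _ _ _)
      rw [← Real.sqrt_mul (by positivity)]
      apply Real.le_sqrt_of_sq_le
      rw [mul_pow, sq_abs]
      have h2 := ridgeForm_sq_le (ψ := ψ) (s := Finset.range n) hp (ψ i) (φ z)
      have h3 : ridgeForm ψ (Finset.range n) p (ψ i) (φ z) ^ 2 =
          expWeight η (i + 1) * inner ℝ (φ (x (i + 1))) u ^ 2 := inner_weightedVec_sq hη x i u
      have h4 := expWeight_mono hη hη' (Nat.succ_le_of_lt hi')
      have h5 := ridgeForm_self_nonneg (ψ := ψ) (s := Finset.range n) hp (ψ i)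
      have h6 := ridgeForm_self_nonneg (ψ := ψ) (s := Finset.range n) hp (φ z)
      rw [h3] at h2
      calc _ = expWeight η (i + 1) * (expWeight η (i + 1) * inner ℝ (φ (x (i + 1))) u ^ 2) := by
            ring
        _ ≤ expWeight η n * (ridgeForm ψ (Finset.range n) p (ψ i) (ψ i) *
            ridgeForm ψ (Finset.range n) p (φ z) (φ z)) :=
            mul_le_mul h4 h2 (mul_nonneg (expWeight_pos hη _).le (sq_nonneg _)) hw.le
        _ = (1 / lam) * ridgeForm ψ (Finset.range n) p (ψ i) (ψ i) *
            (p * ridgeForm ψ (Finset.range n) p (φ z) (φ z)) := by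
            rw [hp_def, reg]
            field_simp
        _ ≤ _ := mul_le_of_le_one_right (by positivity) hQ
    refine (Finset.sum_le_sum h1).trans ?_
    rw [← Finset.mul_sum, ← Finset.mul_sum]
    refine mul_le_mul_of_nonneg_left ?_ (recentDrift_nonneg _ _ _)
    have hlev : ∀ i, 0 ≤ ridgeForm ψ (Finset.range n) p (ψ i) (ψ i) :=
      fun i => ridgeForm_self_nonneg hp _
    have h2 : ∑ i ∈ Finset.range n with ¬ i + 1 + c ≤ n,
        √(ridgeForm ψ (Finset.range n) p (ψ i) (ψ i)) ≤
        √(c * effDim ψ (Finset.range n) p) := by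
      apply Real.le_sqrt_of_sq_le
      refine (sq_sum_le_card_mul_sum_sq).trans ?_
      have h3 : (({i ∈ Finset.range n | ¬ i + 1 + c ≤ n} : Finset ℕ).card : ℝ) ≤ c := by
        have h4 : {i ∈ Finset.range n | ¬ i + 1 + c ≤ n} ⊆ Finset.Ico (n - c) n := by
          intro i hi
          simp only [Finset.mem_filter, Finset.mem_range] at hi
          exact Finset.mem_Ico.mpr (by omega)
        have h5 := Finset.card_le_card h4
        rw [Nat.card_Ico] at h5
        exact_mod_cast h5.trans (by omega)
      refine mul_le_mul h3 ?_ (Finset.sum_nonneg fun _ _ => sq_nonneg _) (Nat.cast_nonneg _)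
      simp only [Real.sq_sqrt (hlev _)]
      exact Finset.sum_le_sum_of_subset_of_nonneg (Finset.filter_subset _ _) fun i _ _ => hlev i
    refine (mul_le_mul_of_nonneg_left h2 (Real.sqrt_nonneg _)).trans (le_of_eq ?_)
    rw [← Real.sqrt_mul (by positivity)]
    congr 1
    ring

end Confidence

end WGPUCB

namespace WGPUCB

section HalfWeight

variable {η : ℝ}

lemma one_le_mul_exp (hη2 : 1 / 2 ≤ η) (hη' : η < 1) : 1 ≤ η * Real.exp (2 * (1 - η)) := by
  have h := Real.add_one_le_exp (2 * (1 - η))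
  have h2 : η * (2 * (1 - η) + 1) ≤ η * Real.exp (2 * (1 - η)) := by gcongr
  nlinarith

lemma expWeight_le_exp (hη2 : 1 / 2 ≤ η) (hη' : η < 1) (n : ℕ) :
    expWeight η n ≤ Real.exp (2 * (n * (1 - η))) := by
  have hη : 0 < η := by linarith
  rw [expWeight, inv_le_iff_one_le_mul₀ (pow_pos hη n)]
  have h : Real.exp (2 * (n * (1 - η))) = Real.exp (2 * (1 - η)) ^ n := by
    rw [← Real.exp_nat_mul]
    ring_nf
  rw [h, mul_comm, ← mul_pow]
  exact one_le_pow₀ (one_le_mul_exp hη2 hη')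

lemma exp_neg_mul_expWeight_sq_le (hη2 : 1 / 2 ≤ η) (hη' : η < 1) {M n i : ℕ}
    (hM : M * (1 - η) ≤ 1) (hi : n ≤ i + M) (hin : i + 1 ≤ n) :
    Real.exp (-4) * expWeight η n ^ 2 ≤ expWeight η (i + 1) ^ 2 := by
  have hη : 0 < η := by linarith
  have h1 : expWeight η n = expWeight η (i + 1) * expWeight η (n - (i + 1)) := by
    rw [← expWeight_add, Nat.add_sub_cancel' hin]
  have h2 : expWeight η (n - (i + 1)) ≤ Real.exp 2 := by
    refine (expWeight_le_exp hη2 hη' _).trans (Real.exp_le_exp.mpr ?_)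
    have h3 : ((n - (i + 1) : ℕ) : ℝ) ≤ M := by exact_mod_cast (by omega : n - (i + 1) ≤ M)
    nlinarith
  have h4 : expWeight η (n - (i + 1)) ^ 2 ≤ Real.exp 4 := by
    refine (pow_le_pow_left₀ (expWeight_pos hη _).le h2 2).trans (le_of_eq ?_)
    rw [← Real.exp_nat_mul]
    norm_num
  rw [h1, mul_pow, Real.exp_neg, inv_mul_le_iff₀ (Real.exp_pos _), mul_comm]
  exact mul_le_mul_of_nonneg_right h4 (sq_nonneg _)

lemma card_mul_le_sum_expWeight_sq (hη2 : 1 / 2 ≤ η) (hη' : η < 1) {M n : ℕ}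
    (hM : M * (1 - η) ≤ 1) {J : Finset ℕ} (hJ : J ⊆ Finset.Ico (n - M) n) :
    J.card * (Real.exp (-4) * expWeight η n ^ 2) ≤ ∑ i ∈ J, expWeight η (i + 1) ^ 2 := by
  rw [← nsmul_eq_mul]
  refine Finset.card_nsmul_le_sum _ _ _ fun i hi => ?_
  have := Finset.mem_Ico.mp (hJ hi)
  exact exp_neg_mul_expWeight_sq_le hη2 hη' hM (by omega) (by omega)

end HalfWeight

section Gain

variable {E X : Type*} [NormedAddCommGroup E] [InnerProductSpace ℝ E]
  {k : X → X → ℝ} {φ : X → E} {η lam : ℝ}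

lemma postVar_nonneg (hk : ∀ z z', k z z' = inner ℝ (φ z) (φ z')) (hη : 0 < η) (hlam : 0 < lam)
    (x : ℕ → X) (n : ℕ) (z : X) : 0 ≤ postVar k (expWeight η) lam x n z := by
  rw [postVar_eq hk x n (reg_pos hη hlam n)]
  exact mul_nonneg (reg_pos hη hlam n).le (ridgeForm_self_nonneg (reg_pos hη hlam n) _)

lemma postVar_le_kernel (hk : ∀ z z', k z z' = inner ℝ (φ z) (φ z')) (hη : 0 < η) (hlam : 0 < lam)
    (x : ℕ → X) (n : ℕ) (z : X) : postVar k (expWeight η) lam x n z ≤ k z z := by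
  rw [postVar_eq hk x n (reg_pos hη hlam n), hk, real_inner_self_eq_norm_sq]
  exact reg_mul_ridgeForm_le (reg_pos hη hlam n) _

lemma postVar_le_double (hk : ∀ z z', k z z' = inner ℝ (φ z) (φ z')) (hη : 0 < η) (hη' : η < 1)
    (hlam : 0 < lam) (x : ℕ → X) (n : ℕ) (z : X) :
    postVar k (expWeight η) lam x n z ≤ doubleReg (expWeight η) lam n *
      ridgeForm (doubleVec φ (expWeight η) x) (Finset.range n)
        (doubleReg (expWeight η) lam n) (φ z) (φ z) := by
  rw [postVar_eq hk x n (reg_pos hη hlam n)]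
  exact ridgeForm_weightedVec_le hη hη' hlam x n (φ z)

/-- The maximum information gain is at least the one obtained from the queries of a path after
moving `b` of the last `M` queries, chosen to have small leverage, to a common point `z`. -/
lemma logDet_add_log_le_doubleGain (hk : ∀ z z', k z z' = inner ℝ (φ z) (φ z'))
    (hk1 : ∀ z, k z z ≤ 1) (hη2 : 1 / 2 ≤ η) (hη' : η < 1) (hlam : 0 < lam) (x : ℕ → X)
    {n M b : ℕ} (hM0 : 0 < M) (hMn : M ≤ n) (hbM : b ≤ M) (hM : M * (1 - η) ≤ 1)
    (hb : b * effDim (doubleVec φ (expWeight η) x) (Finset.range n)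
      (doubleReg (expWeight η) lam n) ≤ M / 2) (z : X) :
    logDet (doubleVec φ (expWeight η) x) (Finset.range n) (doubleReg (expWeight η) lam n) -
        2 * (b * effDim (doubleVec φ (expWeight η) x) (Finset.range n)
          (doubleReg (expWeight η) lam n) / M) +
        Real.log (1 + b * Real.exp (-4) / lam * postVar k (expWeight η) lam x n z) ≤
      2 * doubleGain k (expWeight η) lam n := by
  classical
  have hη : 0 < η := by linarith
  have hp := doubleReg_pos hη hlam n
  have hw := expWeight_pos hη n
  set ψ := doubleVec φ (expWeight η) x with hψ
  set p := doubleReg (expWeight η) lam n with hp_def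
  have hlev : ∀ i, 0 ≤ ridgeForm ψ (Finset.range n) p (ψ i) (ψ i) :=
    fun i => ridgeForm_self_nonneg hp _
  have hcard : (Finset.Ico (n - M) n).card = M := by rw [Nat.card_Ico]; omega
  obtain ⟨J, hJ, hJb, hJs⟩ := exists_subset_card_sum_le
    (fun i => ridgeForm ψ (Finset.range n) p (ψ i) (ψ i)) (Finset.Ico (n - M) n) (b := b)
    (by rw [hcard]; exact hbM)
  have hsub : Finset.Ico (n - M) n ⊆ Finset.range n := fun i hi =>
    Finset.mem_range.mpr (Finset.mem_Ico.mp hi).2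
  have hM0' : (0 : ℝ) < M := by exact_mod_cast hM0
  have hJd : ∑ i ∈ J, ridgeForm ψ (Finset.range n) p (ψ i) (ψ i) ≤
      b * effDim ψ (Finset.range n) p / M := by
    rw [le_div_iff₀ hM0', mul_comm, ← hcard]
    refine hJs.trans (mul_le_mul_of_nonneg_left ?_ (Nat.cast_nonneg _))
    exact Finset.sum_le_sum_of_subset_of_nonneg hsub fun i _ _ => hlev i
  have hJhalf : ∑ i ∈ J, ridgeForm ψ (Finset.range n) p (ψ i) (ψ i) ≤ 1 / 2 := by
    refine hJd.trans ?_
    rw [div_le_iff₀ hM0']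
    linarith
  set x' : ℕ → X := fun j => if j - 1 ∈ J then z else x j with hx'
  have h1 := logDet_replace (ψ := ψ) (ψ' := doubleVec φ (expWeight η) x') hp (hJ.trans hsub)
    hJhalf (c := fun i => expWeight η (i + 1)) (φ := φ z)
    (fun i hi => by
      have : i ∉ J := (Finset.mem_sdiff.mp hi).2
      simp [hψ, doubleVec, hx', this])
    (fun i hi => by simp [doubleVec, hx', hi])
  have h2 := logDet_le_two_mul_doubleGain hk hk1 (expWeight_pos hη) hlam x' n
  have h3 : b * Real.exp (-4) / lam * postVar k (expWeight η) lam x n z ≤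
      (∑ i ∈ J, expWeight η (i + 1) ^ 2) * ridgeForm ψ (Finset.range n) p (φ z) (φ z) := by
    have h4 := postVar_le_double hk hη hη' hlam x n z
    have h5 := card_mul_le_sum_expWeight_sq hη2 hη' hM hJ
    rw [hJb] at h5
    have h6 := ridgeForm_self_nonneg (ψ := ψ) (s := Finset.range n) hp (φ z)
    calc _ ≤ b * Real.exp (-4) / lam * (p * ridgeForm ψ (Finset.range n) p (φ z) (φ z)) :=
          mul_le_mul_of_nonneg_left h4 (by positivity)
      _ = b * (Real.exp (-4) * expWeight η n ^ 2) *
          ridgeForm ψ (Finset.range n) p (φ z) (φ z) := by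
          rw [hp_def, doubleReg]
          field_simp
      _ ≤ _ := mul_le_mul_of_nonneg_right h5 h6
  have h7 : Real.log (1 + b * Real.exp (-4) / lam * postVar k (expWeight η) lam x n z) ≤
      Real.log (1 + (∑ i ∈ J, expWeight η (i + 1) ^ 2) *
        ridgeForm ψ (Finset.range n) p (φ z) (φ z)) := by
    have h8 := postVar_nonneg hk hη hlam x n z
    exact Real.log_le_log (by positivity) (by linarith)
  linarith

lemma log_one_add_le_doubleGain (hk : ∀ z z', k z z' = inner ℝ (φ z) (φ z'))
    (hk1 : ∀ z, k z z ≤ 1) (hη2 : 1 / 2 ≤ η) (hη' : η < 1) (hlam : 0 < lam)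
    {n M : ℕ} (hMn : M ≤ n) (hM : M * (1 - η) ≤ 1) (z : X) :
    Real.log (1 + M * Real.exp (-4) / lam * k z z) ≤
      2 * doubleGain k (expWeight η) lam n := by
  have hη : 0 < η := by linarith
  have hp := doubleReg_pos hη hlam n
  have hw := expWeight_pos hη n
  have h1 := (logDet_union_smul (ψ := doubleVec φ (expWeight η) fun _ => z) (s := ∅)
    (J := Finset.range n) hp (Finset.disjoint_empty_left _)
    (c := fun i => expWeight η (i + 1)) (φ := φ z) (fun i _ => rfl)).1
  rw [Finset.empty_union, logDet_empty, zero_add, ridgeForm_empty hp] at h1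
  refine le_trans ?_ (logDet_le_two_mul_doubleGain hk hk1 (expWeight_pos hη) hlam (fun _ => z) n)
  have hkz : 0 ≤ k z z := by rw [hk]; exact real_inner_self_nonneg
  rw [h1, ← hk]
  refine Real.log_le_log (by positivity) ?_
  have hsub : Finset.Ico (n - M) n ⊆ Finset.range n := fun i hi =>
    Finset.mem_range.mpr (Finset.mem_Ico.mp hi).2
  have h2 := (card_mul_le_sum_expWeight_sq hη2 hη' hM (Finset.Subset.refl
    (Finset.Ico (n - M) n))).trans (Finset.sum_le_sum_of_subset_of_nonneg hsub
      fun i _ _ => sq_nonneg (expWeight η (i + 1)))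
  have hcard : (Finset.Ico (n - M) n).card = M := by rw [Nat.card_Ico]; omega
  rw [hcard] at h2
  have h3 : M * Real.exp (-4) / lam * k z z = M * (Real.exp (-4) * expWeight η n ^ 2) *
      ((doubleReg (expWeight η) lam n)⁻¹ * k z z) := by
    rw [doubleReg]
    field_simp
  rw [h3]
  have h4 : 0 ≤ (doubleReg (expWeight η) lam n)⁻¹ * k z z := by positivity
  linarith [mul_le_mul_of_nonneg_right h2 h4]

end Gain

section Feature

variable {E X : Type*} [NormedAddCommGroup E] [InnerProductSpace ℝ E]
  {k : X → X → ℝ} {φ : X → E} {η lam ε : ℝ} {m : ℕ} {feat : X → EuclideanSpace ℝ (Fin m)}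

lemma effDim_doubleVec_le (hε0 : 0 ≤ ε)
    (hε : ∀ z z', |inner ℝ (φ z) (φ z') - inner ℝ (feat z) (feat z')| ≤ ε)
    (hη : 0 < η) (hη' : η < 1) (hlam : 0 < lam) (hεη : 2 * ε ≤ 1 - η) (hm : 1 ≤ m)
    (x : ℕ → X) (n : ℕ) :
    effDim (doubleVec φ (expWeight η) x) (Finset.range n) (doubleReg (expWeight η) lam n) ≤
      (1 + 2 / lam) * m := by
  have hκ : 0 < 1 - η := by linarith
  have h1 := effDim_le_feature (s := Finset.range n) (x := fun i => x (i + 1))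
    (c := fun i => expWeight η (i + 1)) (Θ := 1 / (lam * (1 - η)))
    (doubleReg_pos hη hlam n) hε0 hε
    ((sum_expWeight_sq_le hη hη' n).trans (le_of_eq (by rw [doubleReg]; field_simp)))
  have h2 : 2 * ε * (1 / (lam * (1 - η))) ≤ 1 / lam := by
    rw [mul_one_div, div_le_div_iff₀ (by positivity) hlam]
    nlinarith
  have h3 := effDim_le_card (ψ := fun i => expWeight η (i + 1) • feat (x (i + 1)))
    (s := Finset.range n) (doubleReg_pos hη hlam n)
  have hm' : (1 : ℝ) ≤ m := by exact_mod_cast hm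
  refine h1.trans ?_
  have h4 : 0 ≤ 2 * ε * (1 / (lam * (1 - η))) := by positivity
  calc _ ≤ (m : ℝ) * (1 + 1 / lam) + 1 / lam :=
        add_le_add (mul_le_mul h3 (by linarith) (by linarith) (by positivity)) h2
    _ ≤ m * (1 + 1 / lam) + 1 / lam * m := by
        have : 0 ≤ 1 / lam := by positivity
        nlinarith
    _ = _ := by ring

lemma sum_weight_le_reg (hη : 0 < η) (hη' : η < 1) (hlam : 0 < lam) (n : ℕ) :
    ∑ i ∈ Finset.range n, √(expWeight η (i + 1)) ^ 2 ≤
      1 / (lam * (1 - η)) * reg (expWeight η) lam n := by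
  have hκ : 0 < 1 - η := by linarith
  simp only [Real.sq_sqrt (expWeight_pos hη _).le]
  exact (sum_expWeight_le hη hη' n).trans (le_of_eq (by rw [reg]; field_simp))

lemma effDim_weightedVec_le (hε0 : 0 ≤ ε)
    (hε : ∀ z z', |inner ℝ (φ z) (φ z') - inner ℝ (feat z) (feat z')| ≤ ε)
    (hη : 0 < η) (hη' : η < 1) (hlam : 0 < lam) (hεη : 2 * ε ≤ 1 - η)
    (x : ℕ → X) (n : ℕ) :
    effDim (weightedVec φ (expWeight η) x) (Finset.range n) (reg (expWeight η) lam n) ≤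
      (1 + 1 / lam) * (2 * featGain (expWeight η) lam x n feat) + 2 * ε / (lam * (1 - η)) := by
  have hκ : 0 < 1 - η := by linarith
  have hp := reg_pos hη hlam n
  have h1 := effDim_le_feature (s := Finset.range n) (x := fun i => x (i + 1))
    (c := fun i => √(expWeight η (i + 1))) hp hε0 hε (sum_weight_le_reg hη hη' hlam n)
  have h2 : 2 * ε * (1 / (lam * (1 - η))) ≤ 1 / lam := by
    rw [mul_one_div, div_le_div_iff₀ (by positivity) hlam]
    nlinarith
  have h3 := effDim_le_logDet (ψ := weightedVec feat (expWeight η) x) hp (Finset.range n)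
  have h4 : logDet (weightedVec feat (expWeight η) x) (Finset.range n) (reg (expWeight η) lam n) =
      2 * featGain (expWeight η) lam x n feat := by
    rw [featGain_eq]
    ring
  have h5 := effDim_nonneg (ψ := weightedVec feat (expWeight η) x) (s := Finset.range n) hp
  rw [h4] at h3
  refine h1.trans ?_
  rw [mul_comm]
  refine add_le_add ?_ (le_of_eq (by ring))
  exact mul_le_mul (by linarith) h3 h5 (by positivity)

lemma featGain_nonneg (hη : 0 < η) (hlam : 0 < lam) (x : ℕ → X) (n : ℕ)
    (feat : X → EuclideanSpace ℝ (Fin m)) : 0 ≤ featGain (expWeight η) lam x n feat := by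
  rw [featGain_eq]
  exact mul_nonneg (by norm_num) (logDet_nonneg (reg_pos hη hlam n) _)

lemma inv_sub_one_le (hη2 : 1 / 2 ≤ η) (hη' : η < 1) : η⁻¹ - 1 ≤ 2 * (1 - η) := by
  have hη : 0 < η := by linarith
  rw [sub_le_iff_le_add, inv_le_iff_one_le_mul₀ hη]
  nlinarith

lemma sum_log_ridgeForm_le (hη2 : 1 / 2 ≤ η) (hη' : η < 1) (hlam : 0 < lam) (x : ℕ → X) (T : ℕ) :
    ∑ n ∈ Finset.range T, Real.log (1 + ridgeForm (weightedVec feat (expWeight η) x)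
        (Finset.range n) (reg (expWeight η) lam n) (weightedVec feat (expWeight η) x n)
        (weightedVec feat (expWeight η) x n)) ≤
      2 * featGain (expWeight η) lam x T feat + 2 * (1 - η) * m * T := by
  have hη : 0 < η := by linarith
  have hr : 1 ≤ η⁻¹ := (one_le_inv₀ hη).mpr hη'.le
  induction T with
  | zero => simpa using featGain_nonneg hη hlam x 0 feat
  | succ T ih =>
    rw [Finset.sum_range_succ]
    have hp := reg_pos hη hlam T
    have h1 := logDet_insert (ψ := weightedVec feat (expWeight η) x) hp
      (Finset.notMem_range_self (n := T))
    rw [← Finset.range_add_one] at h1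
    have h2 := logDet_le_add_effDim (ψ := weightedVec feat (expWeight η) x) hp hr
      (Finset.range (T + 1))
    have h3 : η⁻¹ * reg (expWeight η) lam T = reg (expWeight η) lam (T + 1) := by
      rw [reg, reg, expWeight_succ]
      ring
    rw [h3] at h2
    have h4 := effDim_le_card (ψ := weightedVec feat (expWeight η) x)
      (s := Finset.range (T + 1)) (reg_pos hη hlam (T + 1))
    have h5 := effDim_nonneg (ψ := weightedVec feat (expWeight η) x)
      (s := Finset.range (T + 1)) (reg_pos hη hlam (T + 1))
    have h6 : (η⁻¹ - 1) * effDim (weightedVec feat (expWeight η) x) (Finset.range (T + 1))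
        (reg (expWeight η) lam (T + 1)) ≤ 2 * (1 - η) * m :=
      mul_le_mul (inv_sub_one_le hη2 hη') h4 h5 (by linarith)
    rw [featGain_eq] at ih ⊢
    push_cast
    linarith

lemma postVar_le_feature (hk : ∀ z z', k z z' = inner ℝ (φ z) (φ z')) (hε0 : 0 ≤ ε)
    (hε : ∀ z z', |inner ℝ (φ z) (φ z') - inner ℝ (feat z) (feat z')| ≤ ε)
    (hη : 0 < η) (hη' : η < 1) (hlam : 0 < lam) (hεη : 2 * ε ≤ 1 - η)
    (x : ℕ → X) (n : ℕ) :
    postVar k (expWeight η) lam x n (x (n + 1)) ≤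
      (lam + 1) * ridgeForm (weightedVec feat (expWeight η) x) (Finset.range n)
        (reg (expWeight η) lam n) (weightedVec feat (expWeight η) x n)
        (weightedVec feat (expWeight η) x n) + 2 * ε := by
  have hκ : 0 < 1 - η := by linarith
  have hp := reg_pos hη hlam n
  have h1 := ridgeForm_le_feature (s := Finset.range n) (x := fun i => x (i + 1))
    (c := fun i => √(expWeight η (i + 1))) hp hε0 hε (sum_weight_le_reg hη hη' hlam n) (x (n + 1))
  have h2 : 2 * ε * (1 / (lam * (1 - η))) ≤ 1 / lam := by
    rw [mul_one_div, div_le_div_iff₀ (by positivity) hlam]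
    nlinarith
  rw [postVar_eq hk x n hp]
  refine h1.trans (add_le_add_left ?_ _)
  have h3 : ridgeForm (weightedVec feat (expWeight η) x) (Finset.range n)
        (reg (expWeight η) lam n) (weightedVec feat (expWeight η) x n)
        (weightedVec feat (expWeight η) x n) = expWeight η (n + 1) *
      ridgeForm (weightedVec feat (expWeight η) x) (Finset.range n)
        (reg (expWeight η) lam n) (feat (x (n + 1))) (feat (x (n + 1))) := by
    conv_lhs => rw [show weightedVec feat (expWeight η) x n =
      √(expWeight η (n + 1)) • feat (x (n + 1)) from rfl]
    rw [ridgeForm_smul_smul hp, Real.sq_sqrt (expWeight_pos hη _).le]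
  have h4 := ridgeForm_self_nonneg (ψ := weightedVec feat (expWeight η) x) (s := Finset.range n)
    hp (feat (x (n + 1)))
  rw [h3]
  change reg (expWeight η) lam n * ridgeForm (weightedVec feat (expWeight η) x) (Finset.range n)
        (reg (expWeight η) lam n) (feat (x (n + 1))) (feat (x (n + 1))) * _ ≤ _
  set Q := ridgeForm (weightedVec feat (expWeight η) x) (Finset.range n)
        (reg (expWeight η) lam n) (feat (x (n + 1))) (feat (x (n + 1)))
  have h5 := expWeight_mono hη hη' (Nat.le_succ n)
  calc _ ≤ reg (expWeight η) lam n * Q * (1 + 1 / lam) :=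
        mul_le_mul_of_nonneg_left (by linarith) (mul_nonneg hp.le h4)
    _ = (lam + 1) * (expWeight η n * Q) := by
        rw [reg]
        field_simp
    _ ≤ _ := by gcongr

lemma sum_postVar_le (hk : ∀ z z', k z z' = inner ℝ (φ z) (φ z')) (hk1 : ∀ z, k z z ≤ 1)
    (hε0 : 0 ≤ ε) (hε : ∀ z z', |inner ℝ (φ z) (φ z') - inner ℝ (feat z) (feat z')| ≤ ε)
    (hη2 : 1 / 2 ≤ η) (hη' : η < 1) (hlam : 0 < lam) (hεη : 2 * ε ≤ 1 - η)
    (x : ℕ → X) (T : ℕ) :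
    ∑ n ∈ Finset.range T, postVar k (expWeight η) lam x n (x (n + 1)) ≤
      (lam + 1) * (1 + 4 / lam) * (2 * featGain (expWeight η) lam x T feat +
        2 * (1 - η) * m * T) + 2 * ε * T := by
  have hη : 0 < η := by linarith
  refine (Finset.sum_le_sum fun n _ =>
    postVar_le_feature hk hε0 hε hη hη' hlam hεη x n).trans ?_
  rw [Finset.sum_add_distrib, Finset.sum_const, Finset.card_range, nsmul_eq_mul,
    ← Finset.mul_sum, mul_comm (T : ℝ)]
  refine add_le_add_left ?_ _
  rw [mul_assoc]
  refine mul_le_mul_of_nonneg_left ?_ (by positivity)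
  refine le_trans ?_ (mul_le_mul_of_nonneg_left
    (sum_log_ridgeForm_le (feat := feat) hη2 hη' hlam x T) (by positivity))
  rw [Finset.mul_sum]
  refine Finset.sum_le_sum fun n _ => ?_
  have hp := reg_pos hη hlam n
  set Q := ridgeForm (weightedVec feat (expWeight η) x) (Finset.range n)
        (reg (expWeight η) lam n) (weightedVec feat (expWeight η) x n)
        (weightedVec feat (expWeight η) x n) with hQ
  have hQ0 : 0 ≤ Q := ridgeForm_self_nonneg hp _
  have hQ1 : Q ≤ 4 / lam := by
    have h1 := reg_mul_ridgeForm_le (ψ := weightedVec feat (expWeight η) x)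
      (s := Finset.range n) hp (weightedVec feat (expWeight η) x n)
    rw [← hQ, ← real_inner_self_eq_norm_sq, show weightedVec feat (expWeight η) x n =
      √(expWeight η (n + 1)) • feat (x (n + 1)) from rfl, inner_smul_left, inner_smul_right]
      at h1
    simp only [conj_trivial] at h1
    rw [← mul_assoc, Real.mul_self_sqrt (expWeight_pos hη _).le, reg, expWeight_succ] at h1
    have h2 : inner ℝ (feat (x (n + 1))) (feat (x (n + 1))) ≤ 2 := by
      have h3 := abs_le.mp (hε (x (n + 1)) (x (n + 1)))
      have h4 := hk1 (x (n + 1))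
      rw [hk] at h4
      linarith [h3.1]
    have h5 : η⁻¹ ≤ 2 := by
      rw [inv_le_comm₀ hη two_pos]
      linarith
    have hw := expWeight_pos hη n
    rw [le_div_iff₀ hlam]
    have h6 : η⁻¹ * expWeight η n * inner ℝ (feat (x (n + 1))) (feat (x (n + 1))) ≤
        2 * expWeight η n * 2 := by
      apply mul_le_mul _ h2 real_inner_self_nonneg (by positivity)
      gcongr
    have h7 : expWeight η n * (Q * lam) ≤ expWeight η n * 4 := by linarith
    exact le_of_mul_le_mul_left h7 hw
  have h8 : Q / (1 + Q) ≤ Real.log (1 + Q) := by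
    have h9 := Real.one_sub_inv_le_log_of_pos (show 0 < 1 + Q by positivity)
    refine le_trans (le_of_eq ?_) h9
    field_simp
    ring
  calc Q = (1 + Q) * (Q / (1 + Q)) := by field_simp
    _ ≤ (1 + 4 / lam) * Real.log (1 + Q) :=
      mul_le_mul (by linarith) h8 (by positivity) (by positivity)

lemma effDim_doubleVec_le_featGain (hε0 : 0 ≤ ε)
    (hε : ∀ z z', |inner ℝ (φ z) (φ z') - inner ℝ (feat z) (feat z')| ≤ ε)
    (hη2 : 1 / 2 ≤ η) (hη' : η < 1) (hlam : 0 < lam) (hεη : 2 * ε ≤ 1 - η)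
    (x : ℕ → X) {n T : ℕ} (hn : n ≤ T) (hT : T * (1 - η) ≤ 1) :
    effDim (doubleVec φ (expWeight η) x) (Finset.range n) (doubleReg (expWeight η) lam n) ≤
      Real.exp 4 * (1 + 1 / lam) * (2 * featGain (expWeight η) lam x T feat + 1) := by
  have hη : 0 < η := by linarith
  have hκ : 0 < 1 - η := by linarith
  have hw : ∀ j ≤ T, expWeight η j ≤ Real.exp 2 := by
    intro j hj
    refine (expWeight_le_exp hη2 hη' j).trans (Real.exp_le_exp.mpr ?_)
    have : (j : ℝ) ≤ T := by exact_mod_cast hj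
    nlinarith
  have hpS := reg_pos hη hlam n
  have hpD := doubleReg_pos hη hlam n
  have hn0 := expWeight_pos hη n
  -- comparison of the two leverages
  have h1 : effDim (doubleVec φ (expWeight η) x) (Finset.range n) (doubleReg (expWeight η) lam n) ≤
      Real.exp 2 * effDim (weightedVec φ (expWeight η) x) (Finset.range n)
        (reg (expWeight η) lam n) := by
    unfold effDim
    rw [Finset.mul_sum]
    refine Finset.sum_le_sum fun i hi => ?_
    have hi' := Finset.mem_range.mp hi
    have h2 := ridgeForm_le_of_le (ψ := doubleVec φ (expWeight η) x) (s := Finset.range n)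
      (ψ' := weightedVec φ (expWeight η) x) (s' := Finset.range n) (c := 1) one_pos hpD hpS
      (fun u => by
        rw [inner_ridge_self, inner_ridge_self, one_mul, doubleReg, reg]
        refine add_le_add ?_ (Finset.sum_le_sum fun i _ => ?_)
        · have := one_le_expWeight hη hη' n
          refine mul_le_mul_of_nonneg_right ?_ (sq_nonneg _)
          rw [sq]
          nlinarith [mul_pos hlam hn0]
        · rw [inner_weightedVec_sq hη, inner_doubleVec_sq]
          refine mul_le_mul_of_nonneg_right ?_ (sq_nonneg _)
          nlinarith [one_le_expWeight hη hη' (i + 1)]) (φ (x (i + 1)))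
    rw [inv_one, one_mul] at h2
    rw [show doubleVec φ (expWeight η) x i = expWeight η (i + 1) • φ (x (i + 1)) from rfl,
      show weightedVec φ (expWeight η) x i = √(expWeight η (i + 1)) • φ (x (i + 1)) from rfl,
      ridgeForm_smul_smul hpD, ridgeForm_smul_smul hpS, Real.sq_sqrt (expWeight_pos hη _).le,
      sq, ← mul_assoc]
    have h3 := hw (i + 1) (by omega)
    have h4 := expWeight_pos hη (i + 1)
    have h5 := ridgeForm_self_nonneg (ψ := doubleVec φ (expWeight η) x) (s := Finset.range n)
      hpD (φ (x (i + 1)))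
    exact mul_le_mul (mul_le_mul_of_nonneg_right h3 h4.le) h2 h5 (by positivity)
  have h6 := effDim_weightedVec_le hε0 hε hη hη' hlam hεη x n
  have h7 : 2 * ε / (lam * (1 - η)) ≤ 1 / lam := by
    rw [div_le_div_iff₀ (by positivity) hlam]
    nlinarith
  have h8 : featGain (expWeight η) lam x n feat ≤
      Real.exp 2 * featGain (expWeight η) lam x T feat := by
    rw [featGain_eq, featGain_eq]
    have h9 : 1 ≤ expWeight η (T - n) := one_le_expWeight hη hη' _
    have h10 := logDet_le_mul (ψ := weightedVec feat (expWeight η) x) hpS h9 (Finset.range n)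
    have h11 : expWeight η (T - n) * reg (expWeight η) lam n = reg (expWeight η) lam T := by
      rw [reg, reg, mul_left_comm, ← expWeight_add, Nat.sub_add_cancel hn]
    rw [h11] at h10
    have h12 := logDet_mono (ψ := weightedVec feat (expWeight η) x) (reg_pos hη hlam T)
      (Finset.range_mono hn)
    have h13 := logDet_nonneg (ψ := weightedVec feat (expWeight η) x) (reg_pos hη hlam T)
      (Finset.range T)
    have h14 := mul_le_mul (hw (T - n) (Nat.sub_le _ _)) h12
      (logDet_nonneg (reg_pos hη hlam T) _) (Real.exp_pos 2).le
    linarith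
  have h15 := featGain_nonneg hη hlam x T feat
  have h16 : Real.exp 4 = Real.exp 2 * Real.exp 2 := by rw [← Real.exp_add]; norm_num
  have h17 : 1 ≤ Real.exp 2 := Real.one_le_exp (by norm_num)
  refine h1.trans ?_
  rw [h16, mul_assoc (Real.exp 2), mul_assoc]
  refine mul_le_mul_of_nonneg_left ?_ (Real.exp_pos 2).le
  refine h6.trans ?_
  have h18 : 0 ≤ 1 / lam := by positivity
  calc _ ≤ (1 + 1 / lam) * (2 * (Real.exp 2 * featGain (expWeight η) lam x T feat)) +
        (1 + 1 / lam) * Real.exp 2 := by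
        refine add_le_add (mul_le_mul_of_nonneg_left (by linarith) (by positivity)) ?_
        nlinarith
    _ = _ := by ring

end Feature

end WGPUCB

namespace WGPUCB

section ConfRadius

variable {E X : Type*} [NormedAddCommGroup E] [InnerProductSpace ℝ E]
  {k : X → X → ℝ} {φ : X → E} {η lam δ : ℝ}

/-- `√(2 log (1/δ) + 2 γ̄_n)`, the radius of the self-normalized confidence ellipsoid. -/
def confRadius (k : X → X → ℝ) (η lam δ : ℝ) (n : ℕ) : ℝ :=
  √(2 * Real.log (1 / δ) + 2 * doubleGain k (expWeight η) lam n)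

lemma confRadius_nonneg (n : ℕ) : 0 ≤ confRadius k η lam δ n := Real.sqrt_nonneg _

lemma log_one_div_nonneg (hδ : 0 < δ) (hδ' : δ < 1) : 0 ≤ Real.log (1 / δ) :=
  Real.log_nonneg ((one_le_div hδ).mpr hδ'.le)

lemma confRadius_sq (hk : ∀ z z', k z z' = inner ℝ (φ z) (φ z')) (hk1 : ∀ z, k z z ≤ 1)
    (hη : 0 < η) (hlam : 0 < lam) (hδ : 0 < δ) (hδ' : δ < 1) [Nonempty X] (n : ℕ) :
    confRadius k η lam δ n ^ 2 =
      2 * Real.log (1 / δ) + 2 * doubleGain k (expWeight η) lam n := by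
  have h1 := log_one_div_nonneg hδ hδ'
  have h2 := doubleGain_nonneg hk hk1 (expWeight_pos hη) hlam n
  exact Real.sq_sqrt (by positivity)

lemma confRadius_mono (hk : ∀ z z', k z z' = inner ℝ (φ z) (φ z')) (hk1 : ∀ z, k z z ≤ 1)
    (hη : 0 < η) (hlam : 0 < lam) [Nonempty X] : Monotone (confRadius k η lam δ) := by
  intro n n' h
  have := doubleGain_mono hk hk1 hη hlam h
  exact Real.sqrt_le_sqrt (by linarith)

end ConfRadius

section ShortHorizon

lemma exp_sub_one_le_mul_exp {y Y : ℝ} (hy : 0 ≤ y) (hY : y ≤ Y) :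
    Real.exp y - 1 ≤ y * Real.exp Y := by
  have h1 := Real.add_one_le_exp (-y)
  have h2 : Real.exp y * Real.exp (-y) = 1 := by rw [← Real.exp_add]; simp
  have h3 : Real.exp y * (1 - y) ≤ 1 := by
    rw [← h2]
    exact mul_le_mul_of_nonneg_left (by linarith) (Real.exp_pos _).le
  have h4 : y * Real.exp y ≤ y * Real.exp Y :=
    mul_le_mul_of_nonneg_left (Real.exp_le_exp.mpr hY) hy
  linarith

variable {E X : Type*} [NormedAddCommGroup E] [InnerProductSpace ℝ E]
  {k : X → X → ℝ} {φ : X → E} {η lam δ : ℝ} {x : ℕ → X} {ζ : ℕ → ℝ}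

lemma noiseForm_le_of_mixture_le (hη2 : 1 / 2 ≤ η) (hη' : η < 1) (hlam : 0 < lam)
    {n : ℕ} (hn : n * (1 - η) ≤ 1 / 2)
    (hE : mixture φ (expWeight η) x ζ lam n ≤ 1 / δ) :
    noiseForm φ (expWeight η) x ζ (doubleReg (expWeight η) lam n) n ≤
      2 * Real.log (1 / δ) +
        logDet (doubleVec φ (expWeight η) x) (Finset.range n) (doubleReg (expWeight η) lam n) +
        4 * Real.exp 2 * (n * (1 - η)) * effDim (doubleVec φ (expWeight η) x) (Finset.range n)
          (doubleReg (expWeight η) lam n) := by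
  have hη : 0 < η := by linarith
  have hw := expWeight_pos hη n
  have hpD := doubleReg_pos hη hlam n
  have h1 : 1 ≤ expWeight η n ^ 2 := one_le_pow₀ (one_le_expWeight hη hη' n)
  have h2 : expWeight η n ^ 2 * lam = doubleReg (expWeight η) lam n := mul_comm _ _
  have h3 := logDet_le_add_effDim (ψ := doubleVec φ (expWeight η) x) hlam h1 (Finset.range n)
  rw [h2] at h3
  have h4 : expWeight η n ^ 2 - 1 ≤ 4 * Real.exp 2 * (n * (1 - η)) := by
    have h5 := pow_le_pow_left₀ hw.le (expWeight_le_exp hη2 hη' n) 2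
    rw [← Real.exp_nat_mul] at h5
    push_cast at h5
    have h6 : 0 ≤ n * (1 - η) := mul_nonneg (Nat.cast_nonneg _) (by linarith)
    have h7 := exp_sub_one_le_mul_exp (y := 2 * (2 * (n * (1 - η)))) (Y := 2) (by linarith)
      (by linarith)
    linarith
  have h8 : noiseForm φ (expWeight η) x ζ (doubleReg (expWeight η) lam n) n ≤
      noiseForm φ (expWeight η) x ζ lam n := by
    refine ridgeForm_anti_reg hlam ?_ _
    rw [doubleReg]
    nlinarith
  have h9 : noiseForm φ (expWeight η) x ζ lam n ≤ 2 * Real.log (1 / δ) +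
      logDet (doubleVec φ (expWeight η) x) (Finset.range n) lam := by
    have h10 := Real.log_le_log (Real.exp_pos _) hE
    rw [Real.log_exp] at h10
    linarith
  have h11 := mul_le_mul_of_nonneg_right h4 (effDim_nonneg
    (ψ := doubleVec φ (expWeight η) x) (s := Finset.range n) hpD)
  linarith

/-- The constant of `noise_and_excess_le_of_short`. -/
def shortConst (lam : ℝ) : ℝ :=
  lam * Real.exp 4 * ((4 * Real.exp 2 + 2) * Real.exp (4 * Real.exp 2 + 2))

lemma shortConst_pos (hlam : 0 < lam) : 0 < shortConst lam := by
  unfold shortConst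
  positivity

set_option maxHeartbeats 400000 in
lemma noise_and_excess_le_of_short (hk : ∀ z z', k z z' = inner ℝ (φ z) (φ z'))
    (hk1 : ∀ z, k z z ≤ 1)
    (hη2 : 1 / 2 ≤ η) (hη' : η < 1) (hlam : 0 < lam) (hδ : 0 < δ) (hδ' : δ < 1) {n : ℕ}
    (hn : n * (1 - η) ≤ 1 / 2)
    (hd : n * (1 - η) * effDim (doubleVec φ (expWeight η) x) (Finset.range n)
      (doubleReg (expWeight η) lam n) ≤ 1 / 2)
    (hE : mixture φ (expWeight η) x ζ lam n ≤ 1 / δ) (z : X) :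
    √(noiseForm φ (expWeight η) x ζ (doubleReg (expWeight η) lam n) n) ≤
        (1 + 4 * Real.exp 2) * confRadius k η lam δ n ∧
      max (√(noiseForm φ (expWeight η) x ζ (doubleReg (expWeight η) lam n) n) -
          confRadius k η lam δ n) 0 * postStd k (expWeight η) lam x n z ≤
        4 * Real.exp 2 * (1 + shortConst lam) * (√(1 - η) * confRadius k η lam δ n) := by
  have : Nonempty X := ⟨z⟩
  have hη : 0 < η := by linarith
  have hκ : 0 < 1 - η := by linarith
  have hpD := doubleReg_pos hη hlam n
  have hq := noiseForm_le_of_mixture_le hη2 hη' hlam hn hE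
  have hL := logDet_le_two_mul_doubleGain hk hk1 (expWeight_pos hη) hlam x n
  have hdL := effDim_le_logDet (ψ := doubleVec φ (expWeight η) x) hpD (Finset.range n)
  have hd0 := effDim_nonneg (ψ := doubleVec φ (expWeight η) x) (s := Finset.range n) hpD
  have hgain := fun (b : ℕ) hn0 hb hbd =>
    logDet_add_log_le_doubleGain hk hk1 hη2 hη' hlam x (n := n) (M := n) (b := b) hn0 le_rfl hb
      (hn.trans (by norm_num)) hbd z
  have hasq := confRadius_sq hk hk1 hη hlam hδ hδ' n
  have hlog := log_one_div_nonneg hδ hδ'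
  have ha0 : 0 ≤ confRadius k η lam δ n := confRadius_nonneg n
  have hv0 := postVar_nonneg hk hη hlam x n z
  have hv1 := (postVar_le_kernel hk hη hlam x n z).trans (hk1 z)
  have hssq : postStd k (expWeight η) lam x n z ^ 2 = postVar k (expWeight η) lam x n z :=
    Real.sq_sqrt hv0
  have hs0 : 0 ≤ postStd k (expWeight η) lam x n z := Real.sqrt_nonneg _
  set d := effDim (doubleVec φ (expWeight η) x) (Finset.range n) (doubleReg (expWeight η) lam n)
  set L := logDet (doubleVec φ (expWeight η) x) (Finset.range n) (doubleReg (expWeight η) lam n)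
  set g := doubleGain k (expWeight η) lam n
  set v := postVar k (expWeight η) lam x n z
  set s := postStd k (expWeight η) lam x n z
  set a := confRadius k η lam δ n
  set N := noiseForm φ (expWeight η) x ζ (doubleReg (expWeight η) lam n) n
  set K := 4 * Real.exp 2 with hK
  set τ : ℝ := n * (1 - η) with hτ
  have hτ0 : 0 ≤ τ := by positivity
  have hK0 : 0 < K := by positivity
  clear_value d L g v s a N K τ
  have hda : d ≤ a ^ 2 := by linarith
  have hsd : √d ≤ a := Real.sqrt_le_iff.mpr ⟨ha0, hda⟩
  have hsd0 : 0 ≤ √d := Real.sqrt_nonneg _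
  have hsdsq : √d ^ 2 = d := Real.sq_sqrt hd0
  have hqa : √N ≤ a + K * τ * √d := by
    refine Real.sqrt_le_iff.mpr ⟨by positivity, ?_⟩
    have h1 : K * τ * d ≤ K * τ * (√d * a) :=
      mul_le_mul_of_nonneg_left (by nlinarith) (by positivity)
    have h2 : (a + K * τ * √d) ^ 2 = a ^ 2 + 2 * (K * τ * (√d * a)) + (K * τ * √d) ^ 2 := by ring
    have h3 : 0 ≤ K * τ * d := by positivity
    linarith [sq_nonneg (K * τ * √d)]
  have hexc : max (√N - a) 0 ≤ K * τ * √d := max_le (by linarith) (by positivity)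
  have hKτ : K * τ * √d ≤ K * a := by
    have : τ * √d ≤ 1 * a := mul_le_mul (by linarith) hsd hsd0 zero_le_one
    nlinarith
  have hs1 : s ≤ 1 := by
    apply le_of_sq_le_sq _ zero_le_one
    linarith
  have hC := shortConst_pos hlam
  refine ⟨by linarith, ?_⟩
  have hκ0 : 0 ≤ √(1 - η) := Real.sqrt_nonneg _
  have hκsq : √(1 - η) ^ 2 = 1 - η := Real.sq_sqrt hκ.le
  rcases le_or_gt (n * τ) 1 with hcase | hcase
  · -- the excess itself is small
    have h1 : τ ≤ √(1 - η) := by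
      apply Real.le_sqrt_of_sq_le
      calc τ ^ 2 = (n * τ) * (1 - η) := by rw [hτ]; ring
        _ ≤ 1 * (1 - η) := by gcongr
        _ = 1 - η := one_mul _
    calc _ ≤ K * τ * √d * 1 := mul_le_mul hexc hs1 hs0 (by positivity)
      _ ≤ K * √(1 - η) * a * 1 := by gcongr
      _ ≤ _ := by
        have : 0 ≤ K * shortConst lam * (√(1 - η) * a) := by positivity
        linarith
  · rcases le_or_gt (√N) a with hle | hgt
    · rw [max_eq_right (by linarith), zero_mul]
      positivity
    · -- the information gained at `z` is small
      have hn0 : 0 < n := by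
        rcases Nat.eq_zero_or_pos n with h | h
        · simp [h] at hcase
          linarith
        · exact h
      have hn0' : (0 : ℝ) < n := by exact_mod_cast hn0
      set b := ⌊n * τ⌋₊ with hb
      have hb1 : (b : ℝ) ≤ n * τ := Nat.floor_le (by positivity)
      have hb2 : n * τ / 2 ≤ b := by
        have h1 := Nat.lt_floor_add_one (n * τ)
        have h2 : (1 : ℝ) ≤ b := by exact_mod_cast (Nat.one_le_floor_iff _).mpr hcase.le
        linarith
      have hbn : b ≤ n := by
        have : (b : ℝ) ≤ n := hb1.trans (mul_le_of_le_one_right hn0'.le (by linarith))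
        exact_mod_cast this
      have hbd : b * d ≤ n * (τ * d) := by
        rw [← mul_assoc]
        exact mul_le_mul_of_nonneg_right hb1 hd0
      have h1 := hgain b hn0 hbn (by linarith [mul_le_mul_of_nonneg_left hd hn0'.le])
      have h2 : b * d / n ≤ τ * d := by
        rw [div_le_iff₀ hn0']
        linarith
      have h3 : a ^ 2 < N := (Real.lt_sqrt ha0).mp hgt
      have h5 : Real.log (1 + b * Real.exp (-4) / lam * v) ≤ (K + 2) * (τ * d) := by
        linarith
      have h6 : b * Real.exp (-4) / lam * v ≤
          (K + 2) * (τ * d) * Real.exp (K + 2) := by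
        have h7 := exp_sub_one_le_mul_exp (y := (K + 2) * (τ * d)) (Y := K + 2) (by positivity)
          (mul_le_of_le_one_right (by positivity) (by linarith))
        have h8 : 1 + b * Real.exp (-4) / lam * v ≤ Real.exp ((K + 2) * (τ * d)) := by
          rw [← Real.log_le_iff_le_exp (by positivity)]
          exact h5
        linarith
      have h9 : b * v ≤ shortConst lam * (τ * d) := by
        have h10 : b * v = lam * Real.exp 4 * (b * Real.exp (-4) / lam * v) := by
          rw [Real.exp_neg]
          field_simp
        rw [h10, shortConst]
        calc _ ≤ lam * Real.exp 4 * ((K + 2) * (τ * d) * Real.exp (K + 2)) :=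
              mul_le_mul_of_nonneg_left h6 (by positivity)
          _ = _ := by rw [hK]; ring
      have h11 : n * τ * v ≤ 2 * (shortConst lam * (τ * d)) := by
        linarith [mul_le_mul_of_nonneg_right hb2 hv0]
      apply le_of_sq_le_sq _ (by positivity)
      calc _ ≤ (K * τ * √d * s) ^ 2 :=
            pow_le_pow_left₀ (mul_nonneg (le_max_right _ _) hs0)
              (mul_le_mul_of_nonneg_right hexc hs0) 2
        _ = K ^ 2 * (1 - η) * d * (n * τ * v) := by
            rw [mul_pow, mul_pow, mul_pow, hsdsq, hssq, hτ]
            ring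
        _ ≤ K ^ 2 * (1 - η) * d * (2 * (shortConst lam * (τ * d))) := by gcongr
        _ ≤ K ^ 2 * (1 - η) * a ^ 2 * (2 * (shortConst lam * (1 / 2))) := by gcongr
        _ = K ^ 2 * shortConst lam * (√(1 - η) * a) ^ 2 := by
            rw [mul_pow (√(1 - η)), hκsq]
            ring
        _ ≤ K ^ 2 * (1 + shortConst lam) ^ 2 * (√(1 - η) * a) ^ 2 := by
            gcongr
            nlinarith
        _ = _ := by ring

end ShortHorizon

end WGPUCB

namespace WGPUCB

section WeightedSums

variable {T : ℕ} {p q a g : ℕ → ℝ} {A P : ℝ}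

lemma sum_mul_sq_le_of_sum_exp_le (hp : ∀ n < T, 0 ≤ p n) (hg : ∀ n < T, 0 ≤ g n)
    (ha : ∀ n < T, 0 ≤ a n) (haA : ∀ n < T, a n ≤ A) (hP : ∑ n ∈ Finset.range T, p n = P)
    (hE : ∑ n ∈ Finset.range T, p n * Real.exp ((q n ^ 2 - a n ^ 2) / 2 + g n) ≤ P) :
    ∑ n ∈ Finset.range T, p n * q n ^ 2 ≤ A ^ 2 * P := by
  have h1 : ∑ n ∈ Finset.range T, p n * q n ^ 2 ≤ ∑ n ∈ Finset.range T,
      (2 * (p n * Real.exp ((q n ^ 2 - a n ^ 2) / 2 + g n)) - 2 * p n + A ^ 2 * p n) := by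
    refine Finset.sum_le_sum fun n hn => ?_
    have hn' := Finset.mem_range.mp hn
    have h2 := Real.add_one_le_exp ((q n ^ 2 - a n ^ 2) / 2 + g n)
    have h3 := pow_le_pow_left₀ (ha n hn') (haA n hn') 2
    have h4 : q n ^ 2 ≤ 2 * Real.exp ((q n ^ 2 - a n ^ 2) / 2 + g n) - 2 + A ^ 2 := by
      linarith [hg n hn']
    calc _ ≤ p n * (2 * Real.exp ((q n ^ 2 - a n ^ 2) / 2 + g n) - 2 + A ^ 2) :=
          mul_le_mul_of_nonneg_left h4 (hp n hn')
      _ = _ := by ring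
  refine h1.trans ?_
  rw [Finset.sum_add_distrib, Finset.sum_sub_distrib, ← Finset.mul_sum, ← Finset.mul_sum,
    ← Finset.mul_sum, hP]
  linarith

lemma sum_mul_le_sqrt_mul_sqrt (f : ℕ → ℝ) (hp : ∀ n < T, 0 < p n) :
    ∑ n ∈ Finset.range T, q n * f n ≤
      √(∑ n ∈ Finset.range T, p n * q n ^ 2) * √(∑ n ∈ Finset.range T, f n ^ 2 / p n) := by
  rw [← Real.sqrt_mul (Finset.sum_nonneg fun n hn =>
    mul_nonneg (hp n (Finset.mem_range.mp hn)).le (sq_nonneg _))]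
  apply Real.le_sqrt_of_sq_le
  have h1 := Finset.sum_mul_sq_le_sq_mul_sq (Finset.range T) (fun n => √(p n) * q n)
    (fun n => f n / √(p n))
  have h2 : ∀ n ∈ Finset.range T, √(p n) * q n * (f n / √(p n)) = q n * f n := fun n hn => by
    have := Real.sqrt_pos.mpr (hp n (Finset.mem_range.mp hn))
    field_simp
  have h3 : ∀ n ∈ Finset.range T, (√(p n) * q n) ^ 2 = p n * q n ^ 2 := fun n hn => by
    rw [mul_pow, Real.sq_sqrt (hp n (Finset.mem_range.mp hn)).le]
  have h4 : ∀ n ∈ Finset.range T, (f n / √(p n)) ^ 2 = f n ^ 2 / p n := fun n hn => by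
    rw [div_pow, Real.sq_sqrt (hp n (Finset.mem_range.mp hn)).le]
  rwa [Finset.sum_congr rfl h2, Finset.sum_congr rfl h3, Finset.sum_congr rfl h4] at h1

lemma sum_mul_le_sqrt_card_mul (f : ℕ → ℝ) :
    ∑ n ∈ Finset.range T, f n ≤ √(T * ∑ n ∈ Finset.range T, f n ^ 2) := by
  apply Real.le_sqrt_of_sq_le
  simpa using sq_sum_le_card_mul_sum_sq (s := Finset.range T) (f := f)

lemma sum_mul_le_of_sum_exp_le (hp : ∀ n < T, 0 < p n) (hg : ∀ n < T, 0 ≤ g n)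
    (ha : ∀ n < T, 0 ≤ a n) (haA : ∀ n < T, a n ≤ A) (hA : 0 ≤ A)
    (hP : ∑ n ∈ Finset.range T, p n = P)
    (hE : ∑ n ∈ Finset.range T, p n * Real.exp ((q n ^ 2 - a n ^ 2) / 2 + g n) ≤ P)
    {pm : ℝ} (hpm : 0 < pm) (hpmp : ∀ n < T, pm ≤ p n) (hPpm : P ≤ 2 * T * pm) (f : ℕ → ℝ) :
    ∑ n ∈ Finset.range T, q n * f n ≤ 2 * (A * √(T * ∑ n ∈ Finset.range T, f n ^ 2)) := by
  refine (sum_mul_le_sqrt_mul_sqrt f hp).trans ?_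
  have h1 := sum_mul_sq_le_of_sum_exp_le (fun n hn => (hp n hn).le) hg ha haA hP hE
  have h2 : ∑ n ∈ Finset.range T, f n ^ 2 / p n ≤ (∑ n ∈ Finset.range T, f n ^ 2) / pm := by
    rw [Finset.sum_div]
    refine Finset.sum_le_sum fun n hn => ?_
    have := hpmp n (Finset.mem_range.mp hn)
    gcongr
  have h3 : 0 ≤ ∑ n ∈ Finset.range T, f n ^ 2 := Finset.sum_nonneg fun _ _ => sq_nonneg _
  have h4 : √(∑ n ∈ Finset.range T, p n * q n ^ 2) ≤ √(A ^ 2 * (2 * T * pm)) :=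
    Real.sqrt_le_sqrt (h1.trans (mul_le_mul_of_nonneg_left hPpm (sq_nonneg _)))
  calc _ ≤ √(A ^ 2 * (2 * T * pm)) * √((∑ n ∈ Finset.range T, f n ^ 2) / pm) :=
        mul_le_mul h4 (Real.sqrt_le_sqrt h2) (Real.sqrt_nonneg _) (Real.sqrt_nonneg _)
    _ ≤ _ := by
        rw [← Real.sqrt_mul (by positivity)]
        refine Real.sqrt_le_iff.mpr ⟨by positivity, ?_⟩
        rw [mul_pow, mul_pow, Real.sq_sqrt (by positivity)]
        have h5 : A ^ 2 * (2 * T * pm) * ((∑ n ∈ Finset.range T, f n ^ 2) / pm) =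
            2 * (A ^ 2 * (T * ∑ n ∈ Finset.range T, f n ^ 2)) := by
          field_simp
        have h6 : 0 ≤ A ^ 2 * (T * ∑ n ∈ Finset.range T, f n ^ 2) := by positivity
        rw [h5]
        linarith

lemma sum_excess_le_of_sum_exp_le (hp : ∀ n < T, 0 < p n) (hg : ∀ n < T, 0 ≤ g n)
    (hq : ∀ n < T, 0 ≤ q n) (ha : ∀ n < T, 0 ≤ a n) (haA : ∀ n < T, a n ≤ A) (hA : 0 ≤ A)
    (hP : ∑ n ∈ Finset.range T, p n = P)
    (hE : ∑ n ∈ Finset.range T, p n * Real.exp ((q n ^ 2 - a n ^ 2) / 2 + g n) ≤ P)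
    {c G : ℝ} (hc : 0 < c) (hG : 0 ≤ G) {f : ℕ → ℝ} (hf : ∀ n < T, 0 ≤ f n)
    (h : ∀ n < T, f n ≤ p n ∨ (c ≤ a n ^ 2 ∧ f n ≤ G * (p n * Real.exp (g n)))) :
    ∑ n ∈ Finset.range T, max (q n - a n) 0 * f n ≤ (1 + 2 * G / c) * (A * P) := by
  have hP0 : 0 ≤ P := hP ▸ Finset.sum_nonneg fun n hn => (hp n (Finset.mem_range.mp hn)).le
  have hterm : ∀ n ∈ Finset.range T, max (q n - a n) 0 * f n ≤ q n * p n +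
      2 * G / c * A * (p n * Real.exp ((q n ^ 2 - a n ^ 2) / 2 + g n)) := by
    intro n hn
    have hn' := Finset.mem_range.mp hn
    have hp' := hp n hn'
    have hq' := hq n hn'
    have ha' := ha n hn'
    have hf' := hf n hn'
    have h0 : 0 ≤ 2 * G / c * A * (p n * Real.exp ((q n ^ 2 - a n ^ 2) / 2 + g n)) := by
      positivity
    rcases le_or_gt (q n) (a n) with hle | hgt
    · rw [max_eq_right (by linarith), zero_mul]
      positivity
    · rw [max_eq_left (by linarith)]
      rcases h n hn' with h1 | ⟨h1, h2⟩
      · have : (q n - a n) * f n ≤ q n * p n := mul_le_mul (by linarith) h1 hf' hq'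
        linarith
      · have ha2 : 0 < a n := by
          rcases ha'.lt_or_eq with h3 | h3
          · exact h3
          · rw [← h3] at h1
            norm_num at h1
            linarith
        have h3 : (q n - a n) * c ≤ 2 * A * Real.exp ((q n ^ 2 - a n ^ 2) / 2) := by
          have h4 := Real.add_one_le_exp ((q n ^ 2 - a n ^ 2) / 2)
          calc (q n - a n) * c ≤ (q n - a n) * a n ^ 2 :=
                mul_le_mul_of_nonneg_left h1 (by linarith)
            _ ≤ a n * (q n ^ 2 - a n ^ 2) := by nlinarith [mul_pos ha2 (sub_pos.mpr hgt)]
            _ ≤ A * (2 * Real.exp ((q n ^ 2 - a n ^ 2) / 2)) :=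
                mul_le_mul (haA n hn') (by linarith) (by nlinarith) hA
            _ = _ := by ring
        have h5 : q n - a n ≤ 2 * A * Real.exp ((q n ^ 2 - a n ^ 2) / 2) / c := by
          rwa [le_div_iff₀ hc]
        have h6 : (q n - a n) * f n ≤ 2 * A * Real.exp ((q n ^ 2 - a n ^ 2) / 2) / c *
            (G * (p n * Real.exp (g n))) := mul_le_mul h5 h2 hf' (by positivity)
        have h7 : 2 * A * Real.exp ((q n ^ 2 - a n ^ 2) / 2) / c * (G * (p n * Real.exp (g n))) =
            2 * G / c * A * (p n * Real.exp ((q n ^ 2 - a n ^ 2) / 2 + g n)) := by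
          rw [Real.exp_add]
          ring
        have : 0 ≤ q n * p n := by positivity
        linarith
  refine (Finset.sum_le_sum hterm).trans ?_
  rw [Finset.sum_add_distrib, ← Finset.mul_sum]
  have h1 := sum_mul_le_sqrt_mul_sqrt (q := q) p hp
  have h2 := sum_mul_sq_le_of_sum_exp_le (fun n hn => (hp n hn).le) hg ha haA hP hE
  have h3 : ∑ n ∈ Finset.range T, p n ^ 2 / p n = P := by
    rw [← hP]
    refine Finset.sum_congr rfl fun n hn => ?_
    have := hp n (Finset.mem_range.mp hn)
    field_simp
  rw [h3, ← Real.sqrt_mul (Finset.sum_nonneg fun n hn =>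
    mul_nonneg (hp n (Finset.mem_range.mp hn)).le (sq_nonneg _))] at h1
  have h4 : √((∑ n ∈ Finset.range T, p n * q n ^ 2) * P) ≤ A * P := by
    refine Real.sqrt_le_iff.mpr ⟨by positivity, ?_⟩
    calc _ ≤ A ^ 2 * P * P := mul_le_mul_of_nonneg_right h2 hP0
      _ = _ := by ring
  have h5 := mul_le_mul_of_nonneg_left hE (show 0 ≤ 2 * G / c * A by positivity)
  linarith

end WeightedSums

section ShortHorizon

variable {E X : Type*} [NormedAddCommGroup E] [InnerProductSpace ℝ E]
  {k : X → X → ℝ} {φ : X → E} {η lam δ ε : ℝ} {x xs : ℕ → X} {ζ : ℕ → ℝ} {m : ℕ}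
  {feat : X → EuclideanSpace ℝ (Fin m)}

lemma postStd_sq (hk : ∀ z z', k z z' = inner ℝ (φ z) (φ z')) (hη : 0 < η) (hlam : 0 < lam)
    (x : ℕ → X) (n : ℕ) (z : X) :
    postStd k (expWeight η) lam x n z ^ 2 = postVar k (expWeight η) lam x n z :=
  Real.sq_sqrt (postVar_nonneg hk hη hlam x n z)

lemma postStd_le_one (hk : ∀ z z', k z z' = inner ℝ (φ z) (φ z')) (hk1 : ∀ z, k z z ≤ 1)
    (hη : 0 < η) (hlam : 0 < lam) (x : ℕ → X) (n : ℕ) (z : X) :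
    postStd k (expWeight η) lam x n z ≤ 1 :=
  Real.sqrt_le_one.mpr ((postVar_le_kernel hk hη hlam x n z).trans (hk1 z))

/-- Control of the exploration terms when `m T (1 - η)` is small, on the event that the mixture
supermartingale with constant regularizer stays below `1 / δ`. -/
lemma exploration_le_of_short (hk : ∀ z z', k z z' = inner ℝ (φ z) (φ z'))
    (hk1 : ∀ z, k z z ≤ 1) (hε0 : 0 ≤ ε)
    (hε : ∀ z z', |inner ℝ (φ z) (φ z') - inner ℝ (feat z) (feat z')| ≤ ε)
    (hη2 : 1 / 2 ≤ η) (hη' : η < 1) (hlam : 0 < lam) (hεη : 2 * ε ≤ 1 - η) (hm : 1 ≤ m)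
    (hδ : 0 < δ) (hδ' : δ < 1) {T : ℕ} (hT : (1 + 2 / lam) * (m * T * (1 - η)) ≤ 1 / 2)
    (hE : ∀ n ≤ T, mixture φ (expWeight η) x ζ lam n ≤ 1 / δ) :
    ∑ n ∈ Finset.range T, max (√(noiseForm φ (expWeight η) x ζ (doubleReg (expWeight η) lam n) n) -
        confRadius k η lam δ n) 0 * postStd k (expWeight η) lam x n (xs n) ≤
      4 * Real.exp 2 * (1 + shortConst lam) * (confRadius k η lam δ T *
        √(T * featGain (expWeight η) lam x T feat + m * T ^ 2 * (1 - η))) ∧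
    ∑ n ∈ Finset.range T, √(noiseForm φ (expWeight η) x ζ (doubleReg (expWeight η) lam n) n) *
        postStd k (expWeight η) lam x n (x (n + 1)) ≤
      (1 + 4 * Real.exp 2) * (confRadius k η lam δ T *
        √(T * ∑ n ∈ Finset.range T, postStd k (expWeight η) lam x n (x (n + 1)) ^ 2)) := by
  have : Nonempty X := ⟨x 0⟩
  have hη : 0 < η := by linarith
  have hκ : 0 < 1 - η := by linarith
  have hm' : (1 : ℝ) ≤ m := by exact_mod_cast hm
  have hΛ : 0 < 2 / lam := by positivity
  have hA := confRadius_mono (δ := δ) hk hk1 hη hlam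
  have hγ := featGain_nonneg hη hlam x T feat
  have hC := shortConst_pos hlam
  have hTκ : T * (1 - η) ≤ m * T * (1 - η) := by
    have : 0 ≤ T * (1 - η) := by positivity
    nlinarith
  have hb := fun n (hn : n ∈ Finset.range T) z => noise_and_excess_le_of_short
    (x := x) (ζ := ζ) (n := n)
    hk hk1 hη2 hη' hlam hδ hδ' (by
      have h1 : (n : ℝ) ≤ T := by exact_mod_cast (Finset.mem_range.mp hn).le
      have h2 : 0 ≤ m * T * (1 - η) := by positivity
      nlinarith) (by
      have h1 : (n : ℝ) ≤ T := by exact_mod_cast (Finset.mem_range.mp hn).le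
      calc _ ≤ T * (1 - η) * ((1 + 2 / lam) * m) :=
            mul_le_mul (mul_le_mul_of_nonneg_right h1 hκ.le)
              (effDim_doubleVec_le hε0 hε hη hη' hlam hεη hm x n)
              (effDim_nonneg (doubleReg_pos hη hlam n)) (by positivity)
        _ = (1 + 2 / lam) * (m * T * (1 - η)) := by ring
        _ ≤ _ := hT) (hE n (Finset.mem_range.mp hn).le) z
  constructor
  · refine (Finset.sum_le_card_nsmul _ _ (4 * Real.exp 2 * (1 + shortConst lam) *
      (√(1 - η) * confRadius k η lam δ T)) fun n hn => ?_).trans ?_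
    · refine (hb n hn (xs n)).2.trans ?_
      have := hA (Finset.mem_range.mp hn).le
      gcongr
    · rw [Finset.card_range, nsmul_eq_mul]
      have h1 : T * √(1 - η) ≤
          √(T * featGain (expWeight η) lam x T feat + m * T ^ 2 * (1 - η)) := by
        apply Real.le_sqrt_of_sq_le
        rw [mul_pow, Real.sq_sqrt hκ.le]
        have h2 : 0 ≤ T * featGain (expWeight η) lam x T feat := by positivity
        have h3 : (T : ℝ) ^ 2 * (1 - η) ≤ m * T ^ 2 * (1 - η) := by
          have : 0 ≤ (T : ℝ) ^ 2 * (1 - η) := by positivity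
          nlinarith
        linarith
      have h4 : 0 ≤ confRadius k η lam δ T := confRadius_nonneg T
      calc _ = 4 * Real.exp 2 * (1 + shortConst lam) * (confRadius k η lam δ T *
            (T * √(1 - η))) := by ring
        _ ≤ _ := by gcongr
  · calc _ ≤ ∑ n ∈ Finset.range T, (1 + 4 * Real.exp 2) * confRadius k η lam δ T *
          postStd k (expWeight η) lam x n (x (n + 1)) := by
          refine Finset.sum_le_sum fun n hn => mul_le_mul_of_nonneg_right ?_ (Real.sqrt_nonneg _)
          refine (hb n hn (xs n)).1.trans ?_
          have := hA (Finset.mem_range.mp hn).le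
          gcongr
      _ ≤ _ := by
          rw [← Finset.mul_sum, ← mul_assoc]
          refine mul_le_mul_of_nonneg_left (sum_mul_le_sqrt_card_mul _) ?_
          exact mul_nonneg (by positivity) (confRadius_nonneg T)

end ShortHorizon

end WGPUCB

namespace WGPUCB

section LongHorizon

/-- The scale `(n + 1)^{-1/2} + √κ` below which posterior standard deviations are harmless. -/
def stdScale (κ : ℝ) (n : ℕ) : ℝ := 1 / √(n + 1) + √κ

lemma stdScale_pos {κ : ℝ} (n : ℕ) : 0 < stdScale κ n := by
  have : 0 ≤ √κ := Real.sqrt_nonneg _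
  unfold stdScale
  positivity

lemma sum_one_div_sqrt_le (T : ℕ) : ∑ n ∈ Finset.range T, 1 / √((n : ℝ) + 1) ≤ 2 * √T := by
  induction T with
  | zero => simp
  | succ T ih =>
    rw [Finset.sum_range_succ]
    push_cast
    have h0 : (0 : ℝ) ≤ T := Nat.cast_nonneg T
    have h1 : 0 < √((T : ℝ) + 1) := Real.sqrt_pos.mpr (by positivity)
    have h2 : √((T : ℝ) + 1) ^ 2 = T + 1 := Real.sq_sqrt (by positivity)
    have h3 : √(T : ℝ) ^ 2 = T := Real.sq_sqrt h0
    have h4 : 1 / √((T : ℝ) + 1) ≤ 2 * √((T : ℝ) + 1) - 2 * √T := by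
      rw [div_le_iff₀ h1]
      nlinarith [sq_nonneg (√((T : ℝ) + 1) - √T)]
    linarith

lemma sum_stdScale_le (κ : ℝ) (T : ℕ) :
    ∑ n ∈ Finset.range T, stdScale κ n ≤ 2 * √T + T * √κ := by
  unfold stdScale
  rw [Finset.sum_add_distrib, Finset.sum_const, Finset.card_range, nsmul_eq_mul]
  exact add_le_add_left (sum_one_div_sqrt_le T) _

/-- The information gained per unit of variance in the long-horizon regime. -/
def longGain (lam : ℝ) : ℝ := √(4 + 8 * lam * Real.exp 5)

variable {E X : Type*} [NormedAddCommGroup E] [InnerProductSpace ℝ E]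
  {k : X → X → ℝ} {φ : X → E} {η lam δ ε : ℝ} {x xs : ℕ → X} {ζ : ℕ → ℝ} {m : ℕ}
  {feat : X → EuclideanSpace ℝ (Fin m)}

lemma exists_window {κ : ℝ} (hκ : 0 < κ) (hκ1 : κ ≤ 1 / 2) {n : ℕ} (hn : 0 < n) :
    ∃ M : ℕ, 0 < M ∧ M ≤ n ∧ M * κ ≤ 1 ∧ 1 / (M : ℝ) ≤ 2 * stdScale κ n ^ 2 := by
  have hn' : (1 : ℝ) ≤ n := by exact_mod_cast hn
  have hs0 : 0 ≤ √κ := Real.sqrt_nonneg _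
  have hssq : √κ ^ 2 = κ := Real.sq_sqrt hκ.le
  have ht : 0 < √((n : ℝ) + 1) := Real.sqrt_pos.mpr (by positivity)
  have htsq : (1 / √((n : ℝ) + 1)) ^ 2 = 1 / (n + 1) := by
    rw [div_pow, one_pow, Real.sq_sqrt (by positivity)]
  have ht0 : 0 ≤ 1 / √((n : ℝ) + 1) := by positivity
  have hfl : 1 / κ / 2 ≤ ⌊1 / κ⌋₊ := by
    have h1 := Nat.lt_floor_add_one (1 / κ)
    have h2 : (1 : ℝ) ≤ ⌊1 / κ⌋₊ := by
      exact_mod_cast (Nat.one_le_floor_iff _).mpr ((le_div_iff₀ hκ).mpr (by linarith))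
    linarith
  have hfl2 : (⌊1 / κ⌋₊ : ℝ) ≤ 1 / κ := Nat.floor_le (by positivity)
  have hflpos : 0 < ⌊1 / κ⌋₊ := by
    have : (0 : ℝ) < ⌊1 / κ⌋₊ := lt_of_lt_of_le (by positivity) hfl
    exact_mod_cast this
  have hsq : stdScale κ n ^ 2 = 1 / (n + 1) + κ + 2 * (1 / √((n : ℝ) + 1) * √κ) := by
    rw [stdScale, add_sq, htsq, hssq]
    ring
  have hcross : 0 ≤ 1 / √((n : ℝ) + 1) * √κ := by positivity
  have hinv : 0 < 1 / ((n : ℝ) + 1) := by positivity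
  refine ⟨min n ⌊1 / κ⌋₊, lt_min hn hflpos, min_le_left _ _, ?_, ?_⟩
  · have h1 : ((min n ⌊1 / κ⌋₊ : ℕ) : ℝ) ≤ 1 / κ :=
      le_trans (by exact_mod_cast min_le_right _ _) hfl2
    rwa [le_div_iff₀ hκ] at h1
  · rw [hsq]
    rcases min_choice n ⌊1 / κ⌋₊ with h | h <;> rw [h]
    · have h1 : 1 / (n : ℝ) ≤ 2 * (1 / (n + 1)) := by
        rw [mul_one_div, div_le_div_iff₀ (by linarith) (by linarith)]
        linarith
      linarith
    · have h1 : 1 / (⌊1 / κ⌋₊ : ℝ) ≤ 2 * κ := by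
        rw [div_le_iff₀ (by exact_mod_cast hflpos)]
        have h2 := mul_le_mul_of_nonneg_left hfl (show 0 ≤ 2 * κ by positivity)
        have h3 : 2 * κ * (1 / κ / 2) = 1 := by field_simp
        linarith
      linarith

lemma postStd_le_of_long (hk : ∀ z z', k z z' = inner ℝ (φ z) (φ z'))
    (hk1 : ∀ z, k z z ≤ 1) (hη2 : 1 / 2 ≤ η) (hη' : η < 1) (hlam : 0 < lam)
    (hδ : 0 < δ) (hδ' : δ < 1) (n : ℕ) (z : X) {D : ℝ}
    (hD : 1 + effDim (doubleVec φ (expWeight η) x) (Finset.range n)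
      (doubleReg (expWeight η) lam n) ≤ D) :
    postStd k (expWeight η) lam x n z ≤ stdScale (1 - η) n ∨
      (Real.log (1 + Real.exp (-4) / (2 * lam)) ≤ confRadius k η lam δ n ^ 2 ∧
        postStd k (expWeight η) lam x n z ≤ longGain lam * √D * (stdScale (1 - η) n *
          Real.exp (doubleGain k (expWeight η) lam n - logDet (doubleVec φ (expWeight η) x)
            (Finset.range n) (doubleReg (expWeight η) lam n) / 2))) := by
  have : Nonempty X := ⟨z⟩
  have hη : 0 < η := by linarith
  have hκ : 0 < 1 - η := by linarith
  have hpD := doubleReg_pos hη hlam n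
  have hs1 := postStd_le_one hk hk1 hη hlam x n z
  rcases Nat.eq_zero_or_pos n with rfl | hn
  · left
    have : 0 ≤ √(1 - η) := Real.sqrt_nonneg _
    simp only [stdScale, CharP.cast_eq_zero, zero_add, Real.sqrt_one, div_one]
    linarith
  rcases le_or_gt (postStd k (expWeight η) lam x n z) (stdScale (1 - η) n) with hle | hgt
  · exact Or.inl hle
  right
  obtain ⟨M, hM0, hMn, hMκ, hMinv⟩ := exists_window hκ (by linarith) hn
  have hM0' : (0 : ℝ) < M := by exact_mod_cast hM0
  have hL := logDet_le_two_mul_doubleGain hk hk1 (expWeight_pos hη) hlam x n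
  have hd0 := effDim_nonneg (ψ := doubleVec φ (expWeight η) x) (s := Finset.range n) hpD
  have hgain := fun (b : ℕ) hb hbd =>
    logDet_add_log_le_doubleGain hk hk1 hη2 hη' hlam x (n := n) (M := M) (b := b) hM0 hMn hb
      hMκ hbd z
  have hall := log_one_add_le_doubleGain hk hk1 hη2 hη' hlam hMn hMκ z
  have hasq := confRadius_sq hk hk1 hη hlam hδ hδ' n
  have hlog := log_one_div_nonneg hδ hδ'
  have hv0 := postVar_nonneg hk hη hlam x n z
  have hvk := postVar_le_kernel hk hη hlam x n z
  have hssq := postStd_sq hk hη hlam x n z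
  have hs0 : 0 ≤ postStd k (expWeight η) lam x n z := Real.sqrt_nonneg _
  have hp0 := stdScale_pos (κ := 1 - η) n
  have hvp : stdScale (1 - η) n ^ 2 ≤ postVar k (expWeight η) lam x n z := by
    rw [← hssq]
    exact pow_le_pow_left₀ hp0.le hgt.le 2
  set d := effDim (doubleVec φ (expWeight η) x) (Finset.range n) (doubleReg (expWeight η) lam n)
  set L := logDet (doubleVec φ (expWeight η) x) (Finset.range n) (doubleReg (expWeight η) lam n)
  set g := doubleGain k (expWeight η) lam n
  set v := postVar k (expWeight η) lam x n z
  set s := postStd k (expWeight η) lam x n z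
  set a := confRadius k η lam δ n
  set p := stdScale (1 - η) n
  clear_value d L g v s a p
  have hD1 : 1 ≤ D := by linarith
  constructor
  · have h1 : Real.exp (-4) / (2 * lam) ≤ M * Real.exp (-4) / lam * k z z := by
      have h2 : 1 ≤ 2 * M * k z z := by
        have h3 : 1 / (M : ℝ) ≤ 2 * k z z := by linarith
        rw [div_le_iff₀ hM0'] at h3
        linarith
      calc Real.exp (-4) / (2 * lam) = Real.exp (-4) / (2 * lam) * 1 := (mul_one _).symm
        _ ≤ Real.exp (-4) / (2 * lam) * (2 * M * k z z) := by gcongr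
        _ = _ := by field_simp
    have h4 := Real.log_le_log (by positivity) (by linarith :
      1 + Real.exp (-4) / (2 * lam) ≤ 1 + M * Real.exp (-4) / lam * k z z)
    linarith
  · have hexp : Real.exp (g - L / 2) ^ 2 = Real.exp (2 * g - L) := by
      rw [← Real.exp_nat_mul]
      push_cast
      ring_nf
    have hG : longGain lam ^ 2 = 4 + 8 * lam * Real.exp 5 := Real.sq_sqrt (by positivity)
    have hG0 : 0 ≤ longGain lam := Real.sqrt_nonneg _
    apply le_of_sq_le_sq _ (by positivity)
    rw [mul_pow, mul_pow, mul_pow, hexp, hG, hssq, Real.sq_sqrt (by linarith)]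
    have he : 1 ≤ Real.exp (2 * g - L) := Real.one_le_exp (by linarith)
    have hv1 : v ≤ 1 := by
      rw [← hssq]
      exact pow_le_one₀ hs0 hs1
    have h5 : 0 ≤ D * (p ^ 2 * Real.exp (2 * g - L)) := by positivity
    have h6 : 0 ≤ 8 * lam * Real.exp 5 * (D * (p ^ 2 * Real.exp (2 * g - L))) := by positivity
    rcases lt_or_ge (M : ℝ) (2 * D) with hMD | hMD
    · have h1 : 1 ≤ 4 * (D * p ^ 2) := by
        have h2 := mul_le_mul_of_nonneg_right hMinv hM0'.le
        rw [one_div_mul_cancel hM0'.ne'] at h2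
        have h3 : 2 * p ^ 2 * M ≤ 2 * p ^ 2 * (2 * D) := by gcongr
        linarith
      have h2 : D * p ^ 2 * 1 ≤ D * p ^ 2 * Real.exp (2 * g - L) := by gcongr
      linarith
    · set b := ⌊(M : ℝ) / (2 * D)⌋₊ with hb
      have hMD1 : 1 ≤ (M : ℝ) / (2 * D) := (le_div_iff₀ (by linarith)).mpr (by linarith)
      have hb1 : (b : ℝ) ≤ M / (2 * D) := Nat.floor_le (by positivity)
      have hb2 : (M : ℝ) / (4 * D) ≤ b := by
        have h1 := Nat.lt_floor_add_one ((M : ℝ) / (2 * D))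
        have h2 : (1 : ℝ) ≤ b := by exact_mod_cast (Nat.one_le_floor_iff _).mpr hMD1
        have h3 : (M : ℝ) / (4 * D) = M / (2 * D) / 2 := by
          field_simp
          norm_num
        linarith
      have hb3 : b * D ≤ M / 2 := by
        have h1 := mul_le_mul_of_nonneg_right hb1 (by linarith : 0 ≤ D)
        have h2 : (M : ℝ) / (2 * D) * D = M / 2 := by field_simp
        linarith
      have hb0 : (0 : ℝ) ≤ b := Nat.cast_nonneg b
      have hbd : b * d ≤ M / 2 :=
        (mul_le_mul_of_nonneg_left (by linarith) hb0).trans hb3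
      have hbM : b ≤ M := by
        have h1 : (b : ℝ) ≤ M := by nlinarith
        exact_mod_cast h1
      have h1 := hgain b hbM hbd
      have h2 : b * d / M ≤ 1 / 2 := by
        rw [div_le_iff₀ hM0']
        linarith
      have h3 : b * Real.exp (-4) / lam * v ≤ Real.exp 1 * Real.exp (2 * g - L) := by
        have h4 : Real.log (1 + b * Real.exp (-4) / lam * v) ≤ 1 + (2 * g - L) := by linarith
        rw [Real.log_le_iff_le_exp (by positivity), Real.exp_add] at h4
        linarith
      have h5 : b * v ≤ lam * Real.exp 5 * Real.exp (2 * g - L) := by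
        have h6 : b * v = lam * Real.exp 4 * (b * Real.exp (-4) / lam * v) := by
          rw [Real.exp_neg]
          field_simp
        have h7 : Real.exp 5 = Real.exp 4 * Real.exp 1 := by rw [← Real.exp_add]; norm_num
        rw [h6, h7]
        calc _ ≤ lam * Real.exp 4 * (Real.exp 1 * Real.exp (2 * g - L)) :=
              mul_le_mul_of_nonneg_left h3 (by positivity)
          _ = _ := by ring
      have h8 : M * v ≤ 4 * D * (lam * Real.exp 5 * Real.exp (2 * g - L)) := by
        have h9 := mul_le_mul_of_nonneg_right hb2 hv0
        have h10 : (M : ℝ) * v = 4 * D * (M / (4 * D) * v) := by field_simp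
        rw [h10]
        exact mul_le_mul_of_nonneg_left (h9.trans h5) (by linarith)
      have h11 : v ≤ 4 * D * (lam * Real.exp 5 * Real.exp (2 * g - L)) * (2 * p ^ 2) := by
        calc v = M * v * (1 / M) := by field_simp
          _ ≤ 4 * D * (lam * Real.exp 5 * Real.exp (2 * g - L)) * (2 * p ^ 2) :=
              mul_le_mul h8 hMinv (by positivity) (by positivity)
      linarith

/-- The constant of `exploration_le_of_long`. -/
def longConst (lam : ℝ) : ℝ :=
  (1 + 2 * longGain lam / Real.log (1 + Real.exp (-4) / (2 * lam))) *
    √(64 * (Real.exp 4 * (1 + 1 / lam)) * (1 + 2 / lam))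

lemma exists_effDim_le (hε0 : 0 ≤ ε)
    (hε : ∀ z z', |inner ℝ (φ z) (φ z') - inner ℝ (feat z) (feat z')| ≤ ε)
    (hη2 : 1 / 2 ≤ η) (hη' : η < 1) (hlam : 0 < lam) (hεη : 2 * ε ≤ 1 - η) (hm : 1 ≤ m)
    {T : ℕ} (hT : 1 / 2 < (1 + 2 / lam) * (m * T * (1 - η))) :
    ∃ D : ℝ, 1 ≤ D ∧ (∀ n < T, 1 + effDim (doubleVec φ (expWeight η) x) (Finset.range n)
        (doubleReg (expWeight η) lam n) ≤ D) ∧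
      D * (2 * √T + T * √(1 - η)) ^ 2 ≤
        64 * (Real.exp 4 * (1 + 1 / lam)) * (1 + 2 / lam) *
          (T * featGain (expWeight η) lam x T feat + m * T ^ 2 * (1 - η)) := by
  have hη : 0 < η := by linarith
  have hκ : 0 < 1 - η := by linarith
  have hm' : (1 : ℝ) ≤ m := by exact_mod_cast hm
  have hT0 : (0 : ℝ) ≤ T := Nat.cast_nonneg T
  have hγ := featGain_nonneg hη hlam x T feat
  have hN : 1 ≤ Real.exp 4 * (1 + 1 / lam) := by
    have h1 : 1 ≤ Real.exp 4 := Real.one_le_exp (by norm_num)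
    have h2 : 0 ≤ 1 / lam := by positivity
    nlinarith
  have hΛ : 1 ≤ 1 + 2 / lam := by
    have : 0 ≤ 2 / lam := by positivity
    linarith
  have hsq : (2 * √T + T * √(1 - η)) ^ 2 ≤ 8 * (T + T ^ 2 * (1 - η)) := by
    have h1 : √(T : ℝ) ^ 2 = T := Real.sq_sqrt hT0
    have h2 : √(1 - η) ^ 2 = 1 - η := Real.sq_sqrt hκ.le
    have h3 : (2 * √T + T * √(1 - η)) ^ 2 ≤ 2 * ((2 * √T) ^ 2 + (T * √(1 - η)) ^ 2) := by
      nlinarith [sq_nonneg (2 * √T - T * √(1 - η))]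
    rw [mul_pow, mul_pow, h1, h2] at h3
    have h4 : 0 ≤ (T : ℝ) ^ 2 * (1 - η) := by positivity
    linarith
  set N := Real.exp 4 * (1 + 1 / lam)
  set Λ := 1 + 2 / lam
  set γ := featGain (expWeight η) lam x T feat
  have hγT : 0 ≤ T * γ := by positivity
  have hmT : 0 ≤ m * T ^ 2 * (1 - η) := by positivity
  rcases le_or_gt 1 (T * (1 - η)) with hcase | hcase
  · refine ⟨2 * Λ * m, by nlinarith, fun n _ => ?_, ?_⟩
    · have := effDim_doubleVec_le hε0 hε hη hη' hlam hεη hm x n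
      nlinarith
    · have h1 : (T : ℝ) ≤ T ^ 2 * (1 - η) := by nlinarith
      calc _ ≤ 2 * Λ * m * (8 * (T ^ 2 * (1 - η) + T ^ 2 * (1 - η))) :=
            mul_le_mul_of_nonneg_left (by linarith) (by positivity)
        _ = 32 * 1 * Λ * (0 + m * T ^ 2 * (1 - η)) := by ring
        _ ≤ _ := by gcongr; norm_num
  · refine ⟨2 * N * (1 + γ), by nlinarith, fun n hn => ?_, ?_⟩
    · have := effDim_doubleVec_le_featGain hε0 hε hη2 hη' hlam hεη x hn.le hcase.le
      change _ ≤ N * (2 * γ + 1) at this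
      nlinarith
    · have h1 : (T : ℝ) ^ 2 * (1 - η) ≤ T := by nlinarith
      have h2 : (T : ℝ) ≤ 2 * Λ * (m * T ^ 2 * (1 - η)) := by
        have h3 := mul_le_mul_of_nonneg_left hT.le hT0
        linarith
      calc _ ≤ 2 * N * (1 + γ) * (8 * (T + T)) :=
            mul_le_mul_of_nonneg_left (by linarith) (by positivity)
        _ = 32 * N * (T * γ + T) := by ring
        _ ≤ 32 * N * (2 * Λ * (T * γ) + 2 * Λ * (m * T ^ 2 * (1 - η))) := by
            have : T * γ ≤ 2 * Λ * (T * γ) := by nlinarith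
            gcongr
        _ = _ := by ring

/-- Control of the exploration terms when `m T (1 - η)` is not small, on the event that a weighted
average of the mixtures, each with its current regularizer, is at most `1 / δ`. -/
lemma exploration_le_of_long (hk : ∀ z z', k z z' = inner ℝ (φ z) (φ z'))
    (hk1 : ∀ z, k z z ≤ 1) (hε0 : 0 ≤ ε)
    (hε : ∀ z z', |inner ℝ (φ z) (φ z') - inner ℝ (feat z) (feat z')| ≤ ε)
    (hη2 : 1 / 2 ≤ η) (hη' : η < 1) (hlam : 0 < lam) (hεη : 2 * ε ≤ 1 - η) (hm : 1 ≤ m)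
    (hδ : 0 < δ) (hδ' : δ < 1) {T : ℕ} (hT0 : 0 < T)
    (hT : 1 / 2 < (1 + 2 / lam) * (m * T * (1 - η)))
    (hE : ∑ n ∈ Finset.range T, stdScale (1 - η) n *
        mixture φ (expWeight η) x ζ (doubleReg (expWeight η) lam n) n ≤
      (1 / δ) * ∑ n ∈ Finset.range T, stdScale (1 - η) n) :
    ∑ n ∈ Finset.range T, max (√(noiseForm φ (expWeight η) x ζ (doubleReg (expWeight η) lam n) n) -
        confRadius k η lam δ n) 0 * postStd k (expWeight η) lam x n (xs n) ≤
      longConst lam * (confRadius k η lam δ T *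
        √(T * featGain (expWeight η) lam x T feat + m * T ^ 2 * (1 - η))) ∧
    ∑ n ∈ Finset.range T, √(noiseForm φ (expWeight η) x ζ (doubleReg (expWeight η) lam n) n) *
        postStd k (expWeight η) lam x n (x (n + 1)) ≤
      2 * (confRadius k η lam δ T *
        √(T * ∑ n ∈ Finset.range T, postStd k (expWeight η) lam x n (x (n + 1)) ^ 2)) := by
  have : Nonempty X := ⟨x 0⟩
  have hη : 0 < η := by linarith
  have hκ : 0 < 1 - η := by linarith
  have hT0' : (0 : ℝ) < T := by exact_mod_cast hT0
  have hmono := confRadius_mono (δ := δ) hk hk1 hη hlam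
  have hA0 : 0 ≤ confRadius k η lam δ T := confRadius_nonneg T
  obtain ⟨D, hD1, hD, hDP⟩ := exists_effDim_le (x := x) hε0 hε hη2 hη' hlam hεη hm hT
  have hg : ∀ n < T, 0 ≤ doubleGain k (expWeight η) lam n - logDet (doubleVec φ (expWeight η) x)
      (Finset.range n) (doubleReg (expWeight η) lam n) / 2 := fun n _ => by
    have := logDet_le_two_mul_doubleGain hk hk1 (expWeight_pos hη) hlam x n
    linarith
  have hE' : ∑ n ∈ Finset.range T, stdScale (1 - η) n * Real.exp
      ((√(noiseForm φ (expWeight η) x ζ (doubleReg (expWeight η) lam n) n) ^ 2 -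
        confRadius k η lam δ n ^ 2) / 2 + (doubleGain k (expWeight η) lam n -
          logDet (doubleVec φ (expWeight η) x)
            (Finset.range n) (doubleReg (expWeight η) lam n) / 2)) ≤
      ∑ n ∈ Finset.range T, stdScale (1 - η) n := by
    have h1 : ∀ n ∈ Finset.range T, stdScale (1 - η) n * Real.exp
        ((√(noiseForm φ (expWeight η) x ζ (doubleReg (expWeight η) lam n) n) ^ 2 -
          confRadius k η lam δ n ^ 2) / 2 + (doubleGain k (expWeight η) lam n -
            logDet (doubleVec φ (expWeight η) x)
              (Finset.range n) (doubleReg (expWeight η) lam n) / 2)) =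
        δ * (stdScale (1 - η) n *
          mixture φ (expWeight η) x ζ (doubleReg (expWeight η) lam n) n) := by
      intro n _
      have h2 : 0 ≤ noiseForm φ (expWeight η) x ζ (doubleReg (expWeight η) lam n) n :=
        ridgeForm_self_nonneg (doubleReg_pos hη hlam n) _
      rw [Real.sq_sqrt h2, confRadius_sq hk hk1 hη hlam hδ hδ', mul_left_comm δ, mixture]
      congr 1
      nth_rewrite 2 [← Real.exp_log hδ]
      rw [← Real.exp_add, one_div, Real.log_inv]
      ring_nf
    rw [Finset.sum_congr rfl h1, ← Finset.mul_sum]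
    calc _ ≤ δ * ((1 / δ) * ∑ n ∈ Finset.range T, stdScale (1 - η) n) :=
          mul_le_mul_of_nonneg_left hE hδ.le
      _ = _ := by field_simp
  have hP := sum_stdScale_le (1 - η) T
  constructor
  · have hc : 0 < Real.log (1 + Real.exp (-4) / (2 * lam)) := by
      apply Real.log_pos
      have : 0 < Real.exp (-4) / (2 * lam) := by positivity
      linarith
    have hG : 0 ≤ longGain lam := Real.sqrt_nonneg _
    have h1 := sum_excess_le_of_sum_exp_le (fun n _ => stdScale_pos n) hg
      (fun n _ => Real.sqrt_nonneg _) (fun n _ => confRadius_nonneg n)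
      (fun n hn => hmono hn.le) hA0 rfl hE' hc (G := longGain lam * √D)
      (mul_nonneg hG (Real.sqrt_nonneg _))
      (f := fun n => postStd k (expWeight η) lam x n (xs n)) (fun n _ => Real.sqrt_nonneg _)
      (fun n hn => postStd_le_of_long hk hk1 hη2 hη' hlam hδ hδ' n (xs n) (hD n hn))
    refine h1.trans ?_
    have hD1' : 1 ≤ √D := Real.one_le_sqrt.mpr hD1
    have hP0 : 0 ≤ 2 * √T + T * √(1 - η) := by positivity
    have hDP' : √D * (2 * √T + T * √(1 - η)) ≤
        √(64 * (Real.exp 4 * (1 + 1 / lam)) * (1 + 2 / lam)) *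
          √(T * featGain (expWeight η) lam x T feat + m * T ^ 2 * (1 - η)) := by
      rw [← Real.sqrt_mul (by positivity)]
      apply Real.le_sqrt_of_sq_le
      rwa [mul_pow, Real.sq_sqrt (by linarith)]
    calc _ ≤ (√D + 2 * (longGain lam * √D) / Real.log (1 + Real.exp (-4) / (2 * lam))) *
          (confRadius k η lam δ T * (2 * √T + T * √(1 - η))) :=
          mul_le_mul (add_le_add_left hD1' _) (mul_le_mul_of_nonneg_left hP hA0)
            (mul_nonneg hA0 (Finset.sum_nonneg fun n _ => (stdScale_pos n).le)) (by positivity)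
      _ = (1 + 2 * longGain lam / Real.log (1 + Real.exp (-4) / (2 * lam))) *
          confRadius k η lam δ T * (√D * (2 * √T + T * √(1 - η))) := by
          ring
      _ ≤ _ := mul_le_mul_of_nonneg_left hDP' (by positivity)
      _ = _ := by
          rw [longConst]
          ring
  · refine sum_mul_le_of_sum_exp_le (fun n _ => stdScale_pos n) hg
      (fun n _ => confRadius_nonneg n) (fun n hn => hmono hn.le) hA0 rfl hE'
      (pm := 1 / √T + √(1 - η)) (by positivity) (fun n hn => ?_) ?_ _
    · rw [stdScale]
      have h1 : (n : ℝ) + 1 ≤ T := by exact_mod_cast hn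
      gcongr
    · refine hP.trans ?_
      have h1 : √(T : ℝ) * √T = T := Real.mul_self_sqrt hT0'.le
      have h2 : 0 < √(T : ℝ) := Real.sqrt_pos.mpr hT0'
      have h3 : 2 * (T : ℝ) * (1 / √T + √(1 - η)) = 2 * √T + 2 * (T * √(1 - η)) := by
        have : (T : ℝ) * (1 / √T) = √T := by
          rw [mul_one_div, div_eq_iff h2.ne', h1]
        rw [mul_add]
        linear_combination 2 * this
      rw [h3]
      have : 0 ≤ T * √(1 - η) := by positivity
      linarith

end LongHorizon

end WGPUCB

namespace WGPUCB

section Regret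

variable {E X : Type*} [NormedAddCommGroup E] [InnerProductSpace ℝ E]
  {k : X → X → ℝ} {φ : X → E} {η lam δ ε B BT R : ℝ} {x xs : ℕ → X} {y ζ : ℕ → ℝ} {m c T : ℕ}
  {feat : X → EuclideanSpace ℝ (Fin m)} {f : ℕ → E}

lemma dynRegret_eq_sum_range (g : ℕ → X → ℝ) (xs x : ℕ → X) (T : ℕ) :
    dynRegret g xs x T = ∑ n ∈ Finset.range T, (g (n + 1) (xs (n + 1)) - g (n + 1) (x (n + 1))) := by
  have h : Finset.Icc 1 T = Finset.Ico 1 (T + 1) := by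
    ext
    simp only [Finset.mem_Icc, Finset.mem_Ico]
    omega
  rw [dynRegret, h, Finset.sum_Ico_eq_sum_range, Nat.add_sub_cancel]
  exact Finset.sum_congr rfl fun n _ => by rw [add_comm 1 n]

lemma confWidth_eq (k : X → X → ℝ) (η lam B R δ : ℝ) (n : ℕ) :
    confWidth k (expWeight η) lam n B R δ = B + 1 / √lam * R * confRadius k η lam δ n := rfl

lemma dynRegret_le_of_norm_le {b : ℝ} (hB0 : 0 ≤ B) (hB : ∀ n < T, ‖f (n + 1)‖ ≤ B)
    (hφ : ∀ z, ‖φ z‖ ≤ b) :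
    dynRegret (fun t z => inner ℝ (f t) (φ z)) xs x T ≤ 2 * B * b * T := by
  rw [dynRegret_eq_sum_range]
  refine (Finset.sum_le_card_nsmul _ _ (2 * B * b) fun n hn => ?_).trans (le_of_eq ?_)
  · have h1 : ∀ z, |inner ℝ (f (n + 1)) (φ z)| ≤ B * b := fun z =>
      (abs_real_inner_le_norm _ _).trans
        (mul_le_mul (hB n (Finset.mem_range.mp hn)) (hφ z) (norm_nonneg _) hB0)
    linarith [le_abs_self (inner ℝ (f (n + 1)) (φ (xs (n + 1)))), h1 (xs (n + 1)),
      neg_abs_le (inner ℝ (f (n + 1)) (φ (x (n + 1)))), h1 (x (n + 1))]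
  · rw [Finset.card_range, nsmul_eq_mul, mul_comm]

lemma regret_term_le (hη : 0 < η) (hη' : η < 1) (hlam : 0 < lam)
    (hk : ∀ z z', k z z' = inner ℝ (φ z) (φ z')) (hk1 : ∀ z, k z z ≤ 1)
    (hR : 0 ≤ R) {n : ℕ}
    (hy : ∀ i < n, y (i + 1) = inner ℝ (f (i + 1)) (φ (x (i + 1))) + R * ζ (i + 1))
    (hB : ∀ i ≤ n, ‖f (i + 1)‖ ≤ B) (c : ℕ)
    (hrun : ∀ z, ucb k (expWeight η) lam x y n B R δ z ≤
      ucb k (expWeight η) lam x y n B R δ (x (n + 1))) (z : X) :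
    inner ℝ (f (n + 1)) (φ z) - inner ℝ (f (n + 1)) (φ (x (n + 1))) ≤
      2 * (2 * B / lam * (η ^ c / (1 - η)) +
        recentDrift f c n * √(c * effDim (weightedVec φ (expWeight η) x) (Finset.range n)
          (reg (expWeight η) lam n) / lam)) +
      1 / √lam * R * (max (√(noiseForm φ (expWeight η) x ζ (doubleReg (expWeight η) lam n) n) -
        confRadius k η lam δ n) 0 * postStd k (expWeight η) lam x n z) +
      (B + confWidth k (expWeight η) lam n B R δ) * postStd k (expWeight η) lam x n (x (n + 1)) +
      1 / √lam * R * (√(noiseForm φ (expWeight η) x ζ (doubleReg (expWeight η) lam n) n) *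
        postStd k (expWeight η) lam x n (x (n + 1))) := by
  have hφ : ∀ z, ‖φ z‖ ≤ 1 := fun z => by
    apply le_of_sq_le_sq _ zero_le_one
    rw [← real_inner_self_eq_norm_sq, ← hk, one_pow]
    exact hk1 z
  have h1 := fun z' => abs_le.mp (abs_postMean_sub_le hη hη' hlam hk hR hy (hB n le_rfl) z')
  have h2 := abs_driftBias_le hη hη' hlam hφ x c hB
  have h3 := hrun z
  rw [ucb, ucb, confWidth_eq] at h3
  rw [confWidth_eq]
  have h4 := (h1 z).1
  have h5 := (h1 (x (n + 1))).2
  have h6 := h2 z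
  have h7 := h2 (x (n + 1))
  have hs : 0 ≤ postStd k (expWeight η) lam x n z := Real.sqrt_nonneg _
  set q := √(noiseForm φ (expWeight η) x ζ (doubleReg (expWeight η) lam n) n)
  set a := confRadius k η lam δ n
  set s := postStd k (expWeight η) lam x n z
  set s' := postStd k (expWeight η) lam x n (x (n + 1))
  have h8 : 1 / √lam * R * (q * s) ≤ 1 / √lam * R * (a * s) +
      1 / √lam * R * (max (q - a) 0 * s) := by
    rw [← mul_add, ← add_mul]
    have : q ≤ a + max (q - a) 0 := by linarith [le_max_left (q - a) 0]
    gcongr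
  linarith

lemma le_maxFeatGain (w : ℕ → ℝ) (lam : ℝ) (x : ℕ → X) {n T : ℕ} (hn : n ≤ T)
    (feat : X → EuclideanSpace ℝ (Fin m)) :
    featGain w lam x n feat ≤ maxFeatGain w lam x T feat :=
  Finset.le_sup' (fun t => featGain w lam x t feat) (Finset.mem_range.mpr (Nat.lt_succ_of_le hn))

lemma sum_bias_le (hε0 : 0 ≤ ε)
    (hε : ∀ z z', |inner ℝ (φ z) (φ z') - inner ℝ (feat z) (feat z')| ≤ ε)
    (hη : 0 < η) (hη' : η < 1) (hlam : 0 < lam) (hεη : 2 * ε ≤ 1 - η)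
    (hBT : ∑ t ∈ Finset.Ico 1 T, ‖f (t + 1) - f t‖ ≤ BT) (hc : 1 ≤ c) :
    ∑ n ∈ Finset.range T, 2 * (2 * B / lam * (η ^ c / (1 - η)) +
        recentDrift f c n * √(c * effDim (weightedVec φ (expWeight η) x) (Finset.range n)
          (reg (expWeight η) lam n) / lam)) ≤
      4 / lam * (B * η ^ c / (1 - η) * T) +
      2 * √(2 * (1 + 1 / lam) / lam) * ((c : ℝ) ^ (3 / 2 : ℝ) * BT *
        √(maxFeatGain (expWeight η) lam x T feat)) +
      4 / lam * (BT * ((c : ℝ) ^ 2 * √ε / (1 - η))) := by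
  have hκ : 0 < 1 - η := by linarith
  have hc' : (1 : ℝ) ≤ c := by exact_mod_cast hc
  have hBT0 : 0 ≤ BT := (Finset.sum_nonneg fun _ _ => norm_nonneg _).trans hBT
  have hγ : 0 ≤ maxFeatGain (expWeight η) lam x T feat :=
    (featGain_nonneg hη hlam x T feat).trans (le_maxFeatGain _ _ _ le_rfl _)
  set Γ := maxFeatGain (expWeight η) lam x T feat
  set S := √(c : ℝ) * (√(2 * (1 + 1 / lam) / lam) * √Γ + 2 / lam * (√ε / (1 - η))) with hS
  have hsqrt : ∀ n ∈ Finset.range T,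
      √(c * effDim (weightedVec φ (expWeight η) x) (Finset.range n)
        (reg (expWeight η) lam n) / lam) ≤ S := by
    intro n hn
    have h1 := effDim_weightedVec_le hε0 hε hη hη' hlam hεη x n
    have h2 := le_maxFeatGain (expWeight η) lam x (Finset.mem_range.mp hn).le feat
    have h3 : effDim (weightedVec φ (expWeight η) x) (Finset.range n) (reg (expWeight η) lam n) ≤
        (1 + 1 / lam) * (2 * Γ) + 2 * ε / (lam * (1 - η)) := by
      refine h1.trans (add_le_add_left (mul_le_mul_of_nonneg_left ?_ (by positivity)) _)
      exact mul_le_mul_of_nonneg_left h2 two_pos.le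
    refine Real.sqrt_le_iff.mpr ⟨by positivity, ?_⟩
    have h4 : (√(2 * (1 + 1 / lam) / lam) * √Γ) ^ 2 = 2 * (1 + 1 / lam) / lam * Γ := by
      rw [mul_pow, Real.sq_sqrt (by positivity), Real.sq_sqrt hγ]
    have h5 : 2 * ε / (lam * (1 - η)) / lam ≤ (2 / lam * (√ε / (1 - η))) ^ 2 := by
      rw [mul_pow, div_pow (√ε), Real.sq_sqrt hε0]
      have h6 : 2 * ε / (lam * (1 - η)) / lam = 2 * (1 - η) * (ε / (lam ^ 2 * (1 - η) ^ 2)) := by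
        field_simp
      have h7 : (2 / lam) ^ 2 * (ε / (1 - η) ^ 2) = 4 * (ε / (lam ^ 2 * (1 - η) ^ 2)) := by
        field_simp
        ring
      rw [h6, h7]
      refine mul_le_mul_of_nonneg_right (by linarith) (by positivity)
    have h8 : 0 ≤ √(2 * (1 + 1 / lam) / lam) * √Γ * (2 / lam * (√ε / (1 - η))) := by positivity
    rw [hS, mul_pow, Real.sq_sqrt (Nat.cast_nonneg c), mul_div_assoc]
    refine mul_le_mul_of_nonneg_left ?_ (Nat.cast_nonneg c)
    have h9 := div_le_div_of_nonneg_right h3 hlam.le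
    have h10 : ((1 + 1 / lam) * (2 * Γ) + 2 * ε / (lam * (1 - η))) / lam =
        2 * (1 + 1 / lam) / lam * Γ + 2 * ε / (lam * (1 - η)) / lam := by ring
    rw [add_sq, h4]
    linarith
  have hS0 : 0 ≤ S := by positivity
  have h1 : ∑ n ∈ Finset.range T, recentDrift f c n *
      √(c * effDim (weightedVec φ (expWeight η) x) (Finset.range n)
        (reg (expWeight η) lam n) / lam) ≤ c * BT * S := by
    calc _ ≤ ∑ n ∈ Finset.range T, recentDrift f c n * S :=
          Finset.sum_le_sum fun n hn =>
            mul_le_mul_of_nonneg_left (hsqrt n hn) (recentDrift_nonneg f c n)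
      _ ≤ _ := by
          rw [← Finset.sum_mul]
          refine mul_le_mul_of_nonneg_right ?_ hS0
          exact (sum_recentDrift_le f c T).trans
            (mul_le_mul_of_nonneg_left hBT (Nat.cast_nonneg c))
  rw [← Finset.mul_sum, Finset.sum_add_distrib, Finset.sum_const, Finset.card_range, nsmul_eq_mul]
  have h2 : (c : ℝ) ^ (3 / 2 : ℝ) = c * √c := by
    rw [show (3 / 2 : ℝ) = 1 + 1 / 2 by norm_num, Real.rpow_add (by linarith), Real.rpow_one,
      Real.sqrt_eq_rpow]
  have h3 : (c : ℝ) * √c ≤ c ^ 2 := by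
    rw [sq]
    have : √(c : ℝ) ≤ c := Real.sqrt_le_iff.mpr ⟨by linarith, by nlinarith⟩
    gcongr
  have h4 : c * √c * (BT * (√ε / (1 - η))) ≤ c ^ 2 * (BT * (√ε / (1 - η))) :=
    mul_le_mul_of_nonneg_right h3 (by positivity)
  have h5 := mul_le_mul_of_nonneg_left h4 (show 0 ≤ 4 / lam by positivity)
  rw [h2]
  calc _ ≤ 2 * (T * (2 * B / lam * (η ^ c / (1 - η))) + c * BT * S) := by linarith
    _ = 4 / lam * (B * η ^ c / (1 - η) * T) +
        2 * √(2 * (1 + 1 / lam) / lam) * (c * √c * BT * √Γ) +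
        4 / lam * (c * √c * (BT * (√ε / (1 - η)))) := by
        rw [hS]
        ring
    _ ≤ 4 / lam * (B * η ^ c / (1 - η) * T) +
        2 * √(2 * (1 + 1 / lam) / lam) * (c * √c * BT * √Γ) +
        4 / lam * (c ^ 2 * (BT * (√ε / (1 - η)))) := by linarith
    _ = _ := by ring

lemma confWidth_mono (hk : ∀ z z', k z z' = inner ℝ (φ z) (φ z')) (hk1 : ∀ z, k z z ≤ 1)
    (hη : 0 < η) (hlam : 0 < lam) (hR : 0 ≤ R) [Nonempty X] :
    Monotone fun n => confWidth k (expWeight η) lam n B R δ := by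
  intro n n' h
  simp only [confWidth_eq]
  have := confRadius_mono (δ := δ) hk hk1 hη hlam h
  gcongr

/-- The regret bound of the non-trivial regime, given the control of the exploration terms. -/
lemma dynRegret_le_of_exploration_le (hk : ∀ z z', k z z' = inner ℝ (φ z) (φ z'))
    (hk1 : ∀ z, k z z ≤ 1) (hε0 : 0 ≤ ε)
    (hε : ∀ z z', |inner ℝ (φ z) (φ z') - inner ℝ (feat z) (feat z')| ≤ ε)
    (hη2 : 1 / 2 ≤ η) (hη' : η < 1) (hlam : 0 < lam) (hεη : 2 * ε ≤ 1 - η)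
    (hR : 0 ≤ R) (hB0 : 0 ≤ B) (hB : ∀ n < T, ‖f (n + 1)‖ ≤ B)
    (hBT : ∑ t ∈ Finset.Ico 1 T, ‖f (t + 1) - f t‖ ≤ BT) (hc : 1 ≤ c)
    (hy : ∀ n < T, y (n + 1) = inner ℝ (f (n + 1)) (φ (x (n + 1))) + R * ζ (n + 1))
    (hrun : IsRun k (expWeight η) lam B R δ T x y) {C₁ C₂ : ℝ} (hC₁ : 0 ≤ C₁) (hC₂ : 0 ≤ C₂)
    (h₁ : ∑ n ∈ Finset.range T,
      max (√(noiseForm φ (expWeight η) x ζ (doubleReg (expWeight η) lam n) n) -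
        confRadius k η lam δ n) 0 * postStd k (expWeight η) lam x n (xs (n + 1)) ≤
      C₁ * (confRadius k η lam δ T *
        √(T * featGain (expWeight η) lam x T feat + m * T ^ 2 * (1 - η))))
    (h₂ : ∑ n ∈ Finset.range T, √(noiseForm φ (expWeight η) x ζ (doubleReg (expWeight η) lam n) n) *
        postStd k (expWeight η) lam x n (x (n + 1)) ≤
      C₂ * (confRadius k η lam δ T *
        √(T * ∑ n ∈ Finset.range T, postStd k (expWeight η) lam x n (x (n + 1)) ^ 2))) :
    dynRegret (fun t z => inner ℝ (f t) (φ z)) xs x T ≤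
      (C₁ + (2 + C₂) * √(2 * ((lam + 1) * (1 + 4 / lam)))) *
        (confWidth k (expWeight η) lam T B R δ *
          √(T * featGain (expWeight η) lam x T feat + m * T ^ 2 * (1 - η))) +
      2 * √(2 * (1 + 1 / lam) / lam) * ((c : ℝ) ^ (3 / 2 : ℝ) * BT *
        √(maxFeatGain (expWeight η) lam x T feat)) +
      4 / lam * (B * η ^ c / (1 - η) * T) +
      4 / lam * (BT * ((c : ℝ) ^ 2 * √ε / (1 - η))) +
      2 * (2 + C₂) * (confWidth k (expWeight η) lam T B R δ * T * √ε / (1 - η)) := by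
  have : Nonempty X := ⟨x 0⟩
  have hη : 0 < η := by linarith
  have hκ : 0 < 1 - η := by linarith
  have hT0 : (0 : ℝ) ≤ T := Nat.cast_nonneg T
  have hγ := featGain_nonneg hη hlam x T feat
  rw [dynRegret_eq_sum_range]
  have hterm := fun n (hn : n ∈ Finset.range T) => by
    have hn' := Finset.mem_range.mp hn
    have h := regret_term_le (ζ := ζ) hη hη' hlam hk hk1 hR (fun i hi => hy i (hi.trans hn'))
      (fun i hi => hB i (by omega)) c (fun z => by
        simpa using hrun (n + 1) (Finset.mem_Icc.mpr ⟨by omega, hn'⟩) z) (xs (n + 1))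
    exact h
  refine (Finset.sum_le_sum hterm).trans ?_
  rw [Finset.sum_add_distrib, Finset.sum_add_distrib, Finset.sum_add_distrib,
    ← Finset.mul_sum _ _ (1 / √lam * R), ← Finset.mul_sum _ _ (1 / √lam * R)]
  have hbias := sum_bias_le (x := x) (B := B) hε0 hε hη hη' hlam hεη hBT hc
  have hβmono := confWidth_mono (B := B) (δ := δ) hk hk1 hη hlam hR
  have hβ := confWidth_eq k η lam B R δ T
  have ha0 : 0 ≤ confRadius k η lam δ T := confRadius_nonneg T
  have hRl : 0 ≤ 1 / √lam * R := by positivity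
  have hmain : ∑ n ∈ Finset.range T, (B + confWidth k (expWeight η) lam n B R δ) *
      postStd k (expWeight η) lam x n (x (n + 1)) ≤
      2 * confWidth k (expWeight η) lam T B R δ *
        √(T * ∑ n ∈ Finset.range T, postStd k (expWeight η) lam x n (x (n + 1)) ^ 2) := by
    have hRa : 0 ≤ 1 / √lam * R * confRadius k η lam δ T := by positivity
    refine le_trans ?_ (mul_le_mul_of_nonneg_left (sum_mul_le_sqrt_card_mul
      fun n => postStd k (expWeight η) lam x n (x (n + 1))) (by linarith))
    rw [Finset.mul_sum]
    refine Finset.sum_le_sum fun n hn => mul_le_mul_of_nonneg_right ?_ (Real.sqrt_nonneg _)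
    have h := hβmono (Finset.mem_range.mp hn).le
    simp only at h
    linarith
  have hV : √(T * ∑ n ∈ Finset.range T, postStd k (expWeight η) lam x n (x (n + 1)) ^ 2) ≤
      √(2 * ((lam + 1) * (1 + 4 / lam))) *
        √(T * featGain (expWeight η) lam x T feat + m * T ^ 2 * (1 - η)) +
      2 * (T * √ε / (1 - η)) := by
    have hV1 := sum_postVar_le hk hk1 hε0 hε hη2 hη' hlam hεη x T
    simp only [postStd_sq hk hη hlam]
    refine Real.sqrt_le_iff.mpr ⟨by positivity, ?_⟩
    have h1 : (√(2 * ((lam + 1) * (1 + 4 / lam))) *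
        √(T * featGain (expWeight η) lam x T feat + m * T ^ 2 * (1 - η))) ^ 2 =
        2 * ((lam + 1) * (1 + 4 / lam)) *
          (T * featGain (expWeight η) lam x T feat + m * T ^ 2 * (1 - η)) := by
      rw [mul_pow, Real.sq_sqrt (by positivity), Real.sq_sqrt (by positivity)]
    have h2 : 2 * ε * T ^ 2 ≤ (2 * (T * √ε / (1 - η))) ^ 2 := by
      rw [mul_pow, div_pow, mul_pow, Real.sq_sqrt hε0, ← mul_div_assoc,
        le_div_iff₀ (by positivity)]
      have h3 : (1 - η) ^ 2 ≤ 1 := pow_le_one₀ hκ.le (by linarith)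
      have h4 : 0 ≤ ε * T ^ 2 := by positivity
      nlinarith
    have h5 : 0 ≤ √(2 * ((lam + 1) * (1 + 4 / lam))) *
        √(T * featGain (expWeight η) lam x T feat + m * T ^ 2 * (1 - η)) *
          (2 * (T * √ε / (1 - η))) := by positivity
    have h6 := mul_le_mul_of_nonneg_left hV1 hT0
    rw [add_sq, h1]
    have h7 : T * ((lam + 1) * (1 + 4 / lam) * (2 * featGain (expWeight η) lam x T feat +
        2 * (1 - η) * m * T) + 2 * ε * T) = 2 * ((lam + 1) * (1 + 4 / lam)) *
          (T * featGain (expWeight η) lam x T feat + m * T ^ 2 * (1 - η)) + 2 * ε * T ^ 2 := by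
      ring
    linarith
  have hE1 := mul_le_mul_of_nonneg_left h₁ hRl
  have hE2 := mul_le_mul_of_nonneg_left h₂ hRl
  set G := √(T * featGain (expWeight η) lam x T feat + m * T ^ 2 * (1 - η))
  set V := √(T * ∑ n ∈ Finset.range T, postStd k (expWeight η) lam x n (x (n + 1)) ^ 2)
  set β := confWidth k (expWeight η) lam T B R δ
  set a := confRadius k η lam δ T
  have hG0 : 0 ≤ G := Real.sqrt_nonneg _
  have hV0 : 0 ≤ V := Real.sqrt_nonneg _
  have hβ0 : 0 ≤ β := by
    rw [hβ]
    positivity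
  have haβ : 1 / √lam * R * a ≤ β := by linarith
  have h3 : 1 / √lam * R * (C₁ * (a * G)) ≤ C₁ * (β * G) := by
    calc _ = C₁ * (1 / √lam * R * a * G) := by ring
      _ ≤ _ := by gcongr
  have h4 : 1 / √lam * R * (C₂ * (a * V)) ≤ C₂ * (β * V) := by
    calc _ = C₂ * (1 / √lam * R * a * V) := by ring
      _ ≤ _ := by gcongr
  have h5 : (2 + C₂) * (β * V) ≤ (2 + C₂) * (β *
      (√(2 * ((lam + 1) * (1 + 4 / lam))) * G + 2 * (T * √ε / (1 - η)))) := by gcongr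
  have h6 : (2 + C₂) * (β *
      (√(2 * ((lam + 1) * (1 + 4 / lam))) * G + 2 * (T * √ε / (1 - η)))) =
      (2 + C₂) * √(2 * ((lam + 1) * (1 + 4 / lam))) * (β * G) +
        2 * (2 + C₂) * (β * T * √ε / (1 - η)) := by ring
  linarith

end Regret

end WGPUCB

namespace WGPUCB

/-- The quantity that bounds the dynamic regret up to a constant factor. -/
def regretTerms {X : Type*} (k : X → X → ℝ) (η lam B BT R δ ε : ℝ) (T c : ℕ) (x : ℕ → X)
    {m : ℕ} (feat : X → EuclideanSpace ℝ (Fin m)) : ℝ :=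
  confWidth k (expWeight η) lam T B R δ *
      √(T * featGain (expWeight η) lam x T feat + m * T ^ 2 * Real.log (1 / η)) +
    (c : ℝ) ^ (3 / 2 : ℝ) * BT *
      √(maxFeatGain (expWeight η) lam x T feat + m * c * Real.log (1 / η)) +
    B * η ^ c / (1 - η) * T +
    BT * ((c : ℝ) ^ 2 * √ε / (1 - η)) +
    confWidth k (expWeight η) lam T B R δ * T * √ε / (1 - η)

/-- The constant of the exploration bounds for the excess of the noise. -/
def excessConst (lam : ℝ) : ℝ := 4 * Real.exp 2 * (1 + shortConst lam) + longConst lam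

/-- The constant of the regret bound. -/
def regretConst (lam : ℝ) : ℝ :=
  (excessConst lam + (2 + (3 + 4 * Real.exp 2)) * √(2 * ((lam + 1) * (1 + 4 / lam)))) +
    2 * √(2 * (1 + 1 / lam) / lam) + 4 / lam + 2 * (2 + (3 + 4 * Real.exp 2))

section Deterministic

variable {E X : Type*} [NormedAddCommGroup E] [InnerProductSpace ℝ E]
  {k : X → X → ℝ} {φ : X → E} {η lam δ ε B BT R : ℝ} {x xs : ℕ → X} {y ζ : ℕ → ℝ} {m c T : ℕ}
  {feat : X → EuclideanSpace ℝ (Fin m)} {f : ℕ → E}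

lemma longConst_nonneg (hlam : 0 < lam) : 0 ≤ longConst lam := by
  have h : 0 ≤ Real.log (1 + Real.exp (-4) / (2 * lam)) := by
    apply Real.log_nonneg
    have : 0 < Real.exp (-4) / (2 * lam) := by positivity
    linarith
  have h2 : 0 ≤ longGain lam := Real.sqrt_nonneg _
  unfold longConst
  positivity

lemma excessConst_nonneg (hlam : 0 < lam) : 0 ≤ excessConst lam := by
  have h1 := shortConst_pos hlam
  have h2 := longConst_nonneg hlam
  unfold excessConst
  positivity

lemma regretConst_ge (hlam : 0 < lam) : 10 ≤ regretConst lam := by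
  have h1 := excessConst_nonneg hlam
  unfold regretConst
  have h2 : 0 ≤ (2 + (3 + 4 * Real.exp 2)) * √(2 * ((lam + 1) * (1 + 4 / lam))) := by positivity
  have h3 : 0 ≤ 2 * √(2 * (1 + 1 / lam) / lam) := by positivity
  have h4 : 0 ≤ 4 / lam := by positivity
  have h5 := Real.exp_pos 2
  linarith

lemma one_sub_le_log (hη : 0 < η) : 1 - η ≤ Real.log (1 / η) := by
  have h := Real.log_le_sub_one_of_pos hη
  rw [one_div, Real.log_inv]
  linarith

lemma le_confWidth (hlam : 0 < lam) (hR : 0 ≤ R) : B ≤ confWidth k (expWeight η) lam T B R δ := by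
  rw [confWidth_eq]
  have : 0 ≤ 1 / √lam * R * confRadius k η lam δ T :=
    mul_nonneg (by positivity) (confRadius_nonneg T)
  linarith

/-- The regret bound when one of its terms exceeds the trivial bound `2 B T`. -/
lemma dynRegret_le_of_degenerate (hk : ∀ z z', k z z' = inner ℝ (φ z) (φ z'))
    (hk1 : ∀ z, k z z ≤ 1)
    (hε : ∀ z z', |inner ℝ (φ z) (φ z') - inner ℝ (feat z) (feat z')| ≤ ε)
    (hη : 0 < η) (hη' : η < 1) (hlam : 0 < lam)
    (hR : 0 ≤ R) (hB0 : 0 ≤ B) (hB : ∀ n < T, ‖f (n + 1)‖ ≤ B) (hBT : 0 ≤ BT)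
    (h : m = 0 ∨ η < 1 / 2 ∨ 1 - η ≤ √ε) :
    dynRegret (fun t z => inner ℝ (f t) (φ z)) xs x T ≤
      10 * regretTerms k η lam B BT R δ ε T c x feat := by
  have hκ : 0 < 1 - η := by linarith
  have hnorm : ∀ z, ‖φ z‖ ^ 2 = k z z := fun z => by rw [hk, real_inner_self_eq_norm_sq]
  have hγ := featGain_nonneg hη hlam x T feat
  have hlog := one_sub_le_log hη
  have hlog0 : 0 ≤ Real.log (1 / η) := hκ.le.trans hlog
  have hβB := le_confWidth (k := k) (η := η) (B := B) (δ := δ) (T := T) hlam hR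
  rw [regretTerms]
  set β := confWidth k (expWeight η) lam T B R δ
  have hβ0 : 0 ≤ β := hB0.trans hβB
  set γ := featGain (expWeight η) lam x T feat
  have t1 : 0 ≤ β * √(T * γ + m * T ^ 2 * Real.log (1 / η)) := by positivity
  have t2 : 0 ≤ (c : ℝ) ^ (3 / 2 : ℝ) * BT *
      √(maxFeatGain (expWeight η) lam x T feat + m * c * Real.log (1 / η)) := by positivity
  have t3 : 0 ≤ B * η ^ c / (1 - η) * T := by positivity
  have t4 : 0 ≤ BT * ((c : ℝ) ^ 2 * √ε / (1 - η)) := by positivity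
  have t5 : 0 ≤ β * T * √ε / (1 - η) := by positivity
  have hφ1 : ∀ z, ‖φ z‖ ≤ 1 := fun z => by
    apply le_of_sq_le_sq _ zero_le_one
    rw [hnorm, one_pow]
    exact hk1 z
  have htriv := dynRegret_le_of_norm_le (xs := xs) (x := x) hB0 hB hφ1
  have hBβT : B * T ≤ β * T := by gcongr
  by_cases hm : m = 0
  · subst hm
    have hφε : ∀ z, ‖φ z‖ ≤ √ε := fun z => by
      apply Real.le_sqrt_of_sq_le
      have h1 := hε z z
      rw [Subsingleton.elim (feat z) 0, inner_zero_left, sub_zero, real_inner_self_eq_norm_sq] at h1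
      exact (le_abs_self _).trans h1
    have h1 := dynRegret_le_of_norm_le (xs := xs) (x := x) hB0 hB hφε
    have h2 : β * T * √ε ≤ β * T * √ε / (1 - η) := by
      rw [le_div_iff₀ hκ]
      exact mul_le_of_le_one_right (by positivity) (by linarith)
    have h3 : B * T * √ε ≤ β * T * √ε := by gcongr
    linarith
  have hm' : (1 : ℝ) ≤ m := by exact_mod_cast Nat.one_le_iff_ne_zero.mpr hm
  rcases h with h | h | h
  · exact absurd h hm
  · have h1 : (T : ℝ) / 2 ≤ √(T * γ + m * T ^ 2 * Real.log (1 / η)) := by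
      apply Real.le_sqrt_of_sq_le
      have h2 : 0 ≤ T * γ := by positivity
      have h3 : (1 : ℝ) * T ^ 2 * (1 / 2) ≤ m * T ^ 2 * Real.log (1 / η) := by
        gcongr
        linarith
      nlinarith [sq_nonneg (T : ℝ)]
    have h2 := mul_le_mul_of_nonneg_left h1 hβ0
    linarith
  · have h1 : β * T ≤ β * T * √ε / (1 - η) := by
      rw [le_div_iff₀ hκ]
      gcongr
    linarith

/-- The regret bound in the non-degenerate regime, given the exploration bounds. -/
lemma dynRegret_le_regretTerms (hk : ∀ z z', k z z' = inner ℝ (φ z) (φ z'))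
    (hk1 : ∀ z, k z z ≤ 1) (hε0 : 0 ≤ ε)
    (hε : ∀ z z', |inner ℝ (φ z) (φ z') - inner ℝ (feat z) (feat z')| ≤ ε)
    (hη2 : 1 / 2 ≤ η) (hη' : η < 1) (hlam : 0 < lam) (hεη : 2 * ε ≤ 1 - η)
    (hR : 0 ≤ R) (hB0 : 0 ≤ B) (hB : ∀ n < T, ‖f (n + 1)‖ ≤ B)
    (hBT : ∑ t ∈ Finset.Ico 1 T, ‖f (t + 1) - f t‖ ≤ BT) (hc : 1 ≤ c)
    (hy : ∀ n < T, y (n + 1) = inner ℝ (f (n + 1)) (φ (x (n + 1))) + R * ζ (n + 1))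
    (hrun : IsRun k (expWeight η) lam B R δ T x y) {C₁ C₂ : ℝ}
    (hC₁ : C₁ ≤ excessConst lam) (hC₂ : C₂ ≤ 3 + 4 * Real.exp 2)
    (h : ∑ n ∈ Finset.range T,
      max (√(noiseForm φ (expWeight η) x ζ (doubleReg (expWeight η) lam n) n) -
        confRadius k η lam δ n) 0 * postStd k (expWeight η) lam x n (xs (n + 1)) ≤
      C₁ * (confRadius k η lam δ T *
        √(T * featGain (expWeight η) lam x T feat + m * T ^ 2 * (1 - η))) ∧
      ∑ n ∈ Finset.range T, √(noiseForm φ (expWeight η) x ζ (doubleReg (expWeight η) lam n) n) *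
        postStd k (expWeight η) lam x n (x (n + 1)) ≤
      C₂ * (confRadius k η lam δ T *
        √(T * ∑ n ∈ Finset.range T, postStd k (expWeight η) lam x n (x (n + 1)) ^ 2))) :
    dynRegret (fun t z => inner ℝ (f t) (φ z)) xs x T ≤
      regretConst lam * regretTerms k η lam B BT R δ ε T c x feat := by
  have hη : 0 < η := by linarith
  have hκ : 0 < 1 - η := by linarith
  have ha : 0 ≤ confRadius k η lam δ T := confRadius_nonneg T
  have hex := excessConst_nonneg hlam
  have h1 := dynRegret_le_of_exploration_le (xs := xs) hk hk1 hε0 hε hη2 hη' hlam hεη hR hB0 hB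
    hBT hc hy hrun hex (by positivity : 0 ≤ 3 + 4 * Real.exp 2)
    (h.1.trans (mul_le_mul_of_nonneg_right hC₁ (by positivity)))
    (h.2.trans (mul_le_mul_of_nonneg_right hC₂ (by positivity)))
  refine h1.trans ?_
  have hγ := featGain_nonneg hη hlam x T feat
  have hBT0 : 0 ≤ BT := (Finset.sum_nonneg fun _ _ => norm_nonneg _).trans hBT
  have hlog := one_sub_le_log hη
  have hlog0 : 0 ≤ Real.log (1 / η) := hκ.le.trans hlog
  have hβ0 : 0 ≤ confWidth k (expWeight η) lam T B R δ :=
    hB0.trans (le_confWidth hlam hR)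
  rw [regretTerms]
  set β := confWidth k (expWeight η) lam T B R δ
  set γ := featGain (expWeight η) lam x T feat
  set Γ := maxFeatGain (expWeight η) lam x T feat
  have t1 : β * √(T * γ + m * T ^ 2 * (1 - η)) ≤
      β * √(T * γ + m * T ^ 2 * Real.log (1 / η)) := by gcongr
  have t2 : (c : ℝ) ^ (3 / 2 : ℝ) * BT * √Γ ≤ (c : ℝ) ^ (3 / 2 : ℝ) * BT *
      √(Γ + m * c * Real.log (1 / η)) := by
    have : 0 ≤ m * c * Real.log (1 / η) := by positivity
    refine mul_le_mul_of_nonneg_left (Real.sqrt_le_sqrt (by linarith)) (by positivity)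
  have s1 : 0 ≤ β * √(T * γ + m * T ^ 2 * (1 - η)) := by positivity
  have s2 : 0 ≤ (c : ℝ) ^ (3 / 2 : ℝ) * BT * √Γ := by positivity
  have s3 : 0 ≤ B * η ^ c / (1 - η) * T := by positivity
  have s4 : 0 ≤ BT * ((c : ℝ) ^ 2 * √ε / (1 - η)) := by positivity
  have s5 : 0 ≤ β * T * √ε / (1 - η) := by positivity
  have c1 : 0 ≤ excessConst lam +
      (2 + (3 + 4 * Real.exp 2)) * √(2 * ((lam + 1) * (1 + 4 / lam))) := by positivity
  have c2 : 0 ≤ 2 * √(2 * (1 + 1 / lam) / lam) := by positivity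
  have c3 : 0 ≤ 4 / lam := by positivity
  have c4 : 0 ≤ 2 * (2 + (3 + 4 * Real.exp 2)) := by positivity
  have hC : 0 ≤ regretConst lam := by linarith [regretConst_ge hlam]
  refine le_trans (add_le_add (add_le_add (add_le_add (add_le_add
    (mul_le_mul ?_ t1 s1 hC) (mul_le_mul ?_ t2 s2 hC))
    (mul_le_mul_of_nonneg_right ?_ s3)) (mul_le_mul_of_nonneg_right ?_ s4))
    (mul_le_mul_of_nonneg_right ?_ s5)) (le_of_eq (by ring :
      regretConst lam * _ + regretConst lam * _ + regretConst lam * _ + regretConst lam * _ +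
        regretConst lam * _ = _))
  all_goals
    rw [regretConst]
    linarith

end Deterministic

section History

variable {Ω X : Type*} [MeasurableSpace X] {x : ℕ → Ω → X} {y : ℕ → Ω → ℝ}

lemma measurable_query_historySigma {s t : ℕ} (hs : 1 ≤ s) (hst : s ≤ t) :
    Measurable[historySigma x y t] (x s) := by
  rw [measurable_iff_comap_le]
  rcases hst.eq_or_lt with rfl | hst
  · exact le_sup_right
  · exact (le_sup_left.trans (le_iSup₂_of_le s (Finset.mem_Ico.mpr ⟨hs, hst⟩) le_rfl)).trans
      le_sup_left

lemma measurable_reward_historySigma {s t : ℕ} (hs : 1 ≤ s) (hst : s < t) :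
    Measurable[historySigma x y t] (y s) := by
  rw [measurable_iff_comap_le]
  exact (le_sup_right.trans (le_iSup₂_of_le s (Finset.mem_Ico.mpr ⟨hs, hst⟩) le_rfl)).trans
    le_sup_left

end History

section Probability

variable {Ω : Type*} {F : MeasurableSpace Ω} [m0 : MeasurableSpace Ω] {μ : Measure Ω}

lemma CondSubGaussian.div {ξ : Ω → ℝ} {R : ℝ}
    (h : CondSubGaussian μ F ξ R) (hR : 0 < R) :
    CondSubGaussian μ F (fun ω => ξ ω / R) 1 := by
  intro u
  have h1 := h (u / R)
  have h2 : (fun ω => Real.exp (u * (ξ ω / R))) = fun ω => Real.exp (u / R * ξ ω) := by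
    ext ω
    congr 1
    ring
  have h3 : u ^ 2 * 1 ^ 2 / 2 = (u / R) ^ 2 * R ^ 2 / 2 := by
    field_simp
  rw [h2, h3]
  exact h1

lemma condSubGaussian_zero [IsProbabilityMeasure μ] (hF : F ≤ m0) :
    CondSubGaussian μ F (fun _ => 0) 1 := by
  intro u
  simp only [mul_zero, Real.exp_zero]
  refine ⟨integrable_const _, ?_⟩
  rw [condExp_const hF]
  exact Filter.Eventually.of_forall fun _ => Real.one_le_exp (by positivity)

lemma CondSubGaussian.ae_eq_zero [IsProbabilityMeasure μ] (hF : F ≤ m0)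
    {ξ : Ω → ℝ} (h : CondSubGaussian μ F ξ 0) : ∀ᵐ ω ∂μ, ξ ω = 0 := by
  have hle : ∀ u : ℝ, ∫ ω, Real.exp (u * ξ ω) ∂μ ≤ 1 := by
    intro u
    have h1 := (h u).2
    rw [← integral_condExp hF]
    refine (integral_mono_ae integrable_condExp (integrable_const _) h1).trans ?_
    simp
  have hi2 : Integrable (fun ω => Real.exp (1 * ξ ω) + Real.exp (-1 * ξ ω)) μ :=
    (h 1).1.add (h (-1)).1
  have hi : Integrable (fun ω => Real.exp (1 * ξ ω) + Real.exp (-1 * ξ ω) - 2) μ :=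
    hi2.sub (integrable_const _)
  have hpos : ∀ t : ℝ, 0 ≤ Real.exp (1 * t) + Real.exp (-1 * t) - 2 := by
    intro t
    have h1 := Real.add_one_le_exp (1 * t)
    have h2 := Real.add_one_le_exp (-1 * t)
    linarith
  have h0 : ∫ ω, (Real.exp (1 * ξ ω) + Real.exp (-1 * ξ ω) - 2) ∂μ = 0 := by
    refine le_antisymm ?_ (integral_nonneg fun ω => hpos _)
    rw [integral_sub hi2 (integrable_const _),
      integral_add (h 1).1 (h (-1)).1]
    simp only [integral_const, probReal_univ, one_smul]
    linarith [hle 1, hle (-1)]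
  rw [integral_eq_zero_iff_of_nonneg (fun ω => hpos _) hi] at h0
  filter_upwards [h0] with ω hω
  by_contra hne
  have h1 := Real.add_one_lt_exp (x := 1 * ξ ω) (by simpa using hne)
  have h2 := Real.add_one_le_exp (-1 * ξ ω)
  simp only [Pi.zero_apply] at hω
  linarith

lemma one_sub_le_measureReal [IsProbabilityMeasure μ] {S G : Set Ω} {δ : ℝ}
    (hS : μ Sᶜ ≤ ENNReal.ofReal δ) (hδ : 0 ≤ δ) (h : ∀ᵐ ω ∂μ, ω ∈ S → ω ∈ G) :
    1 - δ ≤ μ.real G := by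
  have h1 : μ S ≤ μ G := measure_mono_ae h
  have h2 : (1 : ENNReal) ≤ μ G + ENNReal.ofReal δ := by
    rw [← measure_univ (μ := μ), ← Set.union_compl_self S]
    exact (measure_union_le _ _).trans (add_le_add h1 hS)
  have h3 := ENNReal.toReal_mono
    (ENNReal.add_ne_top.mpr ⟨measure_ne_top μ G, ENNReal.ofReal_ne_top⟩) h2
  rw [ENNReal.toReal_add (measure_ne_top μ G) ENNReal.ofReal_ne_top, ENNReal.toReal_ofReal hδ,
    ENNReal.toReal_one] at h3
  have h4 : μ.real G = (μ G).toReal := rfl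
  linarith

variable {X : Type*} [MeasurableSpace X] {x : ℕ → Ω → X} {y : ℕ → Ω → ℝ} {T : ℕ}

lemma historySigma_le (hx : ∀ t ∈ Finset.Icc 1 T, Measurable (x t))
    (hy : ∀ t ∈ Finset.Icc 1 T, Measurable (y t)) {t : ℕ} (ht : t ∈ Finset.Icc 1 T) :
    historySigma x y t ≤ m0 := by
  have ht' := Finset.mem_Icc.mp ht
  refine sup_le (iSup₂_le fun s hs => ?_) (hx t ht).comap_le
  have hs' := Finset.mem_Ico.mp hs
  have hs'' : s ∈ Finset.Icc 1 T := Finset.mem_Icc.mpr ⟨hs'.1, by omega⟩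
  exact sup_le (hx s hs'').comap_le (hy s hs'').comap_le

lemma isNoise_of_condSubGaussian [IsProbabilityMeasure μ] {g : ℕ → X → ℝ}
    (hg : ∀ t, Measurable (g t)) {ξ : ℕ → Ω → ℝ} {R : ℝ} (hR : 0 ≤ R)
    (hx : ∀ t ∈ Finset.Icc 1 T, Measurable (x t)) (hξ : ∀ t ∈ Finset.Icc 1 T, Measurable (ξ t))
    (hy : ∀ t ∈ Finset.Icc 1 T, ∀ ω, y t ω = g t (x t ω) + ξ t ω)
    (hsub : ∀ t ∈ Finset.Icc 1 T, CondSubGaussian μ (historySigma x y t) (ξ t) R) :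
    IsNoise μ (historySigma x y) x (fun t ω => (y t ω - g t (x t ω)) / R) T := by
  have hym : ∀ t ∈ Finset.Icc 1 T, Measurable (y t) := fun t ht => by
    rw [show y t = fun ω => g t (x t ω) + ξ t ω from funext (hy t ht)]
    exact ((hg t).comp (hx t ht)).add (hξ t ht)
  have hmem : ∀ n < T, n + 1 ∈ Finset.Icc 1 T := fun n hn =>
    Finset.mem_Icc.mpr ⟨by omega, hn⟩
  refine ⟨fun n hn => historySigma_le hx hym (hmem n hn),
    fun n _ i hi => measurable_query_historySigma (by omega) (by omega), fun n _ i hi => ?_,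
    fun n hn => ?_, fun n hn => ?_⟩
  · have h1 := measurable_query_historySigma (x := x) (y := y)
      (show 1 ≤ i + 1 by omega) (show i + 1 ≤ n + 1 by omega)
    have h2 := measurable_reward_historySigma (x := x) (y := y)
      (show 1 ≤ i + 1 by omega) (show i + 1 < n + 1 by omega)
    exact (h2.sub ((hg (i + 1)).comp h1)).div_const R
  · exact ((hym _ (hmem n hn)).sub ((hg (n + 1)).comp (hx _ (hmem n hn)))).div_const R
  · have h1 : (fun ω => (y (n + 1) ω - g (n + 1) (x (n + 1) ω)) / R) =
        fun ω => ξ (n + 1) ω / R := by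
      ext ω
      rw [hy _ (hmem n hn), add_sub_cancel_left]
    rcases hR.lt_or_eq with hR' | hR'
    · rw [h1]
      exact (hsub _ (hmem n hn)).div hR'
    · subst hR'
      simp only [div_zero]
      exact condSubGaussian_zero (historySigma_le hx hym (hmem n hn))

/-- The reward equation with normalized noise, which only holds almost surely if `R = 0`. -/
lemma ae_reward_eq [IsProbabilityMeasure μ] {g : ℕ → X → ℝ}
    (hg : ∀ t, Measurable (g t)) {ξ : ℕ → Ω → ℝ} {R : ℝ}
    (hx : ∀ t ∈ Finset.Icc 1 T, Measurable (x t)) (hξ : ∀ t ∈ Finset.Icc 1 T, Measurable (ξ t))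
    (hy : ∀ t ∈ Finset.Icc 1 T, ∀ ω, y t ω = g t (x t ω) + ξ t ω)
    (hsub : ∀ t ∈ Finset.Icc 1 T, CondSubGaussian μ (historySigma x y t) (ξ t) R) :
    ∀ᵐ ω ∂μ, ∀ n < T, y (n + 1) ω = g (n + 1) (x (n + 1) ω) +
      R * ((y (n + 1) ω - g (n + 1) (x (n + 1) ω)) / R) := by
  have hym : ∀ t ∈ Finset.Icc 1 T, Measurable (y t) := fun t ht => by
    rw [show y t = fun ω => g t (x t ω) + ξ t ω from funext (hy t ht)]
    exact ((hg t).comp (hx t ht)).add (hξ t ht)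
  rw [ae_all_iff]
  intro n
  by_cases hn : n < T
  · have hmem : n + 1 ∈ Finset.Icc 1 T := Finset.mem_Icc.mpr ⟨by omega, hn⟩
    rcases eq_or_ne R 0 with rfl | hR
    · filter_upwards [(hsub _ hmem).ae_eq_zero (historySigma_le hx hym hmem)] with ω hω _
      rw [hy _ hmem, hω]
      simp
    · refine Filter.Eventually.of_forall fun ω _ => ?_
      field_simp
      ring
  · exact Filter.Eventually.of_forall fun ω h => absurd h hn

/-- The dynamic regret bound for a kernel given by a feature map into an inner product space. -/
theorem measureReal_dynRegret_le [IsProbabilityMeasure μ] {E : Type*} [NormedAddCommGroup E]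
    [InnerProductSpace ℝ E] {k : X → X → ℝ} {φ : X → E} {η lam δ ε B BT R : ℝ} {xs : ℕ → X}
    {m c : ℕ} {feat : X → EuclideanSpace ℝ (Fin m)} {f : ℕ → E} {ξ : ℕ → Ω → ℝ}
    (hk : ∀ z z', k z z' = inner ℝ (φ z) (φ z')) (hk1 : ∀ z, k z z ≤ 1)
    (hφ : Measurable fun q : X × X => inner ℝ (φ q.1) (φ q.2))
    (hf : ∀ t, Measurable fun z => inner ℝ (f t) (φ z))
    (hε : ∀ z z', |k z z' - inner ℝ (feat z) (feat z')| ≤ ε)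
    (hη : 0 < η) (hη' : η < 1) (hlam : 0 < lam) (hδ : 0 < δ) (hδ' : δ < 1)
    (hR : 0 ≤ R) (hB : ∀ t ∈ Finset.Icc 1 T, ‖f t‖ ≤ B)
    (hBT : ∑ t ∈ Finset.Ico 1 T, ‖f (t + 1) - f t‖ ≤ BT) (hc : 1 ≤ c)
    (hx : ∀ t ∈ Finset.Icc 1 T, Measurable (x t)) (hξ : ∀ t ∈ Finset.Icc 1 T, Measurable (ξ t))
    (hy : ∀ t ∈ Finset.Icc 1 T, ∀ ω, y t ω = inner ℝ (f t) (φ (x t ω)) + ξ t ω)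
    (hsub : ∀ t ∈ Finset.Icc 1 T, CondSubGaussian μ (historySigma x y t) (ξ t) R)
    (hrun : ∀ ω, IsRun k (expWeight η) lam B R δ T (fun t => x t ω) (fun t => y t ω)) :
    1 - δ ≤ μ.real {ω | dynRegret (fun t z => inner ℝ (f t) (φ z)) xs (fun t => x t ω) T ≤
      regretConst lam * regretTerms k η lam B BT R δ ε T c (fun t => x t ω) feat} := by
  have hC := regretConst_ge hlam
  have hBT0 : 0 ≤ BT := (Finset.sum_nonneg fun _ _ => norm_nonneg _).trans hBT
  have hκ : 0 < 1 - η := by linarith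
  have hall : (∀ ω, dynRegret (fun t z => inner ℝ (f t) (φ z)) xs (fun t => x t ω) T ≤
      regretConst lam * regretTerms k η lam B BT R δ ε T c (fun t => x t ω) feat) →
      1 - δ ≤ μ.real {ω | dynRegret (fun t z => inner ℝ (f t) (φ z)) xs (fun t => x t ω) T ≤
        regretConst lam * regretTerms k η lam B BT R δ ε T c (fun t => x t ω) feat} := by
    intro h
    exact one_sub_le_measureReal (S := Set.univ) (by simp) hδ.le
      (Filter.Eventually.of_forall fun ω _ => h ω)
  rcases Nat.eq_zero_or_pos T with rfl | hT
  · refine hall fun ω => ?_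
    have h1 : dynRegret (fun t z => inner ℝ (f t) (φ z)) xs (fun t => x t ω) 0 = 0 := by
      simp [dynRegret]
    have h2 : 0 ≤ regretTerms k η lam B BT R δ ε 0 c (fun t => x t ω) feat := by
      have h3 : 0 ≤ (c : ℝ) ^ (3 / 2 : ℝ) * BT *
        √(maxFeatGain (expWeight η) lam (fun t => x t ω) 0 feat + m * c * Real.log (1 / η)) := by
        positivity
      have h4 : 0 ≤ BT * ((c : ℝ) ^ 2 * √ε / (1 - η)) := by positivity
      simp only [regretTerms, CharP.cast_eq_zero]
      norm_num
      norm_num at h3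
      linarith
    rw [h1]
    exact mul_nonneg (by linarith) h2
  have hB' : ∀ n < T, ‖f (n + 1)‖ ≤ B := fun n hn =>
    hB _ (Finset.mem_Icc.mpr ⟨by omega, hn⟩)
  have hB0 : 0 ≤ B := (norm_nonneg _).trans (hB' 0 hT)
  simp only [hk] at hε
  by_cases hdeg : m = 0 ∨ η < 1 / 2 ∨ 1 - η ≤ √ε
  · refine hall fun ω => ?_
    have h1 := dynRegret_le_of_degenerate (xs := xs) (x := fun t => x t ω) (c := c) (δ := δ)
      hk hk1 hε hη hη' hlam hR hB0 hB' hBT0 hdeg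
    refine h1.trans (mul_le_mul_of_nonneg_right hC ?_)
    have h2 : 0 ≤ confWidth k (expWeight η) lam T B R δ := hB0.trans (le_confWidth hlam hR)
    unfold regretTerms
    positivity
  push Not at hdeg
  obtain ⟨hm, hη2, hεη⟩ := hdeg
  have hm1 : 1 ≤ m := Nat.one_le_iff_ne_zero.mpr hm
  have : Nonempty Ω := by
    by_contra h
    rw [not_nonempty_iff] at h
    have := measure_univ (μ := μ)
    simp [Set.univ_eq_empty_iff.mpr h] at this
  obtain ⟨ω₀⟩ := this
  have hε0 : 0 ≤ ε := (abs_nonneg _).trans (hε (x 1 ω₀) (x 1 ω₀))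
  have hεκ : 2 * ε ≤ 1 - η := by
    have h1 := Real.sq_sqrt hε0
    have h2 := Real.sqrt_nonneg ε
    nlinarith
  have hnoise := isNoise_of_condSubGaussian hf hR hx hξ hy hsub
  have hae := ae_reward_eq hf hx hξ hy hsub
  set ζ : ℕ → Ω → ℝ := fun t ω => (y t ω - inner ℝ (f t) (φ (x t ω))) / R
  obtain ⟨S, hS, hSb⟩ : ∃ S : Set Ω, μ Sᶜ ≤ ENNReal.ofReal δ ∧ ∀ ω ∈ S, ∃ C₁ C₂ : ℝ,
      C₁ ≤ excessConst lam ∧ C₂ ≤ 3 + 4 * Real.exp 2 ∧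
      ∑ n ∈ Finset.range T,
        max (√(noiseForm φ (expWeight η) (fun t => x t ω) (fun t => ζ t ω)
            (doubleReg (expWeight η) lam n) n) - confRadius k η lam δ n) 0 *
          postStd k (expWeight η) lam (fun t => x t ω) n (xs (n + 1)) ≤
        C₁ * (confRadius k η lam δ T *
          √(T * featGain (expWeight η) lam (fun t => x t ω) T feat + m * T ^ 2 * (1 - η))) ∧
      ∑ n ∈ Finset.range T, √(noiseForm φ (expWeight η) (fun t => x t ω) (fun t => ζ t ω)
          (doubleReg (expWeight η) lam n) n) *
          postStd k (expWeight η) lam (fun t => x t ω) n (x (n + 1) ω) ≤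
        C₂ * (confRadius k η lam δ T * √(T * ∑ n ∈ Finset.range T,
          postStd k (expWeight η) lam (fun t => x t ω) n (x (n + 1) ω) ^ 2)) := by
    have hlong := longConst_nonneg hlam
    have hshort := shortConst_pos hlam
    have hexp := Real.exp_pos 2
    rcases le_or_gt ((1 + 2 / lam) * (m * T * (1 - η))) (1 / 2) with hcase | hcase
    · refine ⟨_, hnoise.measure_mixture_le (w := expWeight η) (p := lam) hlam hφ hδ le_rfl,
        fun ω hω => ⟨_, _, ?_, ?_, exploration_le_of_short (xs := fun n => xs (n + 1)) hk hk1 hε0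
          hε hη2 hη' hlam hεκ hm1 hδ hδ' hcase hω⟩⟩
      · rw [excessConst]
        linarith
      · linarith
    · refine ⟨_, hnoise.measure_sum_mixture_le (w := expWeight η) (c := stdScale (1 - η))
        (fun n => doubleReg_pos hη hlam n) hφ hδ (fun n => (stdScale_pos n).le)
        (Finset.sum_pos (fun n _ => stdScale_pos n) ⟨0, Finset.mem_range.mpr hT⟩),
        fun ω hω => ⟨_, _, ?_, ?_, exploration_le_of_long (xs := fun n => xs (n + 1)) hk hk1 hε0
          hε hη2 hη' hlam hεκ hm1 hδ hδ' hT hcase hω⟩⟩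
      · rw [excessConst]
        have : 0 ≤ 4 * Real.exp 2 * (1 + shortConst lam) := by positivity
        linarith
      · linarith
  refine one_sub_le_measureReal hS hδ.le ?_
  filter_upwards [hae] with ω hω hωS
  obtain ⟨C₁, C₂, hC₁, hC₂, hb⟩ := hSb ω hωS
  exact dynRegret_le_regretTerms (ζ := fun t => ζ t ω) hk hk1 hε0 hε hη2 hη' hlam hεκ hR hB0 hB'
    hBT hc hω (hrun ω) hC₁ hC₂ hb

end Probability

end WGPUCB

namespace WGPUCB

section Kernel

variable {H X : Type*} [NormedAddCommGroup H] [InnerProductSpace ℝ H] [CompleteSpace H]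
  [RKHS ℝ H X ℝ]

lemma kernelFun_eq_inner (z z' : X) :
    kernelFun H z z' = inner ℝ (RKHS.kerFun H z 1) (RKHS.kerFun H z' 1) := by
  rw [kernelFun, RKHS.kerFun_inner, RKHS.kerFun_apply]
  simp

lemma continuous_kerFun_one [TopologicalSpace X]
    (h : Continuous fun p : X × X => kernelFun H p.1 p.2) :
    Continuous fun z : X => RKHS.kerFun H z (1 : ℝ) := by
  rw [continuous_iff_continuousAt]
  intro z₀
  rw [ContinuousAt, tendsto_iff_norm_sub_tendsto_zero]
  have h1 : ∀ z : X, ‖RKHS.kerFun H z (1 : ℝ) - RKHS.kerFun H z₀ 1‖ =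
      √(kernelFun H z z - 2 * kernelFun H z z₀ + kernelFun H z₀ z₀) := fun z => by
    rw [kernelFun_eq_inner, kernelFun_eq_inner, kernelFun_eq_inner, real_inner_self_eq_norm_sq,
      real_inner_self_eq_norm_sq, ← norm_sub_sq_real, Real.sqrt_sq (norm_nonneg _)]
  simp only [h1]
  have h2 : Continuous fun z : X =>
      √(kernelFun H z z - 2 * kernelFun H z z₀ + kernelFun H z₀ z₀) :=
    (((h.comp (continuous_id.prodMk continuous_id)).sub
      (continuous_const.mul (h.comp (continuous_id.prodMk continuous_const)))).add
        continuous_const).sqrt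
  have h3 := h2.tendsto z₀
  rwa [show kernelFun H z₀ z₀ - 2 * kernelFun H z₀ z₀ + kernelFun H z₀ z₀ = 0 by ring,
    Real.sqrt_zero] at h3

end Kernel

end WGPUCB

end

theorem theorem4 (lam : ℝ) (hlam : 0 < lam) :
    ∃ C : ℝ, 0 < C ∧
      ∀ (d : ℕ) (D : Set (EuclideanSpace ℝ (Fin d))) (_hD : IsCompact D)
        -- the reproducing kernel Hilbert space on `D` and its kernel
        (H : Type*) [NormedAddCommGroup H] [InnerProductSpace ℝ H] [CompleteSpace H]
        [RKHS ℝ H D ℝ]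
        (_hcont : Continuous fun p : D × D => WGPUCB.kernelFun H p.1 p.2)
        (_hk : ∀ z : D, WGPUCB.kernelFun H z z ≤ 1)
        -- the reward functions, their variation budget and their maximizers
        (T : ℕ) (f : ℕ → H) (B BT : ℝ)
        (_hB : ∀ t ∈ Finset.Icc 1 T, ‖f t‖ ≤ B)
        (_hBT : ∑ t ∈ Finset.Ico 1 T, ‖f (t + 1) - f t‖ ≤ BT)
        (xstar : ℕ → D) (_hxstar : ∀ t ∈ Finset.Icc 1 T, ∀ z : D, f t z ≤ f t (xstar t))
        -- the parameters
        (R δ η : ℝ) (_hR : 0 ≤ R) (_hδ : 0 < δ) (_hδ' : δ < 1) (_hη : 0 < η) (_hη' : η < 1)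
        (c : ℕ) (_hc : 1 ≤ c)
        -- the finite-dimensional feature map with its uniform approximation error
        (m : ℕ) (feat : D → EuclideanSpace ℝ (Fin m)) (_hfeat : Measurable feat) (ε : ℝ)
        (_hε : ∀ z z' : D, |WGPUCB.kernelFun H z z' - inner ℝ (feat z) (feat z')| ≤ ε)
        -- the noise, the queries and the noisy rewards
        (Ω : Type*) [MeasurableSpace Ω] (μ : MeasureTheory.Measure Ω)
        [MeasureTheory.IsProbabilityMeasure μ]
        (x : ℕ → Ω → D) (ξ y : ℕ → Ω → ℝ)
        (_hx : ∀ t ∈ Finset.Icc 1 T, Measurable (x t))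
        (_hξ : ∀ t ∈ Finset.Icc 1 T, Measurable (ξ t))
        (_hy : ∀ t ∈ Finset.Icc 1 T, ∀ ω, y t ω = f t (x t ω) + ξ t ω)
        (_hsub : ∀ t ∈ Finset.Icc 1 T,
          WGPUCB.CondSubGaussian μ (WGPUCB.historySigma x y t) (ξ t) R)
        (_hrun : ∀ ω, WGPUCB.IsRun (WGPUCB.kernelFun H) (WGPUCB.expWeight η) lam B R δ T
          (fun t => x t ω) (fun t => y t ω)),
        1 - δ ≤ μ.real {ω |
          WGPUCB.dynRegret (fun t z => f t z) xstar (fun t => x t ω) T ≤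
            C * (WGPUCB.confWidth (WGPUCB.kernelFun H) (WGPUCB.expWeight η) lam T B R δ *
                  √(T * WGPUCB.featGain (WGPUCB.expWeight η) lam (fun t => x t ω) T feat +
                    m * T ^ 2 * Real.log (1 / η))
              + (c : ℝ) ^ (3 / 2 : ℝ) * BT *
                  √(WGPUCB.maxFeatGain (WGPUCB.expWeight η) lam (fun t => x t ω) T feat +
                    m * c * Real.log (1 / η))
              + B * η ^ c / (1 - η) * T
              + BT * ((c : ℝ) ^ 2 * √ε / (1 - η))
              + WGPUCB.confWidth (WGPUCB.kernelFun H) (WGPUCB.expWeight η) lam T B R δ *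
                  T * √ε / (1 - η))} := by
  refine ⟨WGPUCB.regretConst lam, by linarith [WGPUCB.regretConst_ge hlam], ?_⟩
  intro d D _ H _ _ _ _ hcont hk1 T f B BT hB hBT xstar _ R δ η hR hδ hδ' hη hη' c hc m feat _ ε hε
    Ω _ μ _ x ξ y hx hξ hy hsub hrun
  have hk := WGPUCB.kernelFun_eq_inner (H := H) (X := D)
  have hφ := WGPUCB.continuous_kerFun_one hcont
  have hf : ∀ (t : ℕ) (z : D), f t z = inner ℝ (f t) (RKHS.kerFun H z 1) := fun t z => by
    simp
  have hreg : (fun (t : ℕ) (z : D) => f t z) =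
      fun t z => inner ℝ (f t) (RKHS.kerFun H z (1 : ℝ)) := funext₂ hf
  rw [hreg]
  refine WGPUCB.measureReal_dynRegret_le hk hk1 (hφ.fst'.inner hφ.snd').measurable
    (fun t => (continuous_const.inner hφ).measurable) hε hη hη' hlam hδ hδ' hR hB hBT hc hx hξ
    (fun t ht ω => ?_) hsub hrun
  rw [hy t ht, hf]
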